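/- Let $k\ge 2$ be an integer and $\sigma>0$. There is a constant $C>0$ depending only on $k$ and $\sigma$ such that the following holds. *Setting.* Let $\Omega\subset\mathbb R^2$ be a bounded polygonal domain, $f\in L^2(\Omega)$, and let $u\in H_0^2(\Omega)$ be the weak solution of the clamped Kirchhoff plate problem, $$\int_\Omega \nabla^2u:\nabla^2v\,dx=\int_\Omega f\,v\,dx\qquad\text{for all }v\in H^2_0(\Omega).$$ Let $\mathcal T_h$ be a decomposition of $\Omega$ into finitely many disjoint (open) simple polygons $K$, with $h_K=\operatorname{diam}K$; straight angles at vertices are allowed, and every edge of an element either lies on $\partial\Omega$ or is an interior edge, i.e. lies inside $\Omega$ (up to endpoints) and is also an edge of another element. Assume that each $K$ has a conforming triangulation $\mathcal T_K$ such that every edge of $K$ is a side of a triangle of $\mathcal T_K$ and every $\tau\in\mathcal T_K$ satisfies $\operatorname{diam}\tau\ge\sigma h_K$ and contains a disc of radius $\sigma\operatorname{diam}\tau$. *Discrete space.* For an edge $e$ of $K$ let $\boldsymbol n_e,\boldsymbol t_e$ be the unit normal (outward from $K$) and a unit tangent, $h_e=|e|$ its length, and $Q^e_{2k-1}g$ the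 Gauss–Lobatto quadrature of $\int_e g\,ds$ with $k+1$ points. For a function $v$ let $\Pi_K^\nabla v\in\mathbb P_k(K)$ be defined by $$(\nabla\Pi_K^\nabla v,\nabla q)_K=-(v,\Delta q)_K+\sum_{e\subset\partial K}Q^e_{2k-1}(v\,\partial_{\boldsymbol n_e}q)\quad\forall q\in\mathbb P_k(K),\qquad \sum_{z}\Pi_K^\nabla v(z)=\sum_{z}v(z),$$ the last sums being over the vertices $z$ of $K$. Let $V_k(K)$ be the set of $v\in H^2(K)$ with $\Delta^2v\in\mathbb P_k(K)$ and, on each edge $e$ of $K$, $v|_e\in\mathbb P_{k+2}(e)$ and $\partial_{\boldsymbol n_e}v|_e\in\mathbb P_{k+1}(e)$, such that - $\nabla v(z)=\nabla\Pi_K^\nabla v(z)$ at each vertex $z$ of $K$; - $\int_e \partial_{\boldsymbol n_e}v\,m\,ds=\int_e\partial_{\boldsymbol n_e}\Pi_K^\nabla v\,m\,ds$ for each edge $e$ of $K$ and all $m\in\mathbb P_{k-1}(e)$; - $(v,q)_K=(\Pi_K^\nabla v,q)_K$ for the scaled monomials $q=\big((\boldsymbol x-\boldsymbol x_K)/h_K\big)^{\boldsymbol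 s}$ with $|\boldsymbol s|\in\{k-1,k\}$, where $\boldsymbol x_K$ is the centroid of $K$. Let $V_h$ be the space of $v\in L^2(\Omega)$ with $v|_K\in V_k(K)$ for all $K\in\mathcal T_h$ which are continuous at the Gauss–Lobatto points of the interior edges and vanish at those of the boundary edges. Define $\Pi_h^\nabla$ and $f_h$ by $(\Pi_h^\nabla v)|_K=\Pi_K^\nabla(v|_K)$ and $f_h|_K=$ the $L^2(K)$-projection of $f$ onto $\mathbb P_k(K)$, and put $\eta_{5,K}=h_K^2\|f-f_h\|_{0,K}$. *Conclusion.* For every $w_h\in V_h$ and every $K\in\mathcal T_h$, $$h_K^4\|f_h-\Delta^2\Pi_h^\nabla w_h\|_{0,K}^2\le C\big(|u-\Pi_h^\nabla w_h|_{2,K}^2+\eta_{5,K}^2\big),$$ and for every interior edge $e$ of $K$, $$h_e\Big\|\Big[\frac{\partial^2\Pi_h^\nabla w_h}{\partial\boldsymbol n_e^2}\Big]\Big\|_{0,e}^2\le C\Big(|u-\Pi_h^\nabla w_h|_{2,\omega(e)}^2+\sum_{K'\subset\omega(e)}\eta_{5,K'}^2\Big),$$ $$h_e^3\Big\|\Big[\frac{\partial(\Delta\Pi_h^\nabla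 w_h)}{\partial\boldsymbol n_e}+\frac{\partial^3\Pi_h^\nabla w_h}{\partial\boldsymbol n_e\partial\boldsymbol t_e^2}\Big]\Big\|_{0,e}^2\le C\Big(|u-\Pi_h^\nabla w_h|_{2,\omega(e)}^2+\sum_{K'\subset\omega(e)}\eta_{5,K'}^2\Big).$$ Here $[\cdot]$ is the jump across $e$, $\omega(e)$ is the union of the two elements sharing $e$, $|v|_{2,K}$ is the $L^2(K)$-norm of $\nabla^2 v$, and $|\cdot|_{2,\omega(e)}^2$ is the sum of $|\cdot|_{2,K'}^2$ over these two elements. -/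

import Mathlib

open MeasureTheory Filter Topology
open scoped ContDiff

namespace IPVEM

noncomputable section

/-! ### The plane, polynomials, classical derivatives -/

/-- The Euclidean plane. -/
abbrev Plane := EuclideanSpace ℝ (Fin 2)

/-- Value of a bivariate polynomial at a point of the plane. -/
def ev (p : MvPolynomial (Fin 2) ℝ) (x : Plane) : ℝ := MvPolynomial.eval (fun i => x i) p

/-- Bivariate polynomials of total degree at most `k`. -/
abbrev Pk (k : ℕ) : Submodule ℝ (MvPolynomial (Fin 2) ℝ) :=
  MvPolynomial.restrictTotalDegree (Fin 2) ℝ k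

/-- First order partial derivative of a polynomial. -/
abbrev pd (i : Fin 2) (p : MvPolynomial (Fin 2) ℝ) : MvPolynomial (Fin 2) ℝ :=
  MvPolynomial.pderiv i p

/-- Laplacian of a polynomial. -/
def polyLap (p : MvPolynomial (Fin 2) ℝ) : MvPolynomial (Fin 2) ℝ := ∑ i, pd i (pd i p)

/-- Directional derivative `∂p/∂n` at `x`. -/
def polyD1 (p : MvPolynomial (Fin 2) ℝ) (n x : Plane) : ℝ := ∑ i, n i * ev (pd i p) x

/-- Second directional derivative `∂²p/∂n²` at `x`. -/
def polyD2 (p : MvPolynomial (Fin 2) ℝ) (n x : Plane) : ℝ :=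
  ∑ i, ∑ j, n i * n j * ev (pd i (pd j p)) x

/-- Third directional derivative `∂³p/∂n∂t²` at `x`. -/
def polyD3 (p : MvPolynomial (Fin 2) ℝ) (n t x : Plane) : ℝ :=
  ∑ i, ∑ j, ∑ l, n i * t j * t l * ev (pd i (pd j (pd l p))) x

/-- Classical partial derivative of a function on the plane. -/
def partialD (i : Fin 2) (φ : Plane → ℝ) (x : Plane) : ℝ :=
  fderiv ℝ φ x (EuclideanSpace.single i 1)

/-- Classical Laplacian of a function on the plane. -/
def lap (φ : Plane → ℝ) (x : Plane) : ℝ := ∑ i, partialD i (partialD i φ) x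

/-! ### Sobolev spaces through weak derivatives -/

/-- `φ ∈ C_c^∞(U)`. -/
def IsTest (U : Set Plane) (φ : Plane → ℝ) : Prop :=
  ContDiff ℝ ∞ φ ∧ HasCompactSupport φ ∧ tsupport φ ⊆ U

/-- `g ∈ L²(U)` is the weak partial derivative `∂ᵢ v` on `U`. -/
def HasWeakPartial (U : Set Plane) (i : Fin 2) (v g : Plane → ℝ) : Prop :=
  MemLp g 2 (volume.restrict U) ∧
    ∀ φ, IsTest U φ → ∫ x in U, v x * partialD i φ x = - ∫ x in U, g x * φ x

open Classical in
/-- A representative of the weak partial derivative `∂ᵢ v ∈ L²(U)` (unique almost everywhere on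
`U`); the zero function if there is none. -/
def weakPartial (U : Set Plane) (i : Fin 2) (v : Plane → ℝ) : Plane → ℝ :=
  if h : ∃ g, HasWeakPartial U i v g then h.choose else 0

/-- `v ∈ H¹(U)`. -/
def MemH1 (U : Set Plane) (v : Plane → ℝ) : Prop :=
  MemLp v 2 (volume.restrict U) ∧ ∀ i, ∃ g, HasWeakPartial U i v g

/-- `v ∈ H²(U)`. -/
def MemH2 (U : Set Plane) (v : Plane → ℝ) : Prop :=
  MemH1 U v ∧ ∀ i, MemH1 U (weakPartial U i v)

/-- `‖v‖²_{0,U}`. -/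
def l2NormSq (U : Set Plane) (v : Plane → ℝ) : ℝ := ∫ x in U, v x ^ 2

/-- `|v|²_{1,U}`. -/
def h1SemiSq (U : Set Plane) (v : Plane → ℝ) : ℝ := ∑ i, l2NormSq U (weakPartial U i v)

/-- `|v|²_{2,U}`, the squared `L²(U)`-norm of the weak Hessian. -/
def h2SemiSq (U : Set Plane) (v : Plane → ℝ) : ℝ :=
  ∑ i, ∑ j, l2NormSq U (weakPartial U i (weakPartial U j v))

/-- `v ∈ H²₀(U)`: the closure of `C_c^∞(U)` in `H²(U)`. -/
def MemH20 (U : Set Plane) (v : Plane → ℝ) : Prop :=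
  MemH2 U v ∧ ∃ φ : ℕ → Plane → ℝ, (∀ m, IsTest U (φ m)) ∧
    Tendsto (fun m => l2NormSq U (v - φ m) + h1SemiSq U (v - φ m) + h2SemiSq U (v - φ m))
      atTop (𝓝 0)

/-- The bilinear form `a(u,v) = (∇²u, ∇²v)`. -/
def bilinA (U : Set Plane) (u v : Plane → ℝ) : ℝ :=
  ∑ i, ∑ j, ∫ x in U,
    weakPartial U i (weakPartial U j u) x * weakPartial U i (weakPartial U j v) x

/-- `u ∈ H²₀(Ω)` and `a(u,v) = (f,v)` for all `v ∈ H²₀(Ω)`. -/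
def IsWeakSolution (Ω : Set Plane) (f u : Plane → ℝ) : Prop :=
  MemH20 Ω u ∧ ∀ v, MemH20 Ω v → bilinA Ω u v = ∫ x in Ω, f x * v x

/-! ### Polygonal elements -/

/-- The open region enclosed by a simple closed polygon with `m + 3` vertices, which are listed
counterclockwise; straight angles are allowed (hanging nodes). The `i`-th edge joins the `i`-th
vertex to the next one, cyclically. Since the complement of a Jordan curve has exactly one bounded
component, the conditions on `carrier` determine it. -/
structure PolygonalElement where
  m : ℕ
  vertex : Fin (m + 3) → Plane
  carrier : Set Plane
  vertex_injective : Function.Injective vertex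
  /-- Distinct edges meet only in common endpoints. -/
  simple : ∀ i j, i ≠ j →
    segment ℝ (vertex i) (vertex (i + 1)) ∩ segment ℝ (vertex j) (vertex (j + 1)) ⊆
      {vertex i, vertex (i + 1)} ∩ {vertex j, vertex (j + 1)}
  isOpen_carrier : IsOpen carrier
  carrier_nonempty : carrier.Nonempty
  isBounded_carrier : Bornology.IsBounded carrier
  frontier_carrier : frontier carrier = ⋃ i, segment ℝ (vertex i) (vertex (i + 1))
  /-- Counterclockwise labelling: the region lies to the left of each edge. -/
  left : ∀ i, ∀ x ∈ openSegment ℝ (vertex i) (vertex (i + 1)), ∀ᶠ s in 𝓝[>] (0 : ℝ),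
    x + s • (!₂[-((vertex (i + 1)) 1 - (vertex i) 1), (vertex (i + 1)) 0 - (vertex i) 0] : Plane)
      ∈ carrier

namespace PolygonalElement

variable (K : PolygonalElement)

/-- Index set of the edges (and of the vertices). -/
abbrev Edge := Fin (K.m + 3)

/-- The diameter `h_K`. -/
def diam : ℝ := Metric.diam K.carrier

/-- The centroid `x_K`. -/
def centroid : Plane := ⨍ x in K.carrier, x

/-- The length `|e| = h_e` of an edge. -/
def len (e : K.Edge) : ℝ := dist (K.vertex e) (K.vertex (e + 1))

/-- Parametrization of an edge by `[0,1]`. -/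
def edgePt (e : K.Edge) (t : ℝ) : Plane := (1 - t) • K.vertex e + t • K.vertex (e + 1)

/-- The unit tangent `t_e`. -/
def tangent (e : K.Edge) : Plane := (K.len e)⁻¹ • (K.vertex (e + 1) - K.vertex e)

/-- The outward unit normal `n_e`. -/
def normal (e : K.Edge) : Plane := !₂[K.tangent e 1, -K.tangent e 0]

/-- `∫_e g ds`, with `g` given as a function of the point. -/
def edgeIntegral (e : K.Edge) (g : Plane → ℝ) : ℝ :=
  K.len e * ∫ t in (0 : ℝ)..1, g (K.edgePt e t)

end PolygonalElement

/-! ### Gauss-Lobatto quadrature on `[0,1]` -/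

/-- The `k + 1` Gauss-Lobatto nodes on `[0,1]`: both endpoints and the zeros of the derivative of
the (shifted) Legendre polynomial of degree `k`. -/
def glNodes (k : ℕ) : Finset ℝ :=
  {0, 1} ∪ (Polynomial.derivative
    ((Polynomial.shiftedLegendre k).map (Int.castRingHom ℝ))).roots.toFinset

/-- The Gauss-Lobatto weights: the quadrature is interpolatory. -/
def glWeight (k : ℕ) (s : ℝ) : ℝ :=
  ∫ t in (0 : ℝ)..1, (Lagrange.basis (glNodes k) id s).eval t

/-- The quadrature `Q^e_{2k-1} g = |e| ∑ ωᵢ g(xᵢ)`. -/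
def glQuad (k : ℕ) (K : PolygonalElement) (e : K.Edge) (g : Plane → ℝ) : ℝ :=
  K.len e * ∑ s ∈ glNodes k, glWeight k s * g (K.edgePt e s)

/-! ### Projections onto polynomials -/

/-- `p` is the `L²(U)`-orthogonal projection of `f` onto polynomials of degree at most `k`. -/
def IsL2Proj (k : ℕ) (U : Set Plane) (f : Plane → ℝ) (p : MvPolynomial (Fin 2) ℝ) : Prop :=
  p ∈ Pk k ∧ ∀ q ∈ Pk k, ∫ x in U, ev p x * ev q x = ∫ x in U, f x * ev q x

/-- `p` is the modified `H¹`-elliptic projection of `v` on `K`; here `v` is given on the closed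
element. -/
def IsGradProj (k : ℕ) (K : PolygonalElement) (v : Plane → ℝ) (p : MvPolynomial (Fin 2) ℝ) :
    Prop :=
  p ∈ Pk k ∧
  (∀ q ∈ Pk k, ∫ x in K.carrier, ∑ i, ev (pd i p) x * ev (pd i q) x =
    -(∫ x in K.carrier, v x * ev (polyLap q) x) +
      ∑ e, glQuad k K e (fun x => v x * polyD1 q (K.normal e) x)) ∧
  ∑ z, ev p (K.vertex z) = ∑ z, v (K.vertex z)

/-! Existence and uniqueness of the two projections. -/

theorem continuous_ev (p : MvPolynomial (Fin 2) ℝ) : Continuous (ev p) := by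
  have h : Continuous fun x : Plane => (fun i => x i : Fin 2 → ℝ) := by fun_prop
  exact (MvPolynomial.continuous_eval p).comp h

theorem ev_add (p q : MvPolynomial (Fin 2) ℝ) (x : Plane) : ev (p + q) x = ev p x + ev q x := by
  simp [ev]

theorem ev_smul (c : ℝ) (p : MvPolynomial (Fin 2) ℝ) (x : Plane) : ev (c • p) x = c * ev p x := by
  simp [ev, MvPolynomial.smul_eval]

theorem integrableOn_of_continuous {U : Set Plane} (hb : Bornology.IsBounded U)
    {g : Plane → ℝ} (hg : Continuous g) : IntegrableOn g U :=
  (hg.continuousOn.integrableOn_compact hb.isCompact_closure).mono_set subset_closure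

theorem integrableOn_mul_ev {U : Set Plane} (hU : IsOpen U) (hb : Bornology.IsBounded U)
    {f g : Plane → ℝ} (hf : IntegrableOn f U) (hg : Continuous g) :
    IntegrableOn (fun x => f x * g x) U :=
  hf.mul_continuousOn_of_subset hg.continuousOn hU.measurableSet hb.isCompact_closure
    subset_closure

theorem eq_zero_of_ev_eq_zero {U : Set Plane} (hU : IsOpen U) (hne : U.Nonempty)
    {p : MvPolynomial (Fin 2) ℝ} (hp : ∀ x ∈ U, ev p x = 0) : p = 0 := by
  obtain ⟨x₀, hx₀⟩ := hne
  have hU' : IsOpen ((fun y : Fin 2 → ℝ => (WithLp.toLp 2 y : Plane)) ⁻¹' U) :=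
    hU.preimage (PiLp.continuous_toLp 2 _)
  have hmem : (fun i => x₀ i) ∈ ((fun y : Fin 2 → ℝ => (WithLp.toLp 2 y : Plane)) ⁻¹' U) := by
    simpa using hx₀
  obtain ⟨ε, hε, hball⟩ := Metric.isOpen_iff.1 hU' _ hmem
  refine MvPolynomial.funext_set (fun i => Metric.ball (x₀ i) ε) (fun i => ?_) (fun y hy => ?_)
  · rw [Real.ball_eq_Ioo]
    exact Set.Ioo_infinite (by linarith)
  · have : y ∈ Metric.ball (fun i => x₀ i) ε := by
      rw [ball_pi _ hε]
      exact hy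
    simpa [ev] using hp _ (hball this)

theorem eq_zero_of_integral_sq {U : Set Plane} (hU : IsOpen U)
    {g : Plane → ℝ} (hg : Continuous g) (hg0 : ∀ x, 0 ≤ g x) (hi : IntegrableOn g U)
    (h : ∫ x in U, g x = 0) : ∀ x ∈ U, g x = 0 := by
  rw [setIntegral_eq_zero_iff_of_nonneg_ae (ae_of_all _ hg0) hi] at h
  exact Measure.eqOn_open_of_ae_eq h hU hg.continuousOn continuousOn_const

theorem eq_C_of_pd_eq_zero {p : MvPolynomial (Fin 2) ℝ} (h : ∀ i, pd i p = 0) :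
    p = MvPolynomial.C (MvPolynomial.coeff 0 p) := by
  classical
  ext m
  rw [MvPolynomial.coeff_C]
  split_ifs with hm
  · rw [hm]
  · obtain ⟨i, hi⟩ : ∃ i, m i ≠ 0 := by
      by_contra! hc
      exact hm (Finsupp.ext fun i => (hc i).symm)
    have h1 := congrArg (MvPolynomial.coeff (m - Finsupp.single i 1)) (h i)
    rw [MvPolynomial.coeff_pderiv, MvPolynomial.coeff_zero,
      tsub_add_cancel_of_le (Finsupp.single_le_iff.2 (Nat.one_le_iff_ne_zero.2 hi))] at h1
    rcases mul_eq_zero.1 h1 with h2 | h2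
    · exact h2
    · exact absurd h2 (by positivity)

theorem existsUnique_of_definite {V : Type*} [AddCommGroup V] [Module ℝ V] [Module.Finite ℝ V]
    (B : V →ₗ[ℝ] V →ₗ[ℝ] ℝ) (hB : ∀ p, B p p = 0 → p = 0) (l : V →ₗ[ℝ] ℝ) :
    ∃! p, ∀ q, B p q = l q := by
  have hinj : Function.Injective B := by
    rw [injective_iff_map_eq_zero]
    intro p hp
    exact hB p (by rw [hp]; rfl)
  have hsurj : Function.Surjective B :=
    (LinearMap.injective_iff_surjective_of_finrank_eq_finrank
      (Subspace.dual_finrank_eq (K := ℝ) (V := V)).symm).1 hinj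
  obtain ⟨p, hp⟩ := hsurj l
  refine ⟨p, fun q => by rw [hp], fun p' hp' => hinj ?_⟩
  rw [hp]
  exact LinearMap.ext hp'

theorem existsUnique_isL2Proj (k : ℕ) {U : Set Plane} (hU : IsOpen U) (hne : U.Nonempty)
    (hb : Bornology.IsBounded U) {f : Plane → ℝ} (hf : IntegrableOn f U) :
    ∃! p, IsL2Proj k U f p := by
  have hi : ∀ p q : MvPolynomial (Fin 2) ℝ, IntegrableOn (fun x => ev p x * ev q x) U := fun p q =>
    integrableOn_of_continuous hb ((continuous_ev p).mul (continuous_ev q))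
  have hfi : ∀ q : MvPolynomial (Fin 2) ℝ, IntegrableOn (fun x => f x * ev q x) U := fun q =>
    integrableOn_mul_ev hU hb hf (continuous_ev q)
  let B : Pk k →ₗ[ℝ] Pk k →ₗ[ℝ] ℝ := LinearMap.mk₂ ℝ
    (fun p q => ∫ x in U, ev p.1 x * ev q.1 x)
    (fun p p' q => by
      rw [← integral_add (hi _ _) (hi _ _)]
      simp only [Submodule.coe_add, ev_add, add_mul])
    (fun c p q => by
      rw [smul_eq_mul, ← integral_const_mul]
      simp only [Submodule.coe_smul, ev_smul, mul_assoc])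
    (fun p q q' => by
      rw [← integral_add (hi _ _) (hi _ _)]
      simp only [Submodule.coe_add, ev_add, mul_add])
    (fun c p q => by
      rw [smul_eq_mul, ← integral_const_mul]
      simp only [Submodule.coe_smul, ev_smul, mul_left_comm])
  let l : Pk k →ₗ[ℝ] ℝ :=
    { toFun := fun q => ∫ x in U, f x * ev q.1 x
      map_add' := fun q q' => by
        rw [← integral_add (hfi _) (hfi _)]
        simp only [Submodule.coe_add, ev_add, mul_add]
      map_smul' := fun c q => by
        rw [RingHom.id_apply, smul_eq_mul, ← integral_const_mul]
        simp only [Submodule.coe_smul, ev_smul, mul_left_comm] }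
  obtain ⟨p, hp, hu⟩ := existsUnique_of_definite B (fun p hp => by
    have h0 := eq_zero_of_integral_sq hU ((continuous_ev p.1).mul (continuous_ev p.1))
      (fun x => mul_self_nonneg _) (hi p.1 p.1) hp
    exact Subtype.ext (eq_zero_of_ev_eq_zero hU hne fun x hx => mul_self_eq_zero.1 (h0 x hx))) l
  refine ⟨p.1, ⟨p.2, fun q hq => hp ⟨q, hq⟩⟩, fun p' hp' => ?_⟩
  exact congrArg Subtype.val (hu ⟨p', hp'.1⟩ fun q => hp'.2 q.1 q.2)

theorem existsUnique_isGradProj (k : ℕ) (K : PolygonalElement) {v : Plane → ℝ}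
    (hv : IntegrableOn v K.carrier) : ∃! p, IsGradProj k K v p := by
  have hU := K.isOpen_carrier
  have hne := K.carrier_nonempty
  have hb := K.isBounded_carrier
  have hc : ∀ p q : MvPolynomial (Fin 2) ℝ,
      Continuous (fun x => ∑ i, ev (pd i p) x * ev (pd i q) x) := fun p q =>
    continuous_finsetSum _ fun i _ => (continuous_ev _).mul (continuous_ev _)
  have hi : ∀ p q : MvPolynomial (Fin 2) ℝ,
      IntegrableOn (fun x => ∑ i, ev (pd i p) x * ev (pd i q) x) K.carrier := fun p q =>
    integrableOn_of_continuous hb (hc p q)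
  have hvi : ∀ q : MvPolynomial (Fin 2) ℝ,
      IntegrableOn (fun x => v x * ev q x) K.carrier := fun q =>
    integrableOn_mul_ev hU hb hv (continuous_ev q)
  let B : Pk k →ₗ[ℝ] Pk k →ₗ[ℝ] ℝ := LinearMap.mk₂ ℝ
    (fun p q => (∫ x in K.carrier, ∑ i, ev (pd i p.1) x * ev (pd i q.1) x) +
      (∑ z, ev p.1 (K.vertex z)) * ∑ z, ev q.1 (K.vertex z))
    (fun p p' q => by
      simp only [Submodule.coe_add, map_add, ev_add, add_mul, Finset.sum_add_distrib]
      have := integral_add (hi p.1 q.1) (hi p'.1 q.1)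
      rw [this]; ring)
    (fun c p q => by
      simp only [Submodule.coe_smul, Derivation.map_smul, ev_smul, mul_assoc, ← Finset.mul_sum,
        integral_const_mul, smul_eq_mul]
      ring)
    (fun p q q' => by
      simp only [Submodule.coe_add, map_add, ev_add, mul_add, Finset.sum_add_distrib]
      have := integral_add (hi p.1 q.1) (hi p.1 q'.1)
      rw [this]; ring)
    (fun c p q => by
      simp only [Submodule.coe_smul, Derivation.map_smul, ev_smul, mul_left_comm _ c,
        ← Finset.mul_sum, integral_const_mul, smul_eq_mul]
      ring)
  let l : Pk k →ₗ[ℝ] ℝ :=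
    { toFun := fun q => -(∫ x in K.carrier, v x * ev (polyLap q.1) x) +
        ∑ e, glQuad k K e (fun x => v x * polyD1 q.1 (K.normal e) x) +
        (∑ z, v (K.vertex z)) * ∑ z, ev q.1 (K.vertex z)
      map_add' := fun q q' => by
        have hl : polyLap (q.1 + q'.1) = polyLap q.1 + polyLap q'.1 := by
          simp only [polyLap, map_add, Finset.sum_add_distrib]
        have h1 := integral_add (hvi (polyLap q.1)) (hvi (polyLap q'.1))
        simp only [Submodule.coe_add, hl, ev_add, mul_add, h1, glQuad, polyD1, map_add,
          Finset.sum_add_distrib]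
        ring
      map_smul' := fun c q => by
        have hl : polyLap (c • q.1) = c • polyLap q.1 := by
          simp only [polyLap, Derivation.map_smul, Finset.smul_sum]
        simp only [Submodule.coe_smul, hl, ev_smul, glQuad, polyD1, Derivation.map_smul,
          mul_left_comm _ c, ← Finset.mul_sum, integral_const_mul, smul_eq_mul, RingHom.id_apply]
        ring }
  have hcard : (0 : ℝ) < (Fintype.card K.Edge : ℝ) := by
    have : 0 < Fintype.card K.Edge := Fintype.card_pos
    exact_mod_cast this
  have hdef : ∀ p, B p p = 0 → p = 0 := by
    intro p hp
    have hp' : (∫ x in K.carrier, ∑ i, ev (pd i p.1) x * ev (pd i p.1) x) +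
      (∑ z, ev p.1 (K.vertex z)) * ∑ z, ev p.1 (K.vertex z) = 0 := hp
    have hn : ∀ x, 0 ≤ ∑ i, ev (pd i p.1) x * ev (pd i p.1) x := fun x =>
      Finset.sum_nonneg fun i _ => mul_self_nonneg _
    have h1 : 0 ≤ ∫ x in K.carrier, ∑ i, ev (pd i p.1) x * ev (pd i p.1) x :=
      integral_nonneg hn
    have h2 := mul_self_nonneg (∑ z, ev p.1 (K.vertex z))
    have h3 : ∑ z, ev p.1 (K.vertex z) = 0 := mul_self_eq_zero.1 (by linarith)
    have h4 := eq_zero_of_integral_sq hU (hc p.1 p.1) hn (hi p.1 p.1) (by linarith)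
    have h5 := eq_C_of_pd_eq_zero (p := p.1) fun i =>
      eq_zero_of_ev_eq_zero hU hne fun x hx => mul_self_eq_zero.1
        ((Finset.sum_eq_zero_iff_of_nonneg fun i _ => mul_self_nonneg _).1 (h4 x hx) i
          (Finset.mem_univ i))
    rw [h5] at h3
    simp only [ev, MvPolynomial.eval_C, Finset.sum_const, Finset.card_univ, nsmul_eq_mul] at h3
    rcases mul_eq_zero.1 h3 with h6 | h6
    · exact absurd h6 hcard.ne'
    · refine Subtype.ext ?_
      rw [h5, h6]
      simp
  have hone : (MvPolynomial.C 1 : MvPolynomial (Fin 2) ℝ) ∈ Pk k := by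
    rw [MvPolynomial.mem_restrictTotalDegree]
    simp
  have hlap1 : polyLap (MvPolynomial.C 1) = 0 := by
    simp [polyLap]
  have hd1 : ∀ n x, polyD1 (MvPolynomial.C 1) n x = 0 := by
    intro n x
    simp [polyD1, ev]
  have hBe : ∀ p q, B p q = (∫ x in K.carrier, ∑ i, ev (pd i p.1) x * ev (pd i q.1) x) +
      (∑ z, ev p.1 (K.vertex z)) * ∑ z, ev q.1 (K.vertex z) := fun _ _ => rfl
  have hle : ∀ q, l q = -(∫ x in K.carrier, v x * ev (polyLap q.1) x) +
        ∑ e, glQuad k K e (fun x => v x * polyD1 q.1 (K.normal e) x) +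
        (∑ z, v (K.vertex z)) * ∑ z, ev q.1 (K.vertex z) := fun _ => rfl
  obtain ⟨p, hp, hu⟩ := existsUnique_of_definite B hdef l
  have key : ∀ p' : Pk k, (∀ q, B p' q = l q) ↔ IsGradProj k K v p'.1 := by
    intro p'
    constructor
    · intro h
      have hsum : ∑ z, ev p'.1 (K.vertex z) = ∑ z, v (K.vertex z) := by
        have h1 : (∫ x in K.carrier, ∑ i, ev (pd i p'.1) x * ev (pd i (MvPolynomial.C 1)) x) +
          (∑ z, ev p'.1 (K.vertex z)) * ∑ z, ev (MvPolynomial.C 1) (K.vertex z) =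
          -(∫ x in K.carrier, v x * ev (polyLap (MvPolynomial.C 1)) x) +
          ∑ e, glQuad k K e (fun x => v x * polyD1 (MvPolynomial.C 1) (K.normal e) x) +
          (∑ z, v (K.vertex z)) * ∑ z, ev (MvPolynomial.C 1) (K.vertex z) := h ⟨_, hone⟩
        have e1 : ∀ x, ev (MvPolynomial.C 1) x = 1 := fun x => by simp [ev]
        have e0 : ∀ x, ev 0 x = 0 := fun x => by simp [ev]
        simp only [hlap1, hd1, e1, e0, MvPolynomial.pderiv_C, glQuad, mul_zero, Finset.sum_const_zero,
          integral_zero, neg_zero, zero_add, Finset.sum_const, Finset.card_univ, nsmul_eq_mul,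
          mul_one] at h1
        exact mul_right_cancel₀ hcard.ne' h1
      refine ⟨p'.2, fun q hq => ?_, hsum⟩
      have h1 := h ⟨q, hq⟩
      rw [hBe, hle, hsum] at h1
      exact add_right_cancel h1
    · rintro ⟨_, h1, h2⟩ q
      rw [hBe, hle, h1 q.1 q.2, h2]
  refine ⟨p.1, (key p).1 hp, fun p' hp' => ?_⟩
  exact congrArg Subtype.val (hu ⟨p', hp'.1⟩ ((key ⟨p', hp'.1⟩).2 hp'))

open Classical in
/-- The `L²`-projection of `f` onto polynomials of degree at most `k` on `U`. -/
def l2Proj (k : ℕ) (U : Set Plane) (f : Plane → ℝ) : MvPolynomial (Fin 2) ℝ :=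
  if h : ∃ p, IsL2Proj k U f p then h.choose else 0

open Classical in
/-- The modified `H¹`-elliptic projection `Π_K^∇ v`. -/
def gradProj (k : ℕ) (K : PolygonalElement) (v : Plane → ℝ) : MvPolynomial (Fin 2) ℝ :=
  if h : ∃ p, IsGradProj k K v p then h.choose else 0

theorem isL2Proj_l2Proj (k : ℕ) {U : Set Plane} (hU : IsOpen U) (hne : U.Nonempty)
    (hb : Bornology.IsBounded U) {f : Plane → ℝ} (hf : IntegrableOn f U) :
    IsL2Proj k U f (l2Proj k U f) := by
  have h := (existsUnique_isL2Proj k hU hne hb hf).exists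
  rw [l2Proj, dif_pos h]
  exact h.choose_spec

theorem isGradProj_gradProj (k : ℕ) (K : PolygonalElement) {v : Plane → ℝ}
    (hv : IntegrableOn v K.carrier) : IsGradProj k K v (gradProj k K v) := by
  have h := (existsUnique_isGradProj k K hv).exists
  rw [gradProj, dif_pos h]
  exact h.choose_spec

/-! ### The local virtual element spaces -/

/-- The functions `γ e` (parametrized by `t ∈ [0,1]`) are the trace of `g ∈ H¹(K)` on the edges
of `K`: the restrictions to the edges of smooth functions converging to `g` in `H¹(K)` converge to
`γ` in `L²`. -/
def IsEdgeTrace (K : PolygonalElement) (g : Plane → ℝ) (γ : K.Edge → ℝ → ℝ) : Prop :=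
  ∃ φ : ℕ → Plane → ℝ, (∀ m, ContDiff ℝ ∞ (φ m)) ∧
    Tendsto (fun m => l2NormSq K.carrier (g - φ m) + h1SemiSq K.carrier (g - φ m)) atTop (𝓝 0) ∧
    ∀ e, Tendsto (fun m => ∫ t in (0 : ℝ)..1, (γ e t - φ m (K.edgePt e t)) ^ 2) atTop (𝓝 0)

/-- The normal component on the edge `e` of the vector polynomial `d e`. -/
def normalPart (K : PolygonalElement) (d : K.Edge → Fin 2 → Polynomial ℝ) (e : K.Edge) :
    Polynomial ℝ :=
  ∑ j, Polynomial.C (K.normal e j) * d e j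

/-- `v` belongs to the enlarged `C¹`-type local space `Ṽ_{k+2}(K)`, and its gradient has the trace
`d e`, a vector polynomial in the parameter `t ∈ [0,1]`, on each edge `e`. The function `v` is the
continuous representative on the closed element (`H²(K) ⊂ C(K̄)`). As `v` is a polynomial on each
edge, so is its tangential derivative; hence `∂_n v` is a polynomial on `e` if and only if the
whole gradient is. -/
structure InEnlargedSpace (k : ℕ) (K : PolygonalElement) (v : Plane → ℝ)
    (d : K.Edge → Fin 2 → Polynomial ℝ) : Prop where
  continuousOn : ContinuousOn v (closure K.carrier)
  memH2 : MemH2 K.carrier v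
  /-- `Δ² v` is a polynomial of degree at most `k`, in the sense of distributions. -/
  bilaplacian : ∃ q ∈ Pk k, ∀ φ, IsTest K.carrier φ →
    ∫ x in K.carrier, v x * lap (lap φ) x = ∫ x in K.carrier, ev q x * φ x
  /-- `v|_e` is a polynomial of degree at most `k + 2`. -/
  edge_poly : ∀ e, ∃ p : Polynomial ℝ, p.natDegree ≤ k + 2 ∧
    ∀ t ∈ Set.Icc (0 : ℝ) 1, v (K.edgePt e t) = p.eval t
  grad_trace : ∀ j, IsEdgeTrace K (weakPartial K.carrier j v) (fun e t => (d e j).eval t)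
  /-- `∂_n v|_e` is a polynomial of degree at most `k + 1`. -/
  normal_degree : ∀ e, (normalPart K d e).natDegree ≤ k + 1

/-- The scaled monomial `((x - x_K) / h_K)^s`. -/
def scaledMonomial (K : PolygonalElement) (s : Fin 2 → ℕ) (x : Plane) : ℝ :=
  ∏ i, ((x i - K.centroid i) / K.diam) ^ s i

/-- The local interior penalty virtual element space `V_k(K)`: the vertex values of the gradient,
the edge moments of the normal derivative up to degree `k - 1` and the highest order moments on
`K` coincide with those of `Π_K^∇ v`. -/
def InLocalSpace (k : ℕ) (K : PolygonalElement) (v : Plane → ℝ) : Prop :=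
  ∃ d : K.Edge → Fin 2 → Polynomial ℝ, InEnlargedSpace k K v d ∧
    (∀ e j, (d e j).eval 0 = ev (pd j (gradProj k K v)) (K.vertex e) ∧
      (d e j).eval 1 = ev (pd j (gradProj k K v)) (K.vertex (e + 1))) ∧
    (∀ e, ∀ r : Polynomial ℝ, r.natDegree ≤ k - 1 →
      ∫ t in (0 : ℝ)..1, r.eval t * (normalPart K d e).eval t =
        ∫ t in (0 : ℝ)..1, r.eval t * polyD1 (gradProj k K v) (K.normal e) (K.edgePt e t)) ∧
    (∀ s : Fin 2 → ℕ, k - 2 < ∑ i, s i → ∑ i, s i ≤ k →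
      ∫ x in K.carrier, v x * scaledMonomial K s x =
        ∫ x in K.carrier, ev (gradProj k K v) x * scaledMonomial K s x)

/-! ### Meshes -/

/-- A bounded polygonal domain: its boundary consists of finitely many segments. -/
def IsPolygonalDomain (Ω : Set Plane) : Prop :=
  IsOpen Ω ∧ IsConnected Ω ∧ Bornology.IsBounded Ω ∧
    ∃ S : Finset (Plane × Plane), frontier Ω = ⋃ s ∈ S, segment ℝ s.1 s.2

/-- The edge `e` of `K` is the edge `e'` of `K'`, with the opposite orientation (as is always the
case for elements on the two sides of a common edge). -/
def SameEdge (K : PolygonalElement) (e : K.Edge) (K' : PolygonalElement) (e' : K'.Edge) : Prop :=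
  K.vertex e = K'.vertex (e' + 1) ∧ K.vertex (e + 1) = K'.vertex e'

/-- A decomposition of `Ω` into finitely many polygonal elements. Each edge of an element either
lies on the boundary of `Ω` or is inside `Ω` and an edge of another element. -/
structure Mesh (Ω : Set Plane) where
  card : ℕ
  elem : Fin card → PolygonalElement
  subset : ∀ K, (elem K).carrier ⊆ Ω
  disjoint : ∀ K K', K ≠ K' → Disjoint (elem K).carrier (elem K').carrier
  cover : closure Ω = ⋃ K, closure (elem K).carrier
  conforming : ∀ K (e : (elem K).Edge),
    segment ℝ ((elem K).vertex e) ((elem K).vertex (e + 1)) ⊆ frontier Ω ∨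
    (openSegment ℝ ((elem K).vertex e) ((elem K).vertex (e + 1)) ⊆ Ω ∧
      ∃ K', K' ≠ K ∧ ∃ e', SameEdge (elem K) e (elem K') e')

/-- `e ∈ 𝓔(K) ∩ 𝓔(K')` is an interior edge shared by the distinct elements `K` and `K'`. -/
def Mesh.IsInteriorEdge {Ω : Set Plane} (T : Mesh Ω) (K : Fin T.card) (e : (T.elem K).Edge)
    (K' : Fin T.card) (e' : (T.elem K').Edge) : Prop :=
  K ≠ K' ∧ SameEdge (T.elem K) e (T.elem K') e' ∧
    openSegment ℝ ((T.elem K).vertex e) ((T.elem K).vertex (e + 1)) ⊆ Ω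

/-- `τ` is a virtual triangulation of `K`, into `N` triangles, with regularity parameter `σ`. -/
structure IsVirtualTriangulation (σ : ℝ) (K : PolygonalElement) (N : ℕ)
    (τ : Fin N → Fin 3 → Plane) : Prop where
  nondegenerate : ∀ s, AffineIndependent ℝ (τ s)
  inside : ∀ s, interior (convexHull ℝ (Set.range (τ s))) ⊆ K.carrier
  cover : closure K.carrier = ⋃ s, convexHull ℝ (Set.range (τ s))
  disjoint : ∀ s s', s ≠ s' → Disjoint (interior (convexHull ℝ (Set.range (τ s))))
    (interior (convexHull ℝ (Set.range (τ s'))))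
  /-- Two triangles meet in a common face (a side, a vertex, or nothing). -/
  conforming : ∀ s s', convexHull ℝ (Set.range (τ s)) ∩ convexHull ℝ (Set.range (τ s')) =
    convexHull ℝ (Set.range (τ s) ∩ Set.range (τ s'))
  /-- Shape regularity: each triangle contains a disc of comparable diameter. -/
  shapeRegular : ∀ s, ∃ c, Metric.ball c (σ * Metric.diam (Set.range (τ s))) ⊆
    convexHull ℝ (Set.range (τ s))
  /-- Quasi-uniformity: the size of each triangle is comparable to the diameter of `K`. -/
  quasiUniform : ∀ s, σ * K.diam ≤ Metric.diam (Set.range (τ s))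
  /-- Each edge of `K` is a side of a triangle. -/
  edge_side : ∀ e : K.Edge, ∃ s a b, τ s a = K.vertex e ∧ τ s b = K.vertex (e + 1)

/-- The mesh assumption with regularity parameter `σ`. -/
def Mesh.IsRegular {Ω : Set Plane} (T : Mesh Ω) (σ : ℝ) : Prop :=
  ∀ K, ∃ N τ, IsVirtualTriangulation σ (T.elem K) N τ

/-! ### The global space and the quantities in the estimates -/

/-- The global space `V_h`. A function of this space is given by its continuous representatives
`w K` on the closed elements; these agree at the Gauss-Lobatto points of interior edges and vanish
at the Gauss-Lobatto points of boundary edges. -/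
def InVh (k : ℕ) {Ω : Set Plane} (T : Mesh Ω) (w : Fin T.card → Plane → ℝ) : Prop :=
  (∀ K, InLocalSpace k (T.elem K) (w K)) ∧
  (∀ K e K' e', T.IsInteriorEdge K e K' e' → ∀ t ∈ glNodes k,
    w K ((T.elem K).edgePt e t) = w K' ((T.elem K).edgePt e t)) ∧
  (∀ K (e : (T.elem K).Edge),
    segment ℝ ((T.elem K).vertex e) ((T.elem K).vertex (e + 1)) ⊆ frontier Ω →
      ∀ t ∈ glNodes k, w K ((T.elem K).edgePt e t) = 0)

/-- The data oscillation `η²_{5,K} = h_K⁴ ‖f - f_h‖²_{0,K}`, where `f_h|_K` is the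
`L²(K)`-projection of `f` onto polynomials of degree at most `k`. -/
def oscSq (k : ℕ) (K : PolygonalElement) (f : Plane → ℝ) : ℝ :=
  K.diam ^ 4 * l2NormSq K.carrier (fun x => f x - ev (l2Proj k K.carrier f) x)

/-- `h_K⁴ ‖f_h - Δ² p‖²_{0,K}`. -/
def elementResidualSq (k : ℕ) (K : PolygonalElement) (f : Plane → ℝ)
    (p : MvPolynomial (Fin 2) ℝ) : ℝ :=
  K.diam ^ 4 * l2NormSq K.carrier (fun x => ev (l2Proj k K.carrier f) x - ev (polyLap (polyLap p)) x)

/-- `h_e ‖[∂²p/∂n_e²]‖²_{0,e}` for the piecewise polynomial `p` equal to `pK` on `K` and to `pK'`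
on the other side of the edge `e` of `K`. -/
def momentJumpSq (K : PolygonalElement) (e : K.Edge) (pK pK' : MvPolynomial (Fin 2) ℝ) : ℝ :=
  K.len e * K.edgeIntegral e (fun x =>
    (polyD2 pK (K.normal e) x - polyD2 pK' (K.normal e) x) ^ 2)

/-- `h_e³ ‖[∂(Δp)/∂n_e + ∂³p/∂n_e∂t_e²]‖²_{0,e}` for the piecewise polynomial `p` equal to `pK`
on `K` and to `pK'` on the other side of the edge `e` of `K`. -/
def shearJumpSq (K : PolygonalElement) (e : K.Edge) (pK pK' : MvPolynomial (Fin 2) ℝ) : ℝ :=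
  K.len e ^ 3 * K.edgeIntegral e (fun x =>
    ((polyD1 (polyLap pK) (K.normal e) x + polyD3 pK (K.normal e) (K.tangent e) x) -
      (polyD1 (polyLap pK') (K.normal e) x + polyD3 pK' (K.normal e) (K.tangent e) x)) ^ 2)

/-- `|u - p|²_{2,K}`. -/
def energyErrorSq (K : PolygonalElement) (u : Plane → ℝ) (p : MvPolynomial (Fin 2) ℝ) : ℝ :=
  h2SemiSq K.carrier (fun x => u x - ev p x)

end

end IPVEM

open IPVEM

namespace IPVEM

noncomputable section

/-! ### Classical derivatives -/

/-! This is the bubble-function argument for lower bounds of residuals, with smooth cutoffs on discs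
in place of polynomial bubbles. It is carried out for an arbitrary piecewise polynomial p of degree
at most k and then applied to the projections.

For a test function v, the weak equation for u and integration by parts of ∇²p : ∇²v express the
element residual and the jumps, paired with v, through ∇²(u - p) : ∇²v and (f - f_h)v (`residual`).
Each pairing is bounded by Cauchy–Schwarz (`sq_residual_le`). It remains to choose v so that the
pairing dominates the squared norm of the residual, while v and its second derivatives are
controlled by that same norm. The control comes from equivalence of norms on finite-dimensional
polynomial spaces over a fixed reference disc, followed by a similarity; hence the constants depend
only on k and σ.

Element term: K contains a disc of radius σ²h_K. Let q = f_h - Δ²p and take v to be q times a cutoff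
on that disc. The pairing is at least the squared norm of q on the concentric half-size disc, one
factor cancels, and norm equivalence passes from the disc to K (`exists_elementResidualSq_le`).

Edge terms: shape regularity puts a half-disc of radius `edgeRatio σ * h_e` on each side of the
midpoint of an interior edge (`Mesh.IsRegular.disc_subset`). Because v is supported in that disc,
Green's formula is needed only on a half-plane (`setIntegral_halfPlane_hessDot`). Its boundary form
pairs the jump of ∂²p/∂n² with ∂v/∂n and the jump of the shear force with v. One function,
`edgeBump`, has ∂v/∂n proportional to the first jump and v proportional to minus the second on the
edge, so both jumps are estimated at once (`le_edgeForm_edgeBump`). The area terms that remain are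
element residuals, already bounded, and norm equivalence passes from a short middle piece to the
whole edge (`exists_jump_le`). -/

theorem hasFDerivAt_ev (p : MvPolynomial (Fin 2) ℝ) (x : Plane) :
    HasFDerivAt (ev p) (∑ i, ev (pd i p) x • (EuclideanSpace.proj i : Plane →L[ℝ] ℝ)) x := by
  induction p using MvPolynomial.induction_on with
  | C a =>
    have h : ev (MvPolynomial.C a) = fun _ => a := by funext y; simp [ev]
    rw [h]
    refine (hasFDerivAt_const a x).congr_fderiv ?_
    simp [ev]
  | add p q hp hq =>
    have h : ev (p + q) = fun y => ev p y + ev q y := funext fun y => ev_add p q y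
    rw [h]
    refine (hp.fun_add hq).congr_fderiv ?_
    simp only [map_add, ev_add, add_smul, Finset.sum_add_distrib]
  | mul_X p j hp =>
    have h : ev (p * MvPolynomial.X j) = fun y => ev p y * y j := by funext y; simp [ev]
    rw [h]
    refine (hp.fun_mul
      ((EuclideanSpace.proj j : Plane →L[ℝ] ℝ).hasFDerivAt (x := x))).congr_fderiv ?_
    ext v
    fin_cases j <;>
    simp [Fin.sum_univ_two, ev, Derivation.leibniz, MvPolynomial.pderiv_X] <;> ring

theorem contDiff_ev (p : MvPolynomial (Fin 2) ℝ) : ContDiff ℝ ∞ (ev p) := by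
  induction p using MvPolynomial.induction_on with
  | C a =>
    have h : ev (MvPolynomial.C a) = fun _ => a := by funext y; simp [ev]
    rw [h]; exact contDiff_const
  | add p q hp hq =>
    have h : ev (p + q) = fun y => ev p y + ev q y := funext fun y => ev_add p q y
    rw [h]; exact hp.add hq
  | mul_X p j hp =>
    have h : ev (p * MvPolynomial.X j) = fun y => ev p y * y j := by funext y; simp [ev]
    rw [h]
    exact hp.mul (EuclideanSpace.proj j : Plane →L[ℝ] ℝ).contDiff

theorem partialD_ev (i : Fin 2) (p : MvPolynomial (Fin 2) ℝ) : partialD i (ev p) = ev (pd i p) := by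
  funext x
  rw [partialD, (hasFDerivAt_ev p x).fderiv]
  fin_cases i <;> simp [Fin.sum_univ_two]

theorem ev_sub (p q : MvPolynomial (Fin 2) ℝ) (x : Plane) : ev (p - q) x = ev p x - ev q x := by
  simp [ev]

theorem fderiv_apply_eq (φ : Plane → ℝ) (x v : Plane) :
    fderiv ℝ φ x v = ∑ i, v i * partialD i φ x := by
  have hv : v = ∑ i, v i • (EuclideanSpace.single i (1 : ℝ) : Plane) := by
    ext j; fin_cases j <;> simp [Fin.sum_univ_two]
  conv_lhs => rw [hv]
  rw [map_sum]
  simp [partialD]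

theorem contDiff_partialD {φ : Plane → ℝ} (hφ : ContDiff ℝ ∞ φ) (i : Fin 2) :
    ContDiff ℝ ∞ (partialD i φ) :=
  (hφ.fderiv_right (m := ∞) (by simp)).clm_apply contDiff_const

theorem tsupport_partialD_subset (φ : Plane → ℝ) (i : Fin 2) :
    tsupport (partialD i φ) ⊆ tsupport φ :=
  tsupport_fderiv_apply_subset ℝ _

theorem partialD_add {φ ψ : Plane → ℝ} (hφ : ContDiff ℝ ∞ φ) (hψ : ContDiff ℝ ∞ ψ) (i : Fin 2) :
    partialD i (fun x => φ x + ψ x) = fun x => partialD i φ x + partialD i ψ x := by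
  funext x
  rw [partialD, fderiv_fun_add (hφ.differentiable (by simp) x) (hψ.differentiable (by simp) x)]
  rfl

theorem partialD_sub {φ ψ : Plane → ℝ} (hφ : ContDiff ℝ ∞ φ) (hψ : ContDiff ℝ ∞ ψ) (i : Fin 2) :
    partialD i (fun x => φ x - ψ x) = fun x => partialD i φ x - partialD i ψ x := by
  funext x
  rw [partialD, fderiv_fun_sub (hφ.differentiable (by simp) x) (hψ.differentiable (by simp) x)]
  rfl

theorem partialD_const_mul {φ : Plane → ℝ} (hφ : ContDiff ℝ ∞ φ) (c : ℝ) (i : Fin 2) :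
    partialD i (fun x => c * φ x) = fun x => c * partialD i φ x := by
  funext x
  rw [partialD, fderiv_const_mul (hφ.differentiable (by simp) x)]
  rfl

theorem partialD_mul {φ ψ : Plane → ℝ} (hφ : ContDiff ℝ ∞ φ) (hψ : ContDiff ℝ ∞ ψ) (i : Fin 2) :
    partialD i (fun x => φ x * ψ x) = fun x => partialD i φ x * ψ x + φ x * partialD i ψ x := by
  funext x
  rw [partialD, fderiv_fun_mul (hφ.differentiable (by simp) x) (hψ.differentiable (by simp) x)]
  simp [partialD]; ring

/-! ### Test functions -/

theorem IsTest.partialD {U : Set Plane} {φ : Plane → ℝ} (h : IsTest U φ) (i : Fin 2) :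
    IsTest U (partialD i φ) :=
  ⟨contDiff_partialD h.1 i, h.2.1.of_isClosed_subset (isClosed_tsupport _)
    (tsupport_partialD_subset φ i), (tsupport_partialD_subset φ i).trans h.2.2⟩

theorem IsTest.mono {U V : Set Plane} {φ : Plane → ℝ} (h : IsTest U φ) (hUV : U ⊆ V) :
    IsTest V φ := ⟨h.1, h.2.1, h.2.2.trans hUV⟩

theorem IsTest.eq_zero {U : Set Plane} {φ : Plane → ℝ} (h : IsTest U φ) {x : Plane}
    (hx : x ∉ U) : φ x = 0 :=
  image_eq_zero_of_notMem_tsupport fun h' => hx (h.2.2 h')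

theorem IsTest.memLp {U : Set Plane} {φ : Plane → ℝ} (h : IsTest U φ) (S : Set Plane) :
    MemLp φ 2 (volume.restrict S) :=
  (h.1.continuous.memLp_of_hasCompactSupport h.2.1).restrict S

/-- Passing through the whole plane lets integrals against a test function be moved between any two
sets containing its support. -/
theorem setIntegral_mul_test {U : Set Plane} {φ : Plane → ℝ} (h : IsTest U φ) (g : Plane → ℝ) :
    ∫ x in U, g x * φ x = ∫ x, g x * φ x :=
  setIntegral_eq_integral_of_forall_compl_eq_zero fun x hx => by rw [h.eq_zero hx, mul_zero]

theorem memLp_of_continuous {U : Set Plane} (hb : Bornology.IsBounded U) {g : Plane → ℝ}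
    (hg : Continuous g) : MemLp g 2 (volume.restrict U) := by
  rw [memLp_two_iff_integrable_sq hg.aestronglyMeasurable]
  exact integrableOn_of_continuous hb (hg.pow 2)

theorem integrable_mul_test {U : Set Plane} {g φ : Plane → ℝ} (hg : Continuous g)
    (h : IsTest U φ) : Integrable (fun x => g x * φ x) :=
  (hg.mul h.1.continuous).integrable_of_hasCompactSupport h.2.1.mul_left

/-- Integration by parts on the plane. -/
theorem integral_mul_partialD {U : Set Plane} {g φ : Plane → ℝ} (hg : ContDiff ℝ ∞ g)
    (h : IsTest U φ) (i : Fin 2) :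
    ∫ x, g x * partialD i φ x = - ∫ x, partialD i g x * φ x := by
  refine integral_mul_fderiv_eq_neg_fderiv_mul_of_integrable
    (f := g) (g := φ) (v := EuclideanSpace.single i 1) ?_ ?_ ?_ ?_ ?_
  · exact integrable_mul_test (contDiff_partialD hg i).continuous h
  · exact integrable_mul_test hg.continuous (h.partialD i)
  · exact integrable_mul_test hg.continuous h
  · exact fun x _ => hg.differentiable (by simp) x
  · exact fun x _ => h.1.differentiable (by simp) x

theorem integral_test_partialD {U : Set Plane} {g φ : Plane → ℝ} (hg : ContDiff ℝ ∞ g)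
    (h : IsTest U φ) (i : Fin 2) :
    ∫ x in U, g x * partialD i φ x = - ∫ x in U, partialD i g x * φ x := by
  rw [setIntegral_mul_test (h.partialD i), setIntegral_mul_test h, integral_mul_partialD hg h]

theorem integrable_mul_of_memLp {μ : Measure Plane} {f g : Plane → ℝ} (hf : MemLp f 2 μ)
    (hg : MemLp g 2 μ) : Integrable (fun x => f x * g x) μ :=
  hf.integrable_mul hg

/-! ### Weak derivatives -/

/-- The fundamental lemma of the calculus of variations, applied to g - g'. Since `weakPartial` is
an arbitrary choice, this is what allows it to be computed. -/
theorem HasWeakPartial.unique {U : Set Plane} (hU : IsOpen U) {i : Fin 2} {v g g' : Plane → ℝ}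
    (h : HasWeakPartial U i v g) (h' : HasWeakPartial U i v g') :
    g =ᵐ[volume.restrict U] g' := by
  have hl : LocallyIntegrableOn (fun x => g x - g' x) U := by
    have := (h.1.sub h'.1).locallyIntegrable (by norm_num)
    exact locallyIntegrableOn_of_locallyIntegrable_restrict this
  have key := hU.ae_eq_zero_of_integral_contDiff_smul_eq_zero hl (fun φ h1 h2 h3 => by
    have ht : IsTest U φ := ⟨h1, h2, h3⟩
    have e := (h.2 φ ht).symm.trans (h'.2 φ ht)
    have e1 : ∫ x, φ x • (g x - g' x) = ∫ x in U, (g x * φ x - g' x * φ x) := by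
      have : ∀ x, φ x • (g x - g' x) = (g x - g' x) * φ x := fun x => by
        rw [smul_eq_mul]; ring
      simp only [this]
      rw [← setIntegral_mul_test ht]
      simp only [sub_mul]
    rw [e1, integral_sub (integrable_mul_of_memLp h.1 (ht.memLp U))
      (integrable_mul_of_memLp h'.1 (ht.memLp U))]
    linarith)
  rw [Filter.EventuallyEq, ae_restrict_iff' hU.measurableSet]
  filter_upwards [key] with x hx hxU
  linarith [hx hxU]

theorem hasWeakPartial_weakPartial {U : Set Plane} {i : Fin 2} {v : Plane → ℝ}
    (h : ∃ g, HasWeakPartial U i v g) : HasWeakPartial U i v (weakPartial U i v) := by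
  rw [weakPartial, dif_pos h]
  exact h.choose_spec

theorem HasWeakPartial.weakPartial_ae {U : Set Plane} (hU : IsOpen U) {i : Fin 2}
    {v g : Plane → ℝ} (h : HasWeakPartial U i v g) :
    weakPartial U i v =ᵐ[volume.restrict U] g :=
  (hasWeakPartial_weakPartial ⟨g, h⟩).unique hU h

/-- Second weak derivatives are taken of a chosen representative of the first one, which is known
only almost everywhere. -/
theorem HasWeakPartial.congr {U : Set Plane} {i : Fin 2} {v v' g : Plane → ℝ}
    (h : HasWeakPartial U i v g) (e : v =ᵐ[volume.restrict U] v') : HasWeakPartial U i v' g :=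
  ⟨h.1, fun φ hφ => by
    rw [← h.2 φ hφ]
    exact integral_congr_ae (e.symm.mono fun x hx => by simp only [hx])⟩

theorem HasWeakPartial.restrict {U V : Set Plane} (hVU : V ⊆ U) {i : Fin 2}
    {v g : Plane → ℝ} (h : HasWeakPartial U i v g) : HasWeakPartial V i v g :=
  ⟨h.1.mono_measure (Measure.restrict_mono hVU le_rfl), fun φ hφ => by
    have := h.2 φ (hφ.mono hVU)
    rw [setIntegral_mul_test ((hφ.mono hVU).partialD i), setIntegral_mul_test (hφ.mono hVU)] at this
    rw [setIntegral_mul_test (hφ.partialD i), setIntegral_mul_test hφ, this]⟩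

theorem hasWeakPartial_of_contDiff {U : Set Plane} (i : Fin 2) {φ : Plane → ℝ}
    (h : ContDiff ℝ ∞ φ) (hm : MemLp (partialD i φ) 2 (volume.restrict U)) :
    HasWeakPartial U i φ (partialD i φ) :=
  ⟨hm, fun _ hψ => integral_test_partialD h hψ i⟩

theorem HasWeakPartial.sub_ev {U : Set Plane} (hb : Bornology.IsBounded U) {i : Fin 2}
    {v g : Plane → ℝ} (hv : MemLp v 2 (volume.restrict U)) (h : HasWeakPartial U i v g)
    (p : MvPolynomial (Fin 2) ℝ) :
    HasWeakPartial U i (fun x => v x - ev p x) (fun x => g x - ev (pd i p) x) := by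
  have hp := memLp_of_continuous hb (continuous_ev p)
  have hp' := memLp_of_continuous hb (continuous_ev (pd i p))
  refine ⟨h.1.sub hp', fun φ hφ => ?_⟩
  have e := integral_test_partialD (contDiff_ev p) hφ i
  rw [partialD_ev] at e
  simp only [sub_mul]
  rw [integral_sub (integrable_mul_of_memLp hv ((hφ.partialD i).memLp U))
      (integrable_mul_of_memLp hp ((hφ.partialD i).memLp U)),
    integral_sub (integrable_mul_of_memLp h.1 (hφ.memLp U))
      (integrable_mul_of_memLp hp' (hφ.memLp U)), h.2 φ hφ, e]
  ring

theorem IsTest.weakPartial_ae {U : Set Plane} (hU : IsOpen U) {φ : Plane → ℝ} (h : IsTest U φ)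
    (i : Fin 2) : weakPartial U i φ =ᵐ[volume.restrict U] IPVEM.partialD i φ :=
  (hasWeakPartial_of_contDiff i h.1 ((h.partialD i).memLp U)).weakPartial_ae hU

theorem IsTest.hasWeakPartial_weakPartial {U : Set Plane} (hU : IsOpen U) {φ : Plane → ℝ}
    (h : IsTest U φ) (i j : Fin 2) :
    HasWeakPartial U i (weakPartial U j φ) (IPVEM.partialD i (IPVEM.partialD j φ)) :=
  (hasWeakPartial_of_contDiff i (h.partialD j).1 (((h.partialD j).partialD i).memLp U)).congr
    (h.weakPartial_ae hU j).symm

theorem hasWeakPartial_zero (U : Set Plane) (i : Fin 2) {v : Plane → ℝ}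
    (hv : v =ᵐ[volume.restrict U] 0) : HasWeakPartial U i v 0 :=
  ⟨MemLp.zero, fun φ _ => by
    have : ∫ x in U, v x * partialD i φ x = ∫ x in U, (0 : ℝ) :=
      integral_congr_ae (hv.mono fun x hx => by simp [hx])
    rw [this]; simp⟩

theorem l2NormSq_eq_zero {U : Set Plane} {v : Plane → ℝ} (hv : v =ᵐ[volume.restrict U] 0) :
    l2NormSq U v = 0 := by
  have : ∫ x in U, v x ^ 2 = ∫ x in U, (0 : ℝ) :=
    integral_congr_ae (hv.mono fun x hx => by simp [hx])
  rw [l2NormSq, this]; simp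

theorem IsTest.memH20 {U : Set Plane} (hU : IsOpen U) {φ : Plane → ℝ} (h : IsTest U φ) :
    MemH20 U φ := by
  refine ⟨⟨⟨h.memLp U, fun i => ⟨_, hasWeakPartial_of_contDiff i h.1 ((h.partialD i).memLp U)⟩⟩,
    fun i => ⟨((h.partialD i).memLp U).ae_eq (h.weakPartial_ae hU i).symm,
      fun j => ⟨_, h.hasWeakPartial_weakPartial hU j i⟩⟩⟩, fun _ => φ, fun _ => h, ?_⟩
  -- The approximating sequence is constantly φ. The chosen weak derivatives of φ - φ are zero only
  -- almost everywhere, which suffices for the norms.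
  have h1 : ∀ i, weakPartial U i (φ - φ) =ᵐ[volume.restrict U] 0 := fun i =>
    (hasWeakPartial_zero U i (by simp)).weakPartial_ae hU
  have h2 : ∀ i j, weakPartial U i (weakPartial U j (φ - φ)) =ᵐ[volume.restrict U] 0 := fun i j =>
    (hasWeakPartial_zero U i (h1 j)).weakPartial_ae hU
  have h3 : l2NormSq U (φ - φ) = 0 := l2NormSq_eq_zero (by simp)
  simp only [h1SemiSq, h2SemiSq, h3, l2NormSq_eq_zero (h1 _), l2NormSq_eq_zero (h2 _ _)]
  simp

/-- The weak solution tested with a function in `C_c^∞(Ω)`. -/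
theorem IsWeakSolution.test {Ω : Set Plane} (hΩ : IsOpen Ω) {f u : Plane → ℝ}
    (hu : IsWeakSolution Ω f u) {φ : Plane → ℝ} (h : IsTest Ω φ) :
    ∑ i, ∑ j, ∫ x in Ω, weakPartial Ω i (weakPartial Ω j u) x * partialD i (partialD j φ) x =
      ∫ x in Ω, f x * φ x := by
  rw [← hu.2 φ (h.memH20 hΩ), bilinA]
  refine Finset.sum_congr rfl fun i _ => Finset.sum_congr rfl fun j _ => ?_
  refine integral_congr_ae ?_
  filter_upwards [(h.hasWeakPartial_weakPartial hΩ i j).weakPartial_ae hΩ] with x hx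
  rw [hx]

/-- Restriction and subtraction of a polynomial commute with weak differentiation, so the error on K
can be read off from the weak Hessian of u on Ω, the one that occurs in the variational equation. -/
theorem energyErrorSq_eq {Ω : Set Plane} {K : PolygonalElement} (hK : K.carrier ⊆ Ω)
    {u : Plane → ℝ} (hu : MemH2 Ω u) (p : MvPolynomial (Fin 2) ℝ) :
    energyErrorSq K u p = ∑ i, ∑ j, ∫ x in K.carrier,
      (weakPartial Ω i (weakPartial Ω j u) x - ev (pd i (pd j p)) x) ^ 2 := by
  have hO := K.isOpen_carrier
  have hb := K.isBounded_carrier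
  have hr : ∀ {g : Plane → ℝ}, MemLp g 2 (volume.restrict Ω) →
      MemLp g 2 (volume.restrict K.carrier) := fun hg =>
    hg.mono_measure (Measure.restrict_mono hK le_rfl)
  rw [energyErrorSq, h2SemiSq]
  refine Finset.sum_congr rfl fun i _ => Finset.sum_congr rfl fun j _ => ?_
  have h1 : HasWeakPartial K.carrier j (fun x => u x - ev p x)
      (fun x => weakPartial Ω j u x - ev (pd j p) x) :=
    ((hasWeakPartial_weakPartial (hu.1.2 j)).restrict hK).sub_ev hb (hr hu.1.1) p
  have h2 : HasWeakPartial K.carrier i (fun x => weakPartial Ω j u x - ev (pd j p) x)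
      (fun x => weakPartial Ω i (weakPartial Ω j u) x - ev (pd i (pd j p)) x) :=
    ((hasWeakPartial_weakPartial ((hu.2 j).2 i)).restrict hK).sub_ev hb (hr (hu.2 j).1) _
  have h3 := (h2.congr (h1.weakPartial_ae hO).symm).weakPartial_ae hO
  rw [l2NormSq]
  refine integral_congr_ae ?_
  filter_upwards [h3] with x hx
  rw [hx]

/-! ### Green's formula on a half-plane -/

/-- The vector `t` turned by a right angle clockwise. -/
def turn (t : Plane) : Plane := !₂[t 1, -t 0]

@[simp] theorem turn_zero (t : Plane) : turn t 0 = t 1 := by simp [turn]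

@[simp] theorem turn_one (t : Plane) : turn t 1 = -t 0 := by simp [turn]

theorem plane_norm_sq (x : Plane) : ‖x‖ ^ 2 = x 0 ^ 2 + x 1 ^ 2 := by
  rw [EuclideanSpace.norm_sq_eq]; simp [Fin.sum_univ_two]

/-- The rotation taking the standard basis to `t`, `turn t`. -/
def rotation (t : Plane) (ht : t 0 ^ 2 + t 1 ^ 2 = 1) : Plane ≃ₗᵢ[ℝ] Plane :=
  LinearIsometry.toLinearIsometryEquiv
    { toFun := fun y => y 0 • t + y 1 • turn t
      map_add' := fun x y => by simp only [PiLp.add_apply, add_smul]; abel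
      map_smul' := fun c y => by simp only [PiLp.smul_apply, smul_eq_mul, mul_smul, smul_add,
        RingHom.id_apply]
      norm_map' := fun y => by
        rw [← sq_eq_sq₀ (norm_nonneg _) (norm_nonneg _), plane_norm_sq, plane_norm_sq]
        simp
        linear_combination (y 0 ^ 2 + y 1 ^ 2) * ht } rfl

theorem rotation_apply (t : Plane) (ht : t 0 ^ 2 + t 1 ^ 2 = 1) (y : Plane) :
    rotation t ht y = y 0 • t + y 1 • turn t := rfl

/-- The point with coordinates `a` in the direction `t` and `b` in the direction `turn t`, relative
to `m`. -/
def framePt (m t : Plane) (a b : ℝ) : Plane := m + (a • t + b • turn t)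

theorem framePt_apply (m t : Plane) (a b : ℝ) (i : Fin 2) :
    framePt m t a b i = m i + (a * t i + b * turn t i) := by
  simp [framePt]

/-- The frame map is a rotation followed by a translation, after identifying ℝ × ℝ with the plane.
It straightens a half-plane into a product, where Fubini applies. -/
theorem measurePreserving_framePt (m t : Plane) (ht : t 0 ^ 2 + t 1 ^ 2 = 1) :
    MeasurePreserving (fun p : ℝ × ℝ => framePt m t p.1 p.2) ∧
      MeasurableEmbedding (fun p : ℝ × ℝ => framePt m t p.1 p.2) := by
  have e1 := (volume_preserving_finTwoArrow ℝ).symm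
  have e2 := PiLp.volume_preserving_toLp (Fin 2)
  have e3 := (rotation t ht).measurePreserving
  have e4 := measurePreserving_add_left (volume : Measure Plane) m
  have h : (fun p : ℝ × ℝ => framePt m t p.1 p.2) = (fun x => m + x) ∘ (rotation t ht) ∘
      (WithLp.toLp 2) ∘ (MeasurableEquiv.finTwoArrow (α := ℝ)).symm := by
    funext p
    simp [framePt, rotation_apply, MeasurableEquiv.finTwoArrow]
  rw [h]
  refine ⟨e4.comp (e3.comp (e2.comp e1)), ?_⟩
  refine (measurableEmbedding_addLeft m).comp
    ((rotation t ht).toMeasurableEquiv.measurableEmbedding.comp (MeasurableEmbedding.comp ?_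
      (MeasurableEquiv.measurableEmbedding _)))
  exact (MeasurableEquiv.toLp 2 (Fin 2 → ℝ)).measurableEmbedding

/-- The open half-plane `{⟨x - m, n⟩ < 0}`. -/
def halfPlane (m n : Plane) : Set Plane :=
  {x | (x 0 - m 0) * n 0 + (x 1 - m 1) * n 1 < 0}

theorem isOpen_halfPlane (m n : Plane) : IsOpen (halfPlane m n) :=
  isOpen_lt (by fun_prop) continuous_const

theorem preimage_halfPlane (m t : Plane) (ht : t 0 ^ 2 + t 1 ^ 2 = 1) :
    (fun p : ℝ × ℝ => framePt m t p.1 p.2) ⁻¹' halfPlane m (turn t) =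
      Set.univ ×ˢ Set.Iio (0 : ℝ) := by
  ext p
  simp only [halfPlane, Set.mem_preimage, Set.mem_ofPred_eq, Set.mem_prod, Set.mem_univ, true_and,
    Set.mem_Iio, framePt_apply, turn_zero, turn_one]
  have : (m 0 + (p.1 * t 0 + p.2 * t 1) - m 0) * t 1 +
      (m 1 + (p.1 * t 1 + p.2 * -t 0) - m 1) * -t 0 = p.2 := by linear_combination p.2 * ht
  rw [this]

theorem hasDerivAt_comp_line {g : Plane → ℝ} (hg : ContDiff ℝ ∞ g) (x v : Plane) (s : ℝ) :
    HasDerivAt (fun s : ℝ => g (x + s • v)) (∑ i, v i * partialD i g (x + s • v)) s := by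
  have h1 : HasDerivAt (fun s : ℝ => x + s • v) v s := by
    simpa using ((hasDerivAt_id s).smul_const v).const_add x
  have h2 := (hg.differentiable (by simp) (x + s • v)).hasFDerivAt.comp_hasDerivAt s h1
  rwa [fderiv_apply_eq] at h2

theorem hasCompactSupport_comp_line {g : Plane → ℝ} (hg : HasCompactSupport g) (x v : Plane)
    (hv : v 0 ^ 2 + v 1 ^ 2 = 1) : HasCompactSupport (fun s : ℝ => g (x + s • v)) := by
  have hn : ‖v‖ = 1 := by
    have := plane_norm_sq v
    rw [hv] at this
    nlinarith [norm_nonneg v]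
  have hi : Isometry (fun s : ℝ => x + s • v) := by
    refine Isometry.of_dist_eq fun a b => ?_
    rw [dist_add_left, dist_eq_norm, ← sub_smul, norm_smul, hn, mul_one, dist_eq_norm]
  exact hg.comp_isClosedEmbedding hi.isClosedEmbedding

theorem contDiff_comp_line {g : Plane → ℝ} (hg : ContDiff ℝ ∞ g) (x v : Plane) :
    ContDiff ℝ ∞ (fun s : ℝ => g (x + s • v)) :=
  hg.comp (contDiff_const.add (contDiff_id.smul contDiff_const))

theorem integral_deriv_line {g : Plane → ℝ} (hg : ContDiff ℝ ∞ g) (hc : HasCompactSupport g)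
    (x v : Plane) (hv : v 0 ^ 2 + v 1 ^ 2 = 1) :
    ∫ s : ℝ, ∑ i, v i * partialD i g (x + s • v) = 0 := by
  have h1 := hasCompactSupport_comp_line hc x v hv
  have h2 := contDiff_comp_line hg x v
  have h3 : deriv (fun s : ℝ => g (x + s • v)) = fun s => ∑ i, v i * partialD i g (x + s • v) :=
    funext fun s => (hasDerivAt_comp_line hg x v s).deriv
  refine integral_eq_zero_of_hasDerivAt_of_integrable (hasDerivAt_comp_line hg x v) ?_
    (h2.continuous.integrable_of_hasCompactSupport h1)
  rw [← h3]
  exact (h2.continuous_deriv (by simp)).integrable_of_hasCompactSupport h1.deriv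

theorem integral_Iio_deriv_line {g : Plane → ℝ} (hg : ContDiff ℝ ∞ g) (hc : HasCompactSupport g)
    (x v : Plane) (hv : v 0 ^ 2 + v 1 ^ 2 = 1) :
    ∫ s in Set.Iio (0 : ℝ), ∑ i, v i * partialD i g (x + s • v) = g x := by
  have h1 := hasCompactSupport_comp_line hc x v hv
  have h2 := contDiff_comp_line hg x v
  have h3 : deriv (fun s : ℝ => g (x + s • v)) = fun s => ∑ i, v i * partialD i g (x + s • v) :=
    funext fun s => (hasDerivAt_comp_line hg x v s).deriv
  have h4 := h1.integral_Iic_deriv_eq (h2.of_le (by simp)) 0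
  rw [h3, integral_Iic_eq_integral_Iio] at h4
  simpa using h4

theorem integrable_partialD {g : Plane → ℝ} (hg : ContDiff ℝ ∞ g) (hc : HasCompactSupport g)
    (i : Fin 2) : Integrable (partialD i g) :=
  have h : IsTest Set.univ g := ⟨hg, hc, Set.subset_univ _⟩
  (h.partialD i).1.continuous.integrable_of_hasCompactSupport (h.partialD i).2.1

theorem setIntegral_halfPlane (m t : Plane) (ht : t 0 ^ 2 + t 1 ^ 2 = 1) (g : Plane → ℝ) :
    ∫ x in halfPlane m (turn t), g x =
      ∫ p in Set.univ ×ˢ Set.Iio (0 : ℝ), g (framePt m t p.1 p.2) := by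
  obtain ⟨h1, h2⟩ := measurePreserving_framePt m t ht
  rw [← preimage_halfPlane m t ht, h1.setIntegral_preimage_emb h2]

/-- The Gauss theorem on a half-plane. -/
theorem setIntegral_halfPlane_partialD (m t : Plane) (ht : t 0 ^ 2 + t 1 ^ 2 = 1) {g : Plane → ℝ}
    (hg : ContDiff ℝ ∞ g) (hc : HasCompactSupport g) (i : Fin 2) :
    ∫ x in halfPlane m (turn t), partialD i g x = turn t i * ∫ s : ℝ, g (m + s • t) := by
  obtain ⟨h1, h2⟩ := measurePreserving_framePt m t ht
  have hn : turn t 0 ^ 2 + turn t 1 ^ 2 = 1 := by simp; linarith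
  have hint : ∀ v : Plane, Integrable (fun x => ∑ j, v j * partialD j g x) := fun v =>
    integrable_finsetSum _ fun j _ => (integrable_partialD hg hc j).const_mul _
  have hF : ∀ v : Plane, IntegrableOn
      (fun p : ℝ × ℝ => ∑ j, v j * partialD j g (framePt m t p.1 p.2))
      (Set.univ ×ˢ Set.Iio (0 : ℝ)) (volume.prod volume) := fun v =>
    ((h1.integrable_comp_emb h2).2 (hint v)).integrableOn
  -- The coordinate derivative is decomposed into its tangential and normal parts.
  have hd : ∀ x, partialD i g x = t i * (∑ j, t j * partialD j g x) +
      turn t i * (∑ j, turn t j * partialD j g x) := by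
    intro x
    simp only [Fin.sum_univ_two, turn_zero, turn_one]
    fin_cases i
    · simp
      linear_combination (-partialD 0 g x) * ht
    · simp
      linear_combination (-partialD 1 g x) * ht
  -- Fubini is used with the tangential variable innermost: on each line parallel to the boundary,
  -- the derivative of a compactly supported function integrates to zero.
  have ht0 : ∫ x in halfPlane m (turn t), ∑ j, t j * partialD j g x = 0 := by
    rw [setIntegral_halfPlane m t ht, Measure.volume_eq_prod, ← setIntegral_prod_swap,
      setIntegral_prod _ (show IntegrableOn (fun z : ℝ × ℝ =>
        ∑ j, t j * partialD j g (framePt m t z.swap.1 z.swap.2)) _ _ from (hF t).swap)]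
    simp only [Prod.swap, Measure.restrict_univ]
    refine integral_eq_zero_of_ae (ae_of_all _ fun b => ?_)
    refine Eq.trans ?_ (integral_deriv_line hg hc (m + b • turn t) t ht)
    refine integral_congr_ae (ae_of_all _ fun a => ?_)
    have e : framePt m t a b = m + b • turn t + a • t := by simp only [framePt]; abel
    simp only [e]
  -- Here the normal variable is innermost, and each half-line contributes the value of g at its
  -- boundary endpoint.
  have hn0 : ∫ x in halfPlane m (turn t), ∑ j, turn t j * partialD j g x =
      ∫ s : ℝ, g (m + s • t) := by
    rw [setIntegral_halfPlane m t ht, Measure.volume_eq_prod, setIntegral_prod _ (hF _)]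
    simp only [Measure.restrict_univ]
    refine integral_congr_ae (ae_of_all _ fun a => ?_)
    have := integral_Iio_deriv_line hg hc (m + a • t) (turn t) hn
    simp only
    rw [← this]
    refine integral_congr_ae (ae_of_all _ fun b => ?_)
    have e : framePt m t a b = m + a • t + b • turn t := by simp only [framePt]; abel
    simp only [e]
  simp only [hd]
  rw [integral_add ((hint t).const_mul _).integrableOn ((hint _).const_mul _).integrableOn,
    integral_const_mul, integral_const_mul, ht0, hn0]
  ring

/-! ### Integration by parts for the Hessian form. -/

theorem pd_comm (i j : Fin 2) (p : MvPolynomial (Fin 2) ℝ) : pd i (pd j p) = pd j (pd i p) := by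
  have h : ∀ p : MvPolynomial (Fin 2) ℝ, ⁅(MvPolynomial.pderiv i : Derivation ℝ _ _),
      (MvPolynomial.pderiv j : Derivation ℝ (MvPolynomial (Fin 2) ℝ) _)⁆ p = 0 := by
    intro p
    have : ⁅(MvPolynomial.pderiv i : Derivation ℝ (MvPolynomial (Fin 2) ℝ) _),
      (MvPolynomial.pderiv j : Derivation ℝ (MvPolynomial (Fin 2) ℝ) _)⁆ = 0 := by
      -- The commutator of two derivations is a derivation, so it is enough that it kills the
      -- variables.
      refine MvPolynomial.derivation_ext fun l => ?_
      simp [Derivation.commutator_apply, MvPolynomial.pderiv_X, Pi.single_apply,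
        apply_ite (MvPolynomial.pderiv _)]
    rw [this]; rfl
  have := h p
  rw [Derivation.commutator_apply] at this
  exact sub_eq_zero.1 this

theorem ev_polyLap (p : MvPolynomial (Fin 2) ℝ) (x : Plane) :
    ev (polyLap p) x = ev (pd 0 (pd 0 p)) x + ev (pd 1 (pd 1 p)) x := by
  simp [polyLap, Fin.sum_univ_two, ev_add]

/-- `∇²p : ∇²v`. -/
def hessDot (p : MvPolynomial (Fin 2) ℝ) (v : Plane → ℝ) (x : Plane) : ℝ :=
  ∑ i, ∑ j, ev (pd i (pd j p)) x * partialD i (partialD j v) x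

/-- The components of the vector field with divergence `∇²p : ∇²v - Δ²p v`. -/
def greenField (p : MvPolynomial (Fin 2) ℝ) (v : Plane → ℝ) (i : Fin 2) (x : Plane) : ℝ :=
  (∑ j, ev (pd i (pd j p)) x * partialD j v x) - ev (pd i (polyLap p)) x * v x

theorem contDiff_greenField (p : MvPolynomial (Fin 2) ℝ) {v : Plane → ℝ} (hv : ContDiff ℝ ∞ v)
    (i : Fin 2) : ContDiff ℝ ∞ (greenField p v i) :=
  (ContDiff.sum fun j _ => (contDiff_ev _).mul (contDiff_partialD hv j)).sub
    ((contDiff_ev _).mul hv)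

theorem IsTest.greenField {U : Set Plane} (p : MvPolynomial (Fin 2) ℝ) {v : Plane → ℝ}
    (h : IsTest U v) (i : Fin 2) : HasCompactSupport (greenField p v i) := by
  have h1 : ∀ j, HasCompactSupport (fun x => ev (pd i (pd j p)) x * IPVEM.partialD j v x) :=
    fun j => (h.partialD j).2.1.mul_left
  have h2 : HasCompactSupport (fun x => ev (pd i (polyLap p)) x * v x) := h.2.1.mul_left
  have e : IPVEM.greenField p v i = (fun x => ev (pd i (pd 0 p)) x * IPVEM.partialD 0 v x) +
      (fun x => ev (pd i (pd 1 p)) x * IPVEM.partialD 1 v x) -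
      (fun x => ev (pd i (polyLap p)) x * v x) := by
    funext x; simp [IPVEM.greenField, Fin.sum_univ_two]
  rw [e]
  exact ((h1 0).add (h1 1)).sub h2

/-- Differentiating the Hessian factor gives ∇Δp · ∇v, because third derivatives commute; the
product rule for the subtracted term v∇Δp cancels it. -/
theorem div_greenField (p : MvPolynomial (Fin 2) ℝ) {v : Plane → ℝ} (hv : ContDiff ℝ ∞ v)
    (x : Plane) : ∑ i, partialD i (greenField p v i) x =
      hessDot p v x - ev (polyLap (polyLap p)) x * v x := by
  have hmul : ∀ i j, ContDiff ℝ ∞ (fun x => ev (pd i (pd j p)) x * partialD j v x) := fun i j =>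
    (contDiff_ev _).mul (contDiff_partialD hv j)
  have e : ∀ i, greenField p v i = fun x => (ev (pd i (pd 0 p)) x * partialD 0 v x +
      ev (pd i (pd 1 p)) x * partialD 1 v x) - ev (pd i (polyLap p)) x * v x := fun i => by
    funext x; simp [greenField, Fin.sum_univ_two]
  have e2 : ∀ i, partialD i (greenField p v i) x = ev (pd i (pd i (pd 0 p))) x * partialD 0 v x +
      ev (pd i (pd 0 p)) x * partialD i (partialD 0 v) x +
      (ev (pd i (pd i (pd 1 p))) x * partialD 1 v x +
      ev (pd i (pd 1 p)) x * partialD i (partialD 1 v) x) -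
      (ev (pd i (pd i (polyLap p))) x * v x + ev (pd i (polyLap p)) x * partialD i v x) := by
    intro i
    rw [e i, partialD_sub ((hmul i 0).add (hmul i 1)) ((contDiff_ev _).mul hv),
      partialD_add (hmul i 0) (hmul i 1), partialD_mul (contDiff_ev _) (contDiff_partialD hv 0),
      partialD_mul (contDiff_ev _) (contDiff_partialD hv 1), partialD_mul (contDiff_ev _) hv]
    simp only [partialD_ev]
  have c1 : pd 1 (pd 1 (pd 0 p)) = pd 0 (pd 1 (pd 1 p)) := by rw [pd_comm 1 0, pd_comm 1 0]
  have c2 : pd 0 (pd 0 (pd 1 p)) = pd 1 (pd 0 (pd 0 p)) := by rw [pd_comm 0 1, pd_comm 0 1]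
  have c3 : ∀ i, pd i (polyLap p) = pd i (pd 0 (pd 0 p)) + pd i (pd 1 (pd 1 p)) := fun i => by
    simp [polyLap, Fin.sum_univ_two]
  simp only [Fin.sum_univ_two, e2, hessDot, ev_polyLap, c1, c2]
  simp only [c3, ev_add, map_add]
  ring

theorem integral_partialD_eq_zero {U : Set Plane} {g : Plane → ℝ} (hg : IsTest U g) (i : Fin 2) :
    ∫ x, partialD i g x = 0 := by
  have := integral_mul_partialD (contDiff_const (c := (1 : ℝ))) hg i
  simpa [partialD] using this

theorem integrable_hessDot {U : Set Plane} (p : MvPolynomial (Fin 2) ℝ) {v : Plane → ℝ}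
    (h : IsTest U v) : Integrable (hessDot p v) :=
  integrable_finsetSum _ fun i _ => integrable_finsetSum _ fun j _ =>
    integrable_mul_test (continuous_ev _) ((h.partialD j).partialD i)

/-- The divergence of the compactly supported Green field has integral zero. -/
theorem integral_hessDot {U : Set Plane} (p : MvPolynomial (Fin 2) ℝ) {v : Plane → ℝ}
    (h : IsTest U v) : ∫ x, hessDot p v x = ∫ x, ev (polyLap (polyLap p)) x * v x := by
  have h1 : ∀ i, IsTest Set.univ (greenField p v i) := fun i =>
    ⟨contDiff_greenField p h.1 i, h.greenField p i, Set.subset_univ _⟩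
  have h2 : ∫ x, ∑ i, partialD i (greenField p v i) x = 0 := by
    rw [integral_finsetSum _ fun i _ => integrable_partialD (h1 i).1 (h1 i).2.1 i]
    exact Finset.sum_eq_zero fun i _ => integral_partialD_eq_zero (h1 i) i
  simp only [div_greenField p h.1] at h2
  rw [integral_sub (integrable_hessDot p h) (integrable_mul_test (continuous_ev _) h)] at h2
  linarith

/-- Green's formula for the Hessian inner product on a half-plane with boundary tangent `t` and
outward normal `turn t`. -/
theorem setIntegral_halfPlane_hessDot {U : Set Plane} (m t : Plane) (ht : t 0 ^ 2 + t 1 ^ 2 = 1)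
    (p : MvPolynomial (Fin 2) ℝ) {v : Plane → ℝ} (h : IsTest U v) :
    ∫ x in halfPlane m (turn t), hessDot p v x =
      (∫ x in halfPlane m (turn t), ev (polyLap (polyLap p)) x * v x) +
      ∫ s : ℝ, (polyD2 p (turn t) (m + s • t) *
          (∑ j, turn t j * partialD j v (m + s • t)) -
        (polyD1 (polyLap p) (turn t) (m + s • t) + polyD3 p (turn t) t (m + s • t)) *
          v (m + s • t)) := by
  have h2 : ∫ x in halfPlane m (turn t), ∑ i, partialD i (greenField p v i) x =
      ∑ i, turn t i * ∫ s : ℝ, greenField p v i (m + s • t) := by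
    rw [integral_finsetSum _ fun i _ =>
      (integrable_partialD (contDiff_greenField p h.1 i) (h.greenField p i) i).integrableOn]
    exact Finset.sum_congr rfl fun i _ =>
      setIntegral_halfPlane_partialD m t ht (contDiff_greenField p h.1 i) (h.greenField p i) i
  simp only [div_greenField p h.1] at h2
  rw [integral_sub (integrable_hessDot p h).integrableOn
    (integrable_mul_test (continuous_ev _) h).integrableOn] at h2
  have hline : ∀ {g : Plane → ℝ}, Continuous g → HasCompactSupport g →
      Integrable (fun s : ℝ => g (m + s • t)) := fun hg hc =>
    (hg.comp (by fun_prop)).integrable_of_hasCompactSupport (hasCompactSupport_comp_line hc m t ht)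
  have hi : ∀ i, Integrable (fun s : ℝ => greenField p v i (m + s • t)) := fun i =>
    hline (contDiff_greenField p h.1 i).continuous (h.greenField p i)
  -- the tangential derivative is integrated by parts along the boundary
  let q : MvPolynomial (Fin 2) ℝ := ∑ i, ∑ j, MvPolynomial.C (turn t i * t j) * pd i (pd j p)
  have hq : ∀ x, ev q x = ∑ i, ∑ j, turn t i * t j * ev (pd i (pd j p)) x := by
    intro x; simp [q, ev]; ring
  have hq' : ∀ l x, ev (pd l q) x = ∑ i, ∑ j, turn t i * t j * ev (pd i (pd j (pd l p))) x := by
    intro l x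
    have : pd l q = ∑ i, ∑ j, MvPolynomial.C (turn t i * t j) * pd i (pd j (pd l p)) := by
      simp only [q, map_sum, MvPolynomial.pderiv_C_mul, pd_comm l]
    rw [this]; simp [ev]
  have hqv : IsTest U (fun x => ev q x * v x) := by
    refine ⟨(contDiff_ev q).mul h.1, h.2.1.mul_left, ?_⟩
    exact (tsupport_mul_subset_right (f := ev q) (g := v)).trans h.2.2
  have h3 := integral_deriv_line hqv.1 hqv.2.1 m t ht
  have hpm : ∀ i x, partialD i (fun x => ev q x * v x) x =
      ev (pd i q) x * v x + ev q x * partialD i v x := fun i x => by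
    rw [partialD_mul (contDiff_ev q) h.1, partialD_ev]
  -- With n = `turn t` and q = ∂²p/∂n∂t, the flux contains the term q ∂v/∂t, which equals ∂(qv)/∂t -
  -- (∂³p/∂n∂t²)v. The total derivative integrates to zero along the line by `h3`, and the rest
  -- joins the shear force.
  have h4 : ∀ s : ℝ, (∑ i, turn t i * greenField p v i (m + s • t)) =
      (polyD2 p (turn t) (m + s • t) * (∑ j, turn t j * partialD j v (m + s • t)) -
        (polyD1 (polyLap p) (turn t) (m + s • t) + polyD3 p (turn t) t (m + s • t)) *
          v (m + s • t)) + ∑ i, t i * partialD i (fun x => ev q x * v x) (m + s • t) := by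
    intro s
    simp only [hpm]
    simp only [hq, hq', greenField, polyD1, polyD2,
      polyD3, Fin.sum_univ_two]
    generalize m + s • t = x
    have a1 := pd_comm 1 0
    simp only [a1, turn_zero, turn_one]
    set V0 := partialD 0 v x
    set V1 := partialD 1 v x
    linear_combination (-(t 1 * (ev (pd 0 (pd 0 p)) x * V0 + ev (pd 0 (pd 1 p)) x * V1)
      - t 0 * (ev (pd 0 (pd 1 p)) x * V0 + ev (pd 1 (pd 1 p)) x * V1))) * ht
  have h5 : ∑ i, turn t i * ∫ s : ℝ, greenField p v i (m + s • t) =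
      ∫ s : ℝ, ∑ i, turn t i * greenField p v i (m + s • t) := by
    rw [integral_finsetSum _ fun i _ => (hi i).const_mul _]
    exact Finset.sum_congr rfl fun i _ => (integral_const_mul _ _).symm
  have h6 : Integrable (fun s : ℝ => ∑ i, t i * partialD i (fun x => ev q x * v x) (m + s • t)) :=
    integrable_finsetSum _ fun i _ =>
      (hline (hqv.partialD i).1.continuous (hqv.partialD i).2.1).const_mul _
  have h7 : ∫ s : ℝ, (polyD2 p (turn t) (m + s • t) *
          (∑ j, turn t j * partialD j v (m + s • t)) -
        (polyD1 (polyLap p) (turn t) (m + s • t) + polyD3 p (turn t) t (m + s • t)) *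
          v (m + s • t)) = ∫ s : ℝ, ∑ i, turn t i * greenField p v i (m + s • t) := by
    have h8 : Integrable (fun s : ℝ => ∑ i, turn t i * greenField p v i (m + s • t)) :=
      integrable_finsetSum _ fun i _ => (hi i).const_mul _
    have h9 := integral_sub h8 h6
    rw [h3, sub_zero] at h9
    rw [← h9]
    refine integral_congr_ae (ae_of_all _ fun s => ?_)
    have := h4 s
    simp only
    linarith
  rw [h7, ← h5]
  linarith

/-! ### Norm equivalence on finite-dimensional spaces -/

/-- Functionals which are pointwise bounded on a finite-dimensional space are uniformly bounded with
respect to any inner product. -/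
theorem exists_sq_le_mul_of_definite {V Y : Type*} [AddCommGroup V] [Module ℝ V]
    [Module.Finite ℝ V] (B : V →ₗ[ℝ] V →ₗ[ℝ] ℝ) (hs : ∀ v w, B v w = B w v)
    (h0 : ∀ v, 0 ≤ B v v) (hd : ∀ v, B v v = 0 → v = 0) (H : Y → V →ₗ[ℝ] ℝ)
    (hH : ∀ v, ∃ C, ∀ y, |H y v| ≤ C) :
    ∃ M, 0 ≤ M ∧ ∀ v y, (H y v) ^ 2 ≤ M * B v v := by
  let core : InnerProductSpace.Core ℝ V :=
    { inner := fun v w => B v w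
      conj_inner_symm := fun v w => hs w v
      re_inner_nonneg := fun v => h0 v
      add_left := fun u v w => by simp
      smul_left := fun u v c => by simp
      definite := hd }
  let _ : NormedAddCommGroup V := core.toNormedAddCommGroup
  let _ : InnerProductSpace ℝ V := InnerProductSpace.ofCore core.toCore
  have hin : ∀ v w : V, inner ℝ v w = B v w := fun _ _ => rfl
  let b := stdOrthonormalBasis ℝ V
  choose C hC using fun i => hH (b i)
  -- Expand v in a basis orthonormal for B: each coordinate is at most the B-norm of v, and the
  -- functionals are bounded by `C i` on the i-th basis vector, uniformly in the index y.
  refine ⟨(∑ i, |C i|) ^ 2, by positivity, fun v y => ?_⟩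
  rw [← hin, real_inner_self_eq_norm_sq, ← mul_pow]
  refine sq_le_sq' ?_ ?_ <;> [refine neg_le_of_abs_le ?_; refine le_of_abs_le ?_] <;>
  · conv_lhs => rw [← b.sum_repr' v]
    rw [map_sum, Finset.sum_mul]
    refine (Finset.abs_sum_le_sum_abs _ _).trans (Finset.sum_le_sum fun i _ => ?_)
    rw [map_smul, smul_eq_mul, abs_mul, mul_comm]
    refine mul_le_mul ((hC i y).trans (le_abs_self _)) ?_ (abs_nonneg _) (abs_nonneg _)
    have := abs_real_inner_le_norm (b i) v
    rwa [b.norm_eq_one, one_mul] at this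

/-! ### The cutoff function -/

/-- A radial smooth cutoff function, equal to `1` for `|x| ≤ 1/2` and supported in the unit disc. -/
def cutoff (x : Plane) : ℝ := Real.smoothTransition (2 - 4 * (x 0 ^ 2 + x 1 ^ 2))

theorem contDiff_cutoff : ContDiff ℝ ∞ cutoff := by
  have h : ∀ i : Fin 2, ContDiff ℝ ∞ (fun x : Plane => x i) := fun i =>
    (EuclideanSpace.proj i : Plane →L[ℝ] ℝ).contDiff
  exact Real.smoothTransition.contDiff.comp
    (contDiff_const.sub (contDiff_const.mul (((h 0).pow 2).add ((h 1).pow 2))))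

theorem cutoff_nonneg (x : Plane) : 0 ≤ cutoff x := Real.smoothTransition.nonneg _

theorem cutoff_eq_one {x : Plane} (h : ‖x‖ ≤ 1 / 2) : cutoff x = 1 := by
  have := plane_norm_sq x
  exact Real.smoothTransition.one_of_one_le (by nlinarith [norm_nonneg x])

theorem tsupport_cutoff : tsupport cutoff ⊆ Metric.ball 0 1 := by
  -- The cutoff vanishes as soon as 4|x|² ≥ 2, and 4(3/4)² > 2. The radius 3/4 leaves room for the
  -- closure inside the open unit disc.
  have : tsupport cutoff ⊆ Metric.closedBall 0 (3 / 4) := by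
    refine closure_minimal (fun x hx => ?_) Metric.isClosed_closedBall
    rw [mem_closedBall_zero_iff]
    by_contra! hc
    refine hx (Real.smoothTransition.zero_of_nonpos ?_)
    have := plane_norm_sq x
    nlinarith
  exact this.trans (Metric.closedBall_subset_ball (by norm_num))

/-- The cutoff depends only on |x|², whose derivative in the second variable vanishes on the axis.
Multiplying by the cutoff therefore adds no term to the normal derivative there. -/
theorem partialD_one_cutoff {x : Plane} (hx : x 1 = 0) : partialD 1 cutoff x = 0 := by
  let p : MvPolynomial (Fin 2) ℝ :=
    MvPolynomial.C 2 - MvPolynomial.C 4 * (MvPolynomial.X 0 ^ 2 + MvPolynomial.X 1 ^ 2)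
  have h : cutoff = Real.smoothTransition ∘ ev p := by
    funext x; simp [cutoff, ev, p]
  have h1 : ev (pd 1 p) x = 0 := by
    simp [ev, p, Derivation.leibniz_pow, MvPolynomial.pderiv_X, hx]
  rw [← partialD_ev] at h1
  rw [partialD, h, fderiv_comp x (Real.smoothTransition.contDiff.differentiable one_ne_zero _)
    ((contDiff_ev p).differentiable (by simp) x)]
  rw [partialD] at h1
  simp [h1]

theorem isTest_cutoff_mul {g : Plane → ℝ} (hg : ContDiff ℝ ∞ g) :
    IsTest (Metric.ball 0 1) (fun x => cutoff x * g x) := by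
  have h : tsupport (fun x => cutoff x * g x) ⊆ Metric.ball 0 1 :=
    (tsupport_mul_subset_left (f := cutoff) (g := g)).trans tsupport_cutoff
  exact ⟨contDiff_cutoff.mul hg, HasCompactSupport.of_support_subset_isCompact
    (isCompact_closedBall (0 : Plane) 1)
    ((subset_tsupport _).trans (h.trans Metric.ball_subset_closedBall)), h⟩

theorem IsTest.bounded {U : Set Plane} {g : Plane → ℝ} (h : IsTest U g) :
    ∃ C, ∀ x, |g x| ≤ C :=
  h.1.continuous.bounded_above_of_compact_support h.2.1

/-! ### Test functions on the reference disc -/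

/-- Norm equivalence for polynomials of degree at most k, with the L²-norm on the half-size disc as
reference, where the cutoff is 1. The first two bounds control the cut-off test function; the third
extends estimates to the disc of radius R. -/
theorem exists_disc_bound (k : ℕ) (R : ℝ) : ∃ M, 0 ≤ M ∧ ∀ q ∈ Pk k,
    (∀ y, (cutoff y * ev q y) ^ 2 ≤ M * ∫ x in Metric.ball 0 (1 / 2), ev q x ^ 2) ∧
    (∀ i j y, (partialD i (partialD j (fun x => cutoff x * ev q x)) y) ^ 2 ≤
      M * ∫ x in Metric.ball 0 (1 / 2), ev q x ^ 2) ∧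
    (∀ y, ‖y‖ ≤ R → ev q y ^ 2 ≤ M * ∫ x in Metric.ball 0 (1 / 2), ev q x ^ 2) := by
  have hb : Bornology.IsBounded (Metric.ball (0 : Plane) (1 / 2)) := Metric.isBounded_ball
  have hi : ∀ p q : MvPolynomial (Fin 2) ℝ,
      IntegrableOn (fun x => ev p x * ev q x) (Metric.ball 0 (1 / 2)) := fun p q =>
    integrableOn_of_continuous hb ((continuous_ev p).mul (continuous_ev q))
  let B : Pk k →ₗ[ℝ] Pk k →ₗ[ℝ] ℝ := LinearMap.mk₂ ℝ
    (fun p q => ∫ x in Metric.ball 0 (1 / 2), ev p.1 x * ev q.1 x)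
    (fun p p' q => by
      rw [← integral_add (hi _ _) (hi _ _)]
      simp only [Submodule.coe_add, ev_add, add_mul])
    (fun c p q => by
      rw [smul_eq_mul, ← integral_const_mul]
      simp only [Submodule.coe_smul, ev_smul, mul_assoc])
    (fun p q q' => by
      rw [← integral_add (hi _ _) (hi _ _)]
      simp only [Submodule.coe_add, ev_add, mul_add])
    (fun c p q => by
      rw [smul_eq_mul, ← integral_const_mul]
      simp only [Submodule.coe_smul, ev_smul, mul_left_comm])
  have hB : ∀ p q, B p q = ∫ x in Metric.ball 0 (1 / 2), ev p.1 x * ev q.1 x := fun _ _ => rfl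
  have hs : ∀ p q, B p q = B q p := fun p q => by simp only [hB, mul_comm]
  have h0 : ∀ p, 0 ≤ B p p := fun p => integral_nonneg fun x => mul_self_nonneg _
  have hd : ∀ p, B p p = 0 → p = 0 := fun p hp => by
    have h0 := eq_zero_of_integral_sq Metric.isOpen_ball
      ((continuous_ev p.1).mul (continuous_ev p.1)) (fun x => mul_self_nonneg _) (hi p.1 p.1) hp
    exact Subtype.ext (eq_zero_of_ev_eq_zero Metric.isOpen_ball (Metric.nonempty_ball.2 (by norm_num))
      fun x hx => mul_self_eq_zero.1 (h0 x hx))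
  have hBq : ∀ p : Pk k, B p p = ∫ x in Metric.ball 0 (1 / 2), ev p.1 x ^ 2 := fun p => by
    simp only [hB, pow_two]
  have hsm : ∀ q : Pk k, ContDiff ℝ ∞ (fun x => cutoff x * ev q.1 x) := fun q =>
    contDiff_cutoff.mul (contDiff_ev _)
  have hadd : ∀ p q : Pk k, (fun x => cutoff x * ev (p + q).1 x) =
      fun x => cutoff x * ev p.1 x + cutoff x * ev q.1 x := fun p q => by
    funext x; rw [Submodule.coe_add, ev_add, mul_add]
  have hmul : ∀ (c : ℝ) (p : Pk k), (fun x => cutoff x * ev (c • p).1 x) =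
      fun x => c * (cutoff x * ev p.1 x) := fun c p => by
    funext x; rw [Submodule.coe_smul, ev_smul, mul_left_comm]
  let H₁ : Plane → Pk k →ₗ[ℝ] ℝ := fun y =>
    { toFun := fun q => cutoff y * ev q.1 y
      map_add' := fun p q => congrFun (hadd p q) y
      map_smul' := fun c p => congrFun (hmul c p) y }
  let H₂ : (Fin 2 × Fin 2 × Plane) → Pk k →ₗ[ℝ] ℝ := fun z =>
    { toFun := fun q => partialD z.1 (partialD z.2.1 (fun x => cutoff x * ev q.1 x)) z.2.2
      map_add' := fun p q => by
        rw [hadd, partialD_add (hsm p) (hsm q),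
          partialD_add (contDiff_partialD (hsm p) _) (contDiff_partialD (hsm q) _)]
      map_smul' := fun c p => by
        rw [hmul, partialD_const_mul (hsm p), partialD_const_mul (contDiff_partialD (hsm p) _)]
        rfl }
  let H₃ : Metric.closedBall (0 : Plane) R → Pk k →ₗ[ℝ] ℝ := fun y =>
    { toFun := fun q => ev q.1 y
      map_add' := fun p q => ev_add _ _ _
      map_smul' := fun c p => ev_smul _ _ _ }
  obtain ⟨M₁, hM₁, h₁⟩ := exists_sq_le_mul_of_definite B hs h0 hd H₁ fun q =>
    (isTest_cutoff_mul (contDiff_ev q.1)).bounded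
  obtain ⟨M₂, hM₂, h₂⟩ := exists_sq_le_mul_of_definite B hs h0 hd H₂ fun q => by
    choose C hC using fun i j =>
      (((isTest_cutoff_mul (contDiff_ev q.1)).partialD j).partialD i).bounded
    refine ⟨∑ i, ∑ j, |C i j|, fun z => (hC z.1 z.2.1 z.2.2).trans ((le_abs_self _).trans ?_)⟩
    exact (Finset.single_le_sum (f := fun j => |C z.1 j|) (fun _ _ => abs_nonneg _)
      (Finset.mem_univ z.2.1)).trans (Finset.single_le_sum (f := fun i => ∑ j, |C i j|)
      (fun _ _ => Finset.sum_nonneg fun _ _ => abs_nonneg _) (Finset.mem_univ z.1))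
  obtain ⟨M₃, hM₃, h₃⟩ := exists_sq_le_mul_of_definite B hs h0 hd H₃ fun q => by
    obtain ⟨C, hC⟩ := (isCompact_closedBall (0 : Plane) R).exists_bound_of_continuousOn
      (continuous_ev q.1).continuousOn
    exact ⟨C, fun y => hC y.1 y.2⟩
  refine ⟨M₁ + M₂ + M₃, by positivity, fun q hq => ?_⟩
  have hn := h0 ⟨q, hq⟩
  have e := hBq ⟨q, hq⟩
  simp only at e
  rw [← e]
  refine ⟨fun y => (h₁ ⟨q, hq⟩ y).trans ?_, fun i j y => (h₂ ⟨q, hq⟩ (i, j, y)).trans ?_,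
    fun y hy => (h₃ ⟨q, hq⟩ ⟨y, mem_closedBall_zero_iff.2 hy⟩).trans ?_⟩ <;>
  · refine mul_le_mul_of_nonneg_right ?_ hn
    linarith

/-- The reference test function with value `-b` and normal derivative `a` on the axis, cut off. -/
def edgeBump (a b : Polynomial ℝ) (x : Plane) : ℝ :=
  cutoff x * (x 1 * a.eval (x 0) - b.eval (x 0))

theorem contDiff_coord (i : Fin 2) : ContDiff ℝ ∞ (fun x : Plane => x i) :=
  (EuclideanSpace.proj i : Plane →L[ℝ] ℝ).contDiff

theorem contDiff_eval_coord (a : Polynomial ℝ) (i : Fin 2) :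
    ContDiff ℝ ∞ (fun x : Plane => a.eval (x i)) :=
  ContDiff.comp (g := fun s => a.eval s) (by simpa using a.contDiff_aeval (𝕜 := ℝ) ∞)
    (contDiff_coord i)

theorem isTest_edgeBump (a b : Polynomial ℝ) : IsTest (Metric.ball 0 1) (edgeBump a b) :=
  isTest_cutoff_mul (((contDiff_coord 1).mul (contDiff_eval_coord a 0)).sub
    (contDiff_eval_coord b 0))

theorem edgeBump_axis (a b : Polynomial ℝ) {x : Plane} (hx : x 1 = 0) :
    edgeBump a b x = -(cutoff x * b.eval (x 0)) := by
  simp [edgeBump, hx]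

/-- Only differentiating the factor `x 1` survives on the axis: the polynomials depend on `x 0`
alone, and the normal derivative of the cutoff vanishes. -/
theorem partialD_edgeBump_axis (a b : Polynomial ℝ) {x : Plane} (hx : x 1 = 0) :
    partialD 1 (edgeBump a b) x = cutoff x * a.eval (x 0) := by
  have h1 : ∀ c : Polynomial ℝ, partialD 1 (fun x : Plane => c.eval (x 0)) x = 0 := fun c => by
    have : (fun x : Plane => c.eval (x 0)) =
        (fun s => c.eval s) ∘ (EuclideanSpace.proj 0 : Plane →L[ℝ] ℝ) := rfl
    rw [partialD, this, fderiv_comp x c.differentiable.differentiableAt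
      (ContinuousLinearMap.differentiableAt _), ContinuousLinearMap.fderiv]
    simp
  have h2 : partialD 1 (fun x : Plane => x 1) x = 1 := by
    have : (fun x : Plane => x 1) = (EuclideanSpace.proj 1 : Plane →L[ℝ] ℝ) := rfl
    rw [partialD, this, ContinuousLinearMap.fderiv]
    simp
  have e : edgeBump a b = fun x => cutoff x * (x 1 * a.eval (x 0) - b.eval (x 0)) := rfl
  rw [e, partialD_mul contDiff_cutoff (((contDiff_coord 1).mul (contDiff_eval_coord a 0)).sub
    (contDiff_eval_coord b 0)), partialD_sub ((contDiff_coord 1).mul (contDiff_eval_coord a 0))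
    (contDiff_eval_coord b 0), partialD_mul (contDiff_coord 1) (contDiff_eval_coord a 0)]
  simp [h1, h2, partialD_one_cutoff hx]

/-- Norm equivalence on the product of two spaces of univariate polynomials, so that a and b are
treated by one test function. The last two bounds extend control from the middle interval to a
longer one. -/
theorem exists_edge_bound (k : ℕ) (R : ℝ) : ∃ M, 0 ≤ M ∧ ∀ a b : Polynomial ℝ,
    a.natDegree ≤ k → b.natDegree ≤ k →
    (∀ y, edgeBump a b y ^ 2 ≤
      M * ∫ s in Set.Ioo (-(1 / 2) : ℝ) (1 / 2), (a.eval s ^ 2 + b.eval s ^ 2)) ∧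
    (∀ i j y, (partialD i (partialD j (edgeBump a b)) y) ^ 2 ≤
      M * ∫ s in Set.Ioo (-(1 / 2) : ℝ) (1 / 2), (a.eval s ^ 2 + b.eval s ^ 2)) ∧
    (∀ s, |s| ≤ R → a.eval s ^ 2 ≤
      M * ∫ s in Set.Ioo (-(1 / 2) : ℝ) (1 / 2), (a.eval s ^ 2 + b.eval s ^ 2)) ∧
    (∀ s, |s| ≤ R → b.eval s ^ 2 ≤
      M * ∫ s in Set.Ioo (-(1 / 2) : ℝ) (1 / 2), (a.eval s ^ 2 + b.eval s ^ 2)) := by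
  -- Degree less than k + 1 is degree at most k, with the zero polynomial included.
  let W := Polynomial.degreeLT ℝ (k + 1)
  have _ : Module.Finite ℝ W := Module.Finite.equiv (Polynomial.degreeLTEquiv ℝ (k + 1)).symm
  have hW : ∀ p : Polynomial ℝ, p.natDegree ≤ k → p ∈ W := fun p hp =>
    Polynomial.mem_degreeLT.2 (Polynomial.degree_le_natDegree.trans_lt
      (by exact_mod_cast Nat.lt_succ_of_le hp))
  let S := Set.Ioo (-(1 / 2) : ℝ) (1 / 2)
  have hi : ∀ p q : W × W, IntegrableOn
      (fun s => p.1.1.eval s * q.1.1.eval s + p.2.1.eval s * q.2.1.eval s) S := fun p q => by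
    have hc : Continuous
        (fun s : ℝ => p.1.1.eval s * q.1.1.eval s + p.2.1.eval s * q.2.1.eval s) :=
      (p.1.1.continuous.mul q.1.1.continuous).add (p.2.1.continuous.mul q.2.1.continuous)
    exact (hc.continuousOn.integrableOn_compact isCompact_Icc).mono_set Set.Ioo_subset_Icc_self
  let B : W × W →ₗ[ℝ] W × W →ₗ[ℝ] ℝ := LinearMap.mk₂ ℝ
    (fun p q => ∫ s in S, (p.1.1.eval s * q.1.1.eval s + p.2.1.eval s * q.2.1.eval s))
    (fun p p' q => by
      rw [← integral_add (hi _ _) (hi _ _)]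
      refine integral_congr_ae (ae_of_all _ fun s => ?_)
      simp; ring)
    (fun c p q => by
      rw [smul_eq_mul, ← integral_const_mul]
      refine integral_congr_ae (ae_of_all _ fun s => ?_)
      simp; ring)
    (fun p q q' => by
      rw [← integral_add (hi _ _) (hi _ _)]
      refine integral_congr_ae (ae_of_all _ fun s => ?_)
      simp; ring)
    (fun c p q => by
      rw [smul_eq_mul, ← integral_const_mul]
      refine integral_congr_ae (ae_of_all _ fun s => ?_)
      simp; ring)
  have hB : ∀ p q, B p q =
      ∫ s in S, (p.1.1.eval s * q.1.1.eval s + p.2.1.eval s * q.2.1.eval s) := fun _ _ => rfl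
  have hs : ∀ p q, B p q = B q p := fun p q => by
    simp only [hB, mul_comm]
  have hn : ∀ (p : W × W) (s : ℝ),
      0 ≤ p.1.1.eval s * p.1.1.eval s + p.2.1.eval s * p.2.1.eval s := fun p s =>
    add_nonneg (mul_self_nonneg _) (mul_self_nonneg _)
  have h0 : ∀ p, 0 ≤ B p p := fun p => integral_nonneg (hn p)
  have hz : ∀ p : Polynomial ℝ, (∀ s ∈ S, p.eval s = 0) → p = 0 := fun p hp =>
    p.eq_zero_of_infinite_isRoot ((Set.Ioo_infinite (by norm_num : (-(1 / 2) : ℝ) < 1 / 2)).mono hp)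
  have hd : ∀ p, B p p = 0 → p = 0 := fun p hp => by
    rw [hB, setIntegral_eq_zero_iff_of_nonneg_ae (ae_of_all _ (hn p)) (hi p p)] at hp
    have h1 := Measure.eqOn_open_of_ae_eq hp isOpen_Ioo
      ((p.1.1.continuous.mul p.1.1.continuous).add
        (p.2.1.continuous.mul p.2.1.continuous)).continuousOn continuousOn_const
    refine Prod.ext (Subtype.ext (hz _ fun s hs => ?_)) (Subtype.ext (hz _ fun s hs => ?_)) <;>
    · have h2 : p.1.1.eval s * p.1.1.eval s + p.2.1.eval s * p.2.1.eval s = 0 := h1 hs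
      nlinarith [mul_self_nonneg (p.1.1.eval s), mul_self_nonneg (p.2.1.eval s)]
  have hBq : ∀ p : W × W, B p p = ∫ s in S, (p.1.1.eval s ^ 2 + p.2.1.eval s ^ 2) := fun p => by
    simp only [hB, pow_two]
  have hsm : ∀ a b, ContDiff ℝ ∞ (edgeBump a b) := fun a b => (isTest_edgeBump a b).1
  have hadd : ∀ p q : W × W, edgeBump (p + q).1.1 (p + q).2.1 =
      fun x => edgeBump p.1.1 p.2.1 x + edgeBump q.1.1 q.2.1 x := fun p q => by
    funext x; simp [edgeBump]; ring
  have hmul : ∀ (c : ℝ) (p : W × W), edgeBump (c • p).1.1 (c • p).2.1 =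
      fun x => c * edgeBump p.1.1 p.2.1 x := fun c p => by
    funext x; simp [edgeBump]; ring
  let H₁ : Plane → W × W →ₗ[ℝ] ℝ := fun y =>
    { toFun := fun p => edgeBump p.1.1 p.2.1 y
      map_add' := fun p q => congrFun (hadd p q) y
      map_smul' := fun c p => congrFun (hmul c p) y }
  let H₂ : (Fin 2 × Fin 2 × Plane) → W × W →ₗ[ℝ] ℝ := fun z =>
    { toFun := fun p => partialD z.1 (partialD z.2.1 (edgeBump p.1.1 p.2.1)) z.2.2
      map_add' := fun p q => by
        rw [hadd, partialD_add (hsm _ _) (hsm _ _),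
          partialD_add (contDiff_partialD (hsm _ _) _) (contDiff_partialD (hsm _ _) _)]
      map_smul' := fun c p => by
        rw [hmul, partialD_const_mul (hsm _ _), partialD_const_mul (contDiff_partialD (hsm _ _) _)]
        rfl }
  let H₃ : Set.Icc (-R) R → W × W →ₗ[ℝ] ℝ := fun s =>
    { toFun := fun p => p.1.1.eval s.1
      map_add' := fun p q => by simp
      map_smul' := fun c p => by simp }
  let H₄ : Set.Icc (-R) R → W × W →ₗ[ℝ] ℝ := fun s =>
    { toFun := fun p => p.2.1.eval s.1
      map_add' := fun p q => by simp
      map_smul' := fun c p => by simp }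
  obtain ⟨M₁, hM₁, h₁⟩ := exists_sq_le_mul_of_definite B hs h0 hd H₁ fun p =>
    (isTest_edgeBump _ _).bounded
  obtain ⟨M₂, hM₂, h₂⟩ := exists_sq_le_mul_of_definite B hs h0 hd H₂ fun p => by
    choose C hC using fun i j =>
      (((isTest_edgeBump p.1.1 p.2.1).partialD j).partialD i).bounded
    refine ⟨∑ i, ∑ j, |C i j|, fun z => (hC z.1 z.2.1 z.2.2).trans ((le_abs_self _).trans ?_)⟩
    exact (Finset.single_le_sum (f := fun j => |C z.1 j|) (fun _ _ => abs_nonneg _)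
      (Finset.mem_univ z.2.1)).trans (Finset.single_le_sum (f := fun i => ∑ j, |C i j|)
      (fun _ _ => Finset.sum_nonneg fun _ _ => abs_nonneg _) (Finset.mem_univ z.1))
  have hbd : ∀ p : Polynomial ℝ, ∃ C, ∀ s : Set.Icc (-R) R, |p.eval s.1| ≤ C := fun p => by
    obtain ⟨C, hC⟩ := (isCompact_Icc (a := -R) (b := R)).exists_bound_of_continuousOn
      p.continuous.continuousOn
    exact ⟨C, fun y => hC y.1 y.2⟩
  obtain ⟨M₃, hM₃, h₃⟩ := exists_sq_le_mul_of_definite B hs h0 hd H₃ fun p => hbd p.1.1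
  obtain ⟨M₄, hM₄, h₄⟩ := exists_sq_le_mul_of_definite B hs h0 hd H₄ fun p => hbd p.2.1
  refine ⟨M₁ + M₂ + M₃ + M₄, by positivity, fun a b ha hb => ?_⟩
  have ha' : a ∈ W := hW a ha
  have hb' : b ∈ W := hW b hb
  have hn := h0 (⟨a, ha'⟩, ⟨b, hb'⟩)
  have e := hBq (⟨a, ha'⟩, ⟨b, hb'⟩)
  simp only [S] at e
  rw [← e]
  refine ⟨fun y => (h₁ (⟨a, ha'⟩, ⟨b, hb'⟩) y).trans ?_,
    fun i j y => (h₂ (⟨a, ha'⟩, ⟨b, hb'⟩) (i, j, y)).trans ?_,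
    fun s hs => (h₃ (⟨a, ha'⟩, ⟨b, hb'⟩) ⟨s, abs_le.1 hs⟩).trans ?_,
    fun s hs => (h₄ (⟨a, ha'⟩, ⟨b, hb'⟩) ⟨s, abs_le.1 hs⟩).trans ?_⟩ <;>
  · refine mul_le_mul_of_nonneg_right ?_ hn
    linarith

/-! ### Similarities -/

/-- The similarity taking the disc `B(m, r)` to the unit disc. -/
def toUnitDisc (L : Plane ≃ₗᵢ[ℝ] Plane) (m : Plane) (r : ℝ) (x : Plane) : Plane :=
  r⁻¹ • L (x - m)

theorem contDiff_toUnitDisc (L : Plane ≃ₗᵢ[ℝ] Plane) (m : Plane) (r : ℝ) :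
    ContDiff ℝ ∞ (toUnitDisc L m r) :=
  (L.toContinuousLinearEquiv.contDiff.comp (contDiff_id.sub contDiff_const)).const_smul r⁻¹

theorem norm_toUnitDisc (L : Plane ≃ₗᵢ[ℝ] Plane) (m : Plane) {r : ℝ} (hr : 0 < r) (x : Plane) :
    ‖toUnitDisc L m r x‖ = r⁻¹ * dist x m := by
  rw [toUnitDisc, norm_smul, LinearIsometryEquiv.norm_map, dist_eq_norm, Real.norm_of_nonneg]
  positivity

theorem IsTest.comp_toUnitDisc {g : Plane → ℝ} (hg : IsTest (Metric.ball 0 1) g)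
    (L : Plane ≃ₗᵢ[ℝ] Plane) (m : Plane) {r : ℝ} (hr : 0 < r) :
    IsTest (Metric.ball m r) (fun x => g (toUnitDisc L m r x)) := by
  have h : tsupport (fun x => g (toUnitDisc L m r x)) ⊆ Metric.ball m r := by
    intro x hx
    have hc := (contDiff_toUnitDisc L m r).continuous
    have h1 : toUnitDisc L m r x ∈ tsupport g :=
      tsupport_comp_subset_preimage g hc hx
    have h2 := hg.2.2 h1
    rw [mem_ball_zero_iff, norm_toUnitDisc L m hr, inv_mul_lt_iff₀ hr, mul_one] at h2
    exact h2
  exact ⟨hg.1.comp (contDiff_toUnitDisc L m r), HasCompactSupport.of_support_subset_isCompact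
    (isCompact_closedBall m r) ((subset_tsupport _).trans (h.trans Metric.ball_subset_closedBall)),
    h⟩

theorem partialD_comp_toUnitDisc (L : Plane ≃ₗᵢ[ℝ] Plane) (m : Plane) (r : ℝ) {g : Plane → ℝ}
    (hg : ContDiff ℝ ∞ g) (i : Fin 2) :
    partialD i (fun x => g (toUnitDisc L m r x)) = fun x =>
      ∑ l, r⁻¹ * L (EuclideanSpace.single i 1) l * partialD l g (toUnitDisc L m r x) := by
  funext x
  have h1 : HasFDerivAt (toUnitDisc L m r)
      (r⁻¹ • (L.toContinuousLinearEquiv : Plane →L[ℝ] Plane)) x := by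
    have h2 := ((L.toContinuousLinearEquiv : Plane →L[ℝ] Plane).hasFDerivAt
      (x := x - m)).comp x ((hasFDerivAt_id x).sub_const m)
    exact (h2.const_smul r⁻¹)
  have h3 := ((hg.differentiable (by simp) (toUnitDisc L m r x)).hasFDerivAt).comp x h1
  have h4 : fderiv ℝ (fun x => g (toUnitDisc L m r x)) x = _ := h3.fderiv
  rw [partialD, h4, ContinuousLinearMap.comp_apply, fderiv_apply_eq]
  simp

theorem abs_coord_le_norm (x : Plane) (i : Fin 2) : |x i| ≤ ‖x‖ := PiLp.norm_apply_le x i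

/-- Two derivatives bring out r⁻² and a sum of four second derivatives of g, whose coefficients are
products of entries of an isometry, hence at most 1 in absolute value. Squaring 4√A gives 16A. -/
theorem sq_partialD_comp_toUnitDisc_le (L : Plane ≃ₗᵢ[ℝ] Plane) (m : Plane) {r : ℝ} (hr : 0 < r)
    {g : Plane → ℝ} (hg : ContDiff ℝ ∞ g) {A : ℝ}
    (hA : ∀ i j y, (partialD i (partialD j g) y) ^ 2 ≤ A) (i j : Fin 2) (x : Plane) :
    (partialD i (partialD j (fun x => g (toUnitDisc L m r x))) x) ^ 2 ≤ 16 * A / r ^ 4 := by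
  have hs : ∀ l, ContDiff ℝ ∞ (fun x => partialD l g (toUnitDisc L m r x)) := fun l =>
    (contDiff_partialD hg l).comp (contDiff_toUnitDisc L m r)
  have hL : ∀ i l, |L (EuclideanSpace.single i 1) l| ≤ 1 := fun i l => by
    refine (abs_coord_le_norm _ l).trans ?_
    rw [LinearIsometryEquiv.norm_map]; simp
  have hA' : ∀ i j y, |partialD i (partialD j g) y| ≤ √A := fun i j y => by
    rw [← Real.sqrt_sq_eq_abs]; exact Real.sqrt_le_sqrt (hA i j y)
  have hA0 : 0 ≤ A := (sq_nonneg _).trans (hA 0 0 0)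
  have e : partialD i (partialD j (fun x => g (toUnitDisc L m r x))) x =
      r⁻¹ ^ 2 * ∑ l, ∑ l', L (EuclideanSpace.single j 1) l * L (EuclideanSpace.single i 1) l' *
        partialD l' (partialD l g) (toUnitDisc L m r x) := by
    rw [partialD_comp_toUnitDisc L m r hg]
    simp only [Fin.sum_univ_two]
    rw [partialD_add (contDiff_const.mul (hs 0)) (contDiff_const.mul (hs 1)),
      partialD_const_mul (hs 0), partialD_const_mul (hs 1),
      partialD_comp_toUnitDisc L m r (contDiff_partialD hg 0),
      partialD_comp_toUnitDisc L m r (contDiff_partialD hg 1)]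
    simp only [Fin.sum_univ_two]
    ring
  have hS : |∑ l, ∑ l', L (EuclideanSpace.single j 1) l * L (EuclideanSpace.single i 1) l' *
        partialD l' (partialD l g) (toUnitDisc L m r x)| ≤ 4 * √A := by
    have ht : ∀ l l', |L (EuclideanSpace.single j 1) l * L (EuclideanSpace.single i 1) l' *
        partialD l' (partialD l g) (toUnitDisc L m r x)| ≤ √A := fun l l' => by
      rw [abs_mul, abs_mul]
      calc _ ≤ 1 * 1 * √A := by gcongr <;> first | exact hL _ _ | exact hA' _ _ _
        _ = √A := by ring
    calc _ ≤ ∑ l : Fin 2, ∑ l' : Fin 2, √A :=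
          (Finset.abs_sum_le_sum_abs _ _).trans (Finset.sum_le_sum fun l _ =>
            (Finset.abs_sum_le_sum_abs _ _).trans (Finset.sum_le_sum fun l' _ => ht l l'))
      _ = 4 * √A := by simp; ring
  rw [e, mul_pow]
  have h5 : (∑ l, ∑ l', L (EuclideanSpace.single j 1) l * L (EuclideanSpace.single i 1) l' *
        partialD l' (partialD l g) (toUnitDisc L m r x)) ^ 2 ≤ 16 * A := by
    rw [← sq_abs]
    calc _ ≤ (4 * √A) ^ 2 := by gcongr
      _ = 16 * A := by rw [mul_pow, Real.sq_sqrt hA0]; norm_num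
  calc _ ≤ (r⁻¹ ^ 2) ^ 2 * (16 * A) := by gcongr
    _ = _ := by field_simp

/-! ### Geometry of the elements -/

theorem PolygonalElement.diam_pos (K : PolygonalElement) : 0 < K.diam := by
  obtain ⟨x, hx⟩ := K.carrier_nonempty
  obtain ⟨ε, hε, hb⟩ := Metric.isOpen_iff.1 K.isOpen_carrier x hx
  have hy : x + EuclideanSpace.single 0 (ε / 2) ∈ K.carrier := hb (by
    rw [Metric.mem_ball, dist_eq_norm, add_sub_cancel_left, PiLp.norm_single,
      Real.norm_of_nonneg (by positivity)]
    linarith)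
  have h := Metric.dist_le_diam_of_mem K.isBounded_carrier hy hx
  rw [dist_eq_norm, add_sub_cancel_left, PiLp.norm_single,
      Real.norm_of_nonneg (by positivity)] at h
  exact lt_of_lt_of_le (by positivity) h

theorem PolygonalElement.len_pos (K : PolygonalElement) (e : K.Edge) : 0 < K.len e := by
  refine dist_pos.2 fun h => ?_
  have h1 := K.vertex_injective h
  have h2 : (1 : Fin (K.m + 3)) = 0 := by simpa using h1.symm
  exact absurd h2 (by simp)

theorem PolygonalElement.vertex_mem_closure (K : PolygonalElement) (e : K.Edge) :
    K.vertex e ∈ closure K.carrier := by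
  refine frontier_subset_closure ?_
  rw [K.frontier_carrier]
  exact Set.mem_iUnion.2 ⟨e, left_mem_segment ℝ _ _⟩

theorem PolygonalElement.len_le_diam (K : PolygonalElement) (e : K.Edge) : K.len e ≤ K.diam := by
  rw [PolygonalElement.diam, ← Metric.diam_closure]
  exact Metric.dist_le_diam_of_mem K.isBounded_carrier.closure (K.vertex_mem_closure _)
    (K.vertex_mem_closure _)

/-- Any one triangle will do: its disc has radius σ times its diameter, and that diameter is at
least σh_K. -/
theorem IsVirtualTriangulation.exists_ball_subset {σ : ℝ} (hσ : 0 < σ) {K : PolygonalElement}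
    {N : ℕ} {τ : Fin N → Fin 3 → Plane} (h : IsVirtualTriangulation σ K N τ) :
    ∃ c, Metric.ball c (σ ^ 2 * K.diam) ⊆ K.carrier := by
  obtain ⟨x, hx⟩ := K.carrier_nonempty
  have hx' := subset_closure hx
  rw [h.cover] at hx'
  obtain ⟨s, -⟩ := Set.mem_iUnion.1 hx'
  obtain ⟨c, hc⟩ := h.shapeRegular s
  refine ⟨c, (Metric.ball_subset_ball ?_).trans
    ((interior_maximal hc Metric.isOpen_ball).trans (h.inside s))⟩
  have := mul_le_mul_of_nonneg_left (h.quasiUniform s) hσ.le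
  linarith

/-- The ratio of the radius of the discs around the edge midpoints to the edge length. -/
def edgeRatio (σ : ℝ) : ℝ := σ / (10 * (1 + σ))

theorem edgeRatio_pos {σ : ℝ} (hσ : 0 < σ) : 0 < edgeRatio σ := by
  unfold edgeRatio; positivity

theorem edgeRatio_lt {σ : ℝ} (hσ : 0 < σ) : edgeRatio σ < 1 / 2 := by
  unfold edgeRatio
  rw [div_lt_iff₀ (by positivity)]
  linarith

/-- The coordinate of `x` relative to `m` in the direction `t`. -/
def coordAlong (m t x : Plane) : ℝ := (x 0 - m 0) * t 0 + (x 1 - m 1) * t 1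

theorem mem_halfPlane {m n x : Plane} : x ∈ halfPlane m n ↔ coordAlong m n x < 0 := Iff.rfl

theorem coordAlong_neg (m t x : Plane) : coordAlong m (-t) x = -coordAlong m t x := by
  simp [coordAlong]; ring

theorem framePt_coordAlong {m t : Plane} (ht : t 0 ^ 2 + t 1 ^ 2 = 1) (x : Plane) :
    framePt m t (coordAlong m t x) (coordAlong m (turn t) x) = x := by
  ext i
  rw [framePt_apply]
  fin_cases i
  · simp [coordAlong]; linear_combination (x 0 - m 0) * ht
  · simp [coordAlong]; linear_combination (x 1 - m 1) * ht

theorem coordAlong_sq_add {m t : Plane} (ht : t 0 ^ 2 + t 1 ^ 2 = 1) (x : Plane) :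
    coordAlong m t x ^ 2 + coordAlong m (turn t) x ^ 2 = dist x m ^ 2 := by
  rw [dist_eq_norm, plane_norm_sq]
  simp [coordAlong]
  linear_combination ((x 0 - m 0) ^ 2 + (x 1 - m 1) ^ 2) * ht

theorem abs_coordAlong_le {m t : Plane} (ht : t 0 ^ 2 + t 1 ^ 2 = 1) (x : Plane) :
    |coordAlong m t x| ≤ dist x m ∧ |coordAlong m (turn t) x| ≤ dist x m := by
  have h := coordAlong_sq_add (m := m) ht x
  constructor <;>
  · refine abs_le_of_sq_le_sq ?_ dist_nonneg
    nlinarith [sq_nonneg (coordAlong m t x), sq_nonneg (coordAlong m (turn t) x)]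

theorem convex_abs_coordAlong_le (m n : Plane) (δ : ℝ) :
    Convex ℝ {x | |coordAlong m n x| ≤ δ} := by
  intro x hx y hy a b ha hb hab
  rw [Set.mem_ofPred_eq] at hx hy ⊢
  have e : coordAlong m n (a • x + b • y) = a * coordAlong m n x + b * coordAlong m n y := by
    simp [coordAlong]; linear_combination (m 0 * n 0 + m 1 * n 1) * hab
  rw [e]
  rw [abs_le] at hx hy ⊢
  constructor <;> nlinarith

/-- A shape regular triangle contains a half-disc around the midpoint of a side. -/
theorem exists_halfDisc_subset {σ : ℝ} (hσ : 0 < σ) {m t c o : Plane}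
    (ht : t 0 ^ 2 + t 1 ^ 2 = 1) {h d : ℝ} (hh : 0 < h) (hhd : h ≤ d) (hcd : dist c m ≤ d)
    (hball : Metric.ball o (σ * d) ⊆
      convexHull ℝ {m - (h / 2) • t, m + (h / 2) • t, c}) :
    ∃ ε : ℝ, (ε = 1 ∨ ε = -1) ∧ Metric.ball m (edgeRatio σ * h) ∩ halfPlane m (ε • turn t) ⊆
      interior (convexHull ℝ {m - (h / 2) • t, m + (h / 2) • t, c}) := by
  set T := convexHull ℝ {m - (h / 2) • t, m + (h / 2) • t, c} with hT
  have hd : 0 < d := hh.trans_le hhd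
  have hr : 0 < σ * d := by positivity
  set Y := coordAlong m (turn t) c with hY
  set S := coordAlong m t c with hS
  -- the height of the triangle
  have hYr : σ * d / 2 ≤ |Y| := by
    have hTs : T ⊆ {x | |coordAlong m (turn t) x| ≤ |Y|} := by
      refine convexHull_min ?_ (convex_abs_coordAlong_le _ _ _)
      intro x hx
      rcases hx with rfl | rfl | rfl
      · have : coordAlong m (turn t) (m - (h / 2) • t) = 0 := by simp [coordAlong]; ring
        simp [this]
      · have : coordAlong m (turn t) (m + (h / 2) • t) = 0 := by simp [coordAlong]; ring
        simp [this]
      · simp [hY]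
    -- The triangle lies in the strip of half-width |Y| around the line of its side. The two points
    -- at distance σd/2 from o along the normal lie in the disc, hence in the strip, which forces
    -- |Y| ≥ σd/2.
    have hpt : ∀ ε : ℝ, |ε| = 1 → |coordAlong m (turn t) o + ε * (σ * d / 2)| ≤ |Y| := by
      intro ε hε
      have h1 : o + (ε * (σ * d / 2)) • turn t ∈ T := hball (by
        have hn : ‖turn t‖ = 1 := by
          have := plane_norm_sq (turn t)
          simp only [turn_zero, turn_one] at this
          nlinarith [norm_nonneg (turn t)]
        rw [Metric.mem_ball, dist_eq_norm, add_sub_cancel_left, norm_smul, hn, mul_one,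
          Real.norm_eq_abs, abs_mul, hε, one_mul, abs_of_pos (by positivity)]
        linarith)
      have h2 := hTs h1
      have e : coordAlong m (turn t) (o + (ε * (σ * d / 2)) • turn t) =
          coordAlong m (turn t) o + ε * (σ * d / 2) := by
        simp [coordAlong]; linear_combination (ε * (σ * d / 2)) * ht
      rwa [Set.mem_ofPred_eq, e] at h2
    have h1 := (abs_le.1 (hpt 1 (by simp))).2
    have h2 := (abs_le.1 (hpt (-1) (by simp))).1
    linarith
  have hY0 : 0 < |Y| := lt_of_lt_of_le (by positivity) hYr
  have hSd : |S| ≤ d := ((abs_coordAlong_le ht c).1).trans hcd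
  have key : ∀ x ∈ Metric.ball m (edgeRatio σ * h), 0 < coordAlong m (turn t) x / Y → x ∈ T := by
    intro x hx hγ
    rw [Metric.mem_ball] at hx
    obtain ⟨h1, h2⟩ := abs_coordAlong_le (m := m) ht x
    set s := coordAlong m t x with hs
    set y := coordAlong m (turn t) x with hy
    -- γ, β, α are the barycentric coordinates of x: γ matches the normal coordinate, and the other
    -- two are then determined by the tangential coordinate and the sum 1. The factor 10 in
    -- `edgeRatio` yields γ ≤ 1/5 and a tangential term of size at most 3/5, so that α and β stay
    -- nonnegative.
    set γ := y / Y with hγd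
    set β := ((1 - γ) + 2 * (s - γ * S) / h) / 2 with hβ
    set α := ((1 - γ) - 2 * (s - γ * S) / h) / 2 with hα
    have hγ1 : γ ≤ 2 * edgeRatio σ / σ := by
      rw [← abs_of_pos hγ, hγd, abs_div, div_le_div_iff₀ hY0 hσ]
      have : |y| ≤ edgeRatio σ * d := (h2.trans hx.le).trans
        (mul_le_mul_of_nonneg_left hhd (edgeRatio_pos hσ).le)
      nlinarith [edgeRatio_pos hσ]
    have hk1 : edgeRatio σ / σ ≤ 1 / 10 := by
      unfold edgeRatio
      rw [div_div, div_le_div_iff₀ (by positivity) (by positivity)]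
      nlinarith
    have hk2 : edgeRatio σ ≤ 1 / 10 := by
      unfold edgeRatio
      rw [div_le_div_iff₀ (by positivity) (by positivity)]
      nlinarith
    have hk3 : edgeRatio σ * h ≤ h / 10 := by nlinarith
    have hg : γ ≤ 1 / 5 := by
      have : 2 * edgeRatio σ / σ = 2 * (edgeRatio σ / σ) := by ring
      linarith
    have hγS : |γ * S| ≤ h / 5 := by
      rw [abs_mul, abs_of_pos hγ, hγd]
      have h3 : y / Y = |y| / |Y| := by rw [← abs_div, abs_of_pos hγ]
      rw [h3, div_mul_eq_mul_div, div_le_iff₀ hY0]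
      have h4 : |y| * |S| ≤ (edgeRatio σ * h) * d := mul_le_mul (h2.trans hx.le) hSd
        (abs_nonneg _) (mul_nonneg (edgeRatio_pos hσ).le hh.le)
      have h5 : edgeRatio σ ≤ σ / 10 := by
        rw [div_le_iff₀ hσ] at hk1; linarith
      have h6 : (edgeRatio σ * h) * d ≤ (σ / 10 * h) * d := by gcongr
      have h7 : h / 5 * (σ * d / 2) ≤ h / 5 * |Y| := by gcongr
      linarith
    have hsγ : |2 * (s - γ * S) / h| ≤ 3 / 5 := by
      rw [abs_div, abs_of_pos hh, div_le_iff₀ hh, abs_mul, abs_two]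
      have := abs_sub s (γ * S)
      have h3 := h1.trans hx.le
      linarith
    have hβ0 : 0 ≤ β := by have := (abs_le.1 hsγ).1; rw [hβ]; linarith
    have hα0 : 0 ≤ α := by have := (abs_le.1 hsγ).2; rw [hα]; linarith
    have hY' : Y ≠ 0 := abs_pos.1 hY0
    have ex : x = α • (m - (h / 2) • t) + β • (m + (h / 2) • t) + γ • c := by
      have hc' := framePt_coordAlong (m := m) ht c
      rw [← hS, ← hY] at hc'
      have e1 : (β - α) * (h / 2) + γ * S = s := by
        rw [hα, hβ]; field_simp; ring
      have e2 : γ * Y = y := div_mul_cancel₀ _ hY'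
      have e3 : α + β + γ = 1 := by rw [hα, hβ]; ring
      conv_lhs => rw [← framePt_coordAlong (m := m) ht x, ← hs, ← hy]
      conv_rhs => rw [← hc']
      ext i
      simp only [framePt_apply, PiLp.add_apply, PiLp.smul_apply, PiLp.sub_apply, smul_eq_mul]
      linear_combination (-m i) * e3 - t i * e1 - turn t i * e2
    have hsum : α + β + γ = 1 := by rw [hα, hβ]; ring
    have hcv := convex_convexHull ℝ {m - (h / 2) • t, m + (h / 2) • t, c}
    rw [ex, hT]
    have hmem := hcv.sum_mem (t := Finset.univ) (w := ![α, β, γ])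
      (z := ![m - (h / 2) • t, m + (h / 2) • t, c]) (by
        intro i _; fin_cases i <;> [exact hα0; exact hβ0; exact hγ.le])
      (by simp [Fin.sum_univ_three, hsum]) (by
        intro i _
        refine subset_convexHull ℝ _ ?_
        fin_cases i <;> simp)
    simpa [Fin.sum_univ_three] using hmem
  have hopen : ∀ ε : ℝ, IsOpen (Metric.ball m (edgeRatio σ * h) ∩ halfPlane m (ε • turn t)) :=
    fun ε => Metric.isOpen_ball.inter (isOpen_halfPlane _ _)
  -- The sign ε selects the side of the line on which the apex lies, where y/Y is positive.
  rcases lt_or_gt_of_ne (abs_pos.1 hY0) with hneg | hpos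
  · refine ⟨1, Or.inl rfl, interior_maximal (fun x hx => key x hx.1 ?_) (hopen _)⟩
    have := hx.2
    rw [one_smul, mem_halfPlane] at this
    exact div_pos_of_neg_of_neg this hneg
  · refine ⟨-1, Or.inr rfl, interior_maximal (fun x hx => key x hx.1 ?_) (hopen _)⟩
    have := hx.2
    rw [neg_one_smul, mem_halfPlane, coordAlong_neg] at this
    exact div_pos (by linarith) hpos

/-! ### Edge frames and the discs around edge midpoints. -/

namespace PolygonalElement

variable (K : PolygonalElement)

theorem normal_eq_turn (e : K.Edge) : K.normal e = turn (K.tangent e) := rfl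

theorem tangent_unit (e : K.Edge) : K.tangent e 0 ^ 2 + K.tangent e 1 ^ 2 = 1 := by
  have h := K.len_pos e
  rw [← plane_norm_sq, tangent, norm_smul, ← dist_eq_norm, dist_comm, norm_inv,
    Real.norm_of_nonneg h.le]
  change ((K.len e)⁻¹ * K.len e) ^ 2 = 1
  rw [inv_mul_cancel₀ h.ne', one_pow]

/-- The midpoint of an edge. -/
def midpoint (e : K.Edge) : Plane := K.edgePt e (1 / 2)

theorem vertex_succ_sub (e : K.Edge) :
    K.vertex (e + 1) - K.vertex e = K.len e • K.tangent e := by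
  rw [tangent, smul_smul, mul_inv_cancel₀ (K.len_pos e).ne', one_smul]

theorem edgePt_eq (e : K.Edge) (s : ℝ) :
    K.edgePt e s = K.midpoint e + ((s - 1 / 2) * K.len e) • K.tangent e := by
  rw [mul_smul, ← vertex_succ_sub, midpoint, edgePt, edgePt]
  module

theorem vertex_eq (e : K.Edge) : K.vertex e = K.midpoint e - (K.len e / 2) • K.tangent e := by
  rw [div_eq_inv_mul, mul_smul, ← vertex_succ_sub, midpoint, edgePt]
  module

theorem vertex_succ_eq (e : K.Edge) :
    K.vertex (e + 1) = K.midpoint e + (K.len e / 2) • K.tangent e := by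
  rw [div_eq_inv_mul, mul_smul, ← vertex_succ_sub, midpoint, edgePt]
  module

/-- The leftward vector in the orientation condition is -|e| times the normal; this is where the
normal is seen to point outward. -/
theorem eventually_inward_mem (e : K.Edge) :
    ∀ᶠ s in 𝓝[>] (0 : ℝ), K.midpoint e - s • (K.len e • K.normal e) ∈ K.carrier := by
  have hm : K.midpoint e ∈ openSegment ℝ (K.vertex e) (K.vertex (e + 1)) :=
    ⟨1 / 2, 1 / 2, by norm_num, by norm_num, by norm_num, by rw [midpoint, edgePt]; norm_num⟩
  have h := K.left e _ hm
  have hv : (!₂[-((K.vertex (e + 1)) 1 - (K.vertex e) 1),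
      (K.vertex (e + 1)) 0 - (K.vertex e) 0] : Plane) = -(K.len e • K.normal e) := by
    have h0 : ∀ i, (K.vertex (e + 1)) i - (K.vertex e) i = K.len e * K.tangent e i := fun i => by
      have := congrArg (fun x : Plane => x i) (K.vertex_succ_sub e)
      simpa using this
    ext i
    fin_cases i
    · simp [normal, h0]
    · simp [normal, h0]
  rw [hv] at h
  filter_upwards [h] with s hs
  rwa [smul_neg, ← sub_eq_add_neg] at hs

end PolygonalElement

namespace SameEdge

variable {K K' : PolygonalElement} {e : K.Edge} {e' : K'.Edge}

theorem symm (h : SameEdge K e K' e') : SameEdge K' e' K e := ⟨h.2.symm, h.1.symm⟩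

theorem len_eq (h : SameEdge K e K' e') : K'.len e' = K.len e := by
  rw [PolygonalElement.len, PolygonalElement.len, h.1, h.2, dist_comm]

theorem midpoint_eq (h : SameEdge K e K' e') : K'.midpoint e' = K.midpoint e := by
  rw [PolygonalElement.midpoint, PolygonalElement.midpoint, PolygonalElement.edgePt,
    PolygonalElement.edgePt, h.1, h.2]
  module

theorem tangent_eq (h : SameEdge K e K' e') : K'.tangent e' = -K.tangent e := by
  rw [PolygonalElement.tangent, PolygonalElement.tangent, h.len_eq, h.1, h.2]
  module

theorem normal_eq (h : SameEdge K e K' e') : K'.normal e' = -K.normal e := by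
  rw [PolygonalElement.normal, PolygonalElement.normal, h.tangent_eq]
  ext i
  fin_cases i <;> simp

end SameEdge

/-- The half-disc is taken in the triangle that has e as a side. On which side of e that triangle
lies is left open here, as the sign ε. -/
theorem IsVirtualTriangulation.exists_halfDisc_subset {σ : ℝ} (hσ : 0 < σ) {K : PolygonalElement}
    {N : ℕ} {τ : Fin N → Fin 3 → Plane} (h : IsVirtualTriangulation σ K N τ) (e : K.Edge) :
    ∃ ε : ℝ, (ε = 1 ∨ ε = -1) ∧ Metric.ball (K.midpoint e) (edgeRatio σ * K.len e) ∩
      halfPlane (K.midpoint e) (ε • K.normal e) ⊆ K.carrier := by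
  obtain ⟨s, a, b, ha, hb⟩ := h.edge_side e
  have hne : a ≠ b := by
    rintro rfl
    have := K.len_pos e
    rw [PolygonalElement.len, ← ha, ← hb, dist_self] at this
    exact lt_irrefl _ this
  obtain ⟨c, hc⟩ : ∃ c, ∀ i, i = a ∨ i = b ∨ i = c := by
    have : ∀ a b : Fin 3, a ≠ b → ∃ c, ∀ i, i = a ∨ i = b ∨ i = c := by decide
    exact this a b hne
  have hrange : Set.range (τ s) = {K.midpoint e - (K.len e / 2) • K.tangent e,
      K.midpoint e + (K.len e / 2) • K.tangent e, τ s c} := by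
    rw [← K.vertex_eq, ← K.vertex_succ_eq, ← ha, ← hb]
    ext x
    simp only [Set.mem_range, Set.mem_insert_iff, Set.mem_singleton_iff]
    constructor
    · rintro ⟨i, rfl⟩
      rcases hc i with rfl | rfl | rfl <;> simp
    · rintro (rfl | rfl | rfl) <;> exact ⟨_, rfl⟩
  have hbd : Bornology.IsBounded (Set.range (τ s)) := (Set.finite_range _).isBounded
  have hdist : ∀ i j, dist (τ s i) (τ s j) ≤ Metric.diam (Set.range (τ s)) := fun i j =>
    Metric.dist_le_diam_of_mem hbd ⟨i, rfl⟩ ⟨j, rfl⟩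
  obtain ⟨o, ho⟩ := h.shapeRegular s
  have hlen : K.len e ≤ Metric.diam (Set.range (τ s)) := by
    have := hdist a b
    rwa [ha, hb] at this
  have hcm : dist (τ s c) (K.midpoint e) ≤ Metric.diam (Set.range (τ s)) := by
    -- The distance from the apex to the midpoint is bounded by averaging its distances to the two
    -- endpoints.
    have e1 : τ s c - K.midpoint e =
        (1 / 2 : ℝ) • (τ s c - τ s a) + (1 / 2 : ℝ) • (τ s c - τ s b) := by
      rw [ha, hb, PolygonalElement.midpoint, PolygonalElement.edgePt]
      module
    rw [dist_eq_norm, e1]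
    refine (norm_add_le _ _).trans ?_
    rw [norm_smul, norm_smul, ← dist_eq_norm, ← dist_eq_norm]
    have h1 := hdist c a
    have h2 := hdist c b
    norm_num
    linarith
  rw [hrange] at ho
  obtain ⟨ε, hε, hsub⟩ := IPVEM.exists_halfDisc_subset hσ (K.tangent_unit e) (K.len_pos e)
    (hrange ▸ hlen) (hrange ▸ hcm) ho
  refine ⟨ε, hε, hsub.trans ?_⟩
  rw [← hrange]
  exact h.inside s

/-- The half-disc around the midpoint of an edge lies in the element on its side. -/
theorem IsVirtualTriangulation.halfDisc_subset {σ : ℝ} (hσ : 0 < σ) {K K' : PolygonalElement}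
    {N : ℕ} {τ : Fin N → Fin 3 → Plane} (h : IsVirtualTriangulation σ K N τ) {e : K.Edge}
    {e' : K'.Edge} (hs : SameEdge K e K' e') (hd : Disjoint K.carrier K'.carrier) :
    Metric.ball (K.midpoint e) (edgeRatio σ * K.len e) ∩
      halfPlane (K.midpoint e) (K.normal e) ⊆ K.carrier := by
  obtain ⟨ε, rfl | rfl, hsub⟩ := h.exists_halfDisc_subset hσ e
  · rwa [one_smul] at hsub
  -- If the half-disc of K were on the outer side, it would contain points reached from the midpoint
  -- by moving slightly into K', although the two elements are disjoint.
  · exfalso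
    have hl := K.len_pos e
    have h1 := K'.eventually_inward_mem e'
    have h2 : ∀ᶠ s in 𝓝[>] (0 : ℝ), K'.midpoint e' - s • (K'.len e' • K'.normal e') ∈
        Metric.ball (K.midpoint e) (edgeRatio σ * K.len e) := by
      refine Filter.Eventually.filter_mono nhdsWithin_le_nhds ?_
      have hc : ContinuousAt
          (fun s : ℝ => K'.midpoint e' - s • (K'.len e' • K'.normal e')) 0 := by fun_prop
      refine hc.eventually_mem (Metric.isOpen_ball.mem_nhds ?_)
      simp [hs.midpoint_eq, edgeRatio_pos hσ, hl]
    obtain ⟨s, ⟨hs1, hs2⟩, hs0⟩ := ((h1.and h2).and self_mem_nhdsWithin).exists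
    refine Set.disjoint_left.1 hd (hsub ⟨hs2, ?_⟩) hs1
    rw [hs.midpoint_eq, hs.len_eq, hs.normal_eq, neg_one_smul, mem_halfPlane, coordAlong_neg]
    have hu := K.tangent_unit e
    have : coordAlong (K.midpoint e) (K.normal e)
        (K.midpoint e - s • K.len e • -K.normal e) = s * K.len e := by
      simp [coordAlong, PolygonalElement.normal]
      linear_combination (s * K.len e) * hu
    rw [this]
    have : 0 < s * K.len e := mul_pos hs0 hl
    linarith

/-- Around the midpoint of an interior edge there is a disc, of radius comparable to the length of
the edge, which consists of a half-disc in each of the two elements and a part of the edge. -/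
theorem Mesh.IsRegular.disc_subset {Ω : Set Plane} {T : Mesh Ω} {σ : ℝ} (hσ : 0 < σ)
    (hT : T.IsRegular σ) {K K' : Fin T.card} {e : (T.elem K).Edge} {e' : (T.elem K').Edge}
    (h : T.IsInteriorEdge K e K' e') :
    (Metric.ball ((T.elem K).midpoint e) (edgeRatio σ * (T.elem K).len e) ∩
      halfPlane ((T.elem K).midpoint e) ((T.elem K).normal e) ⊆ (T.elem K).carrier) ∧
    (Metric.ball ((T.elem K).midpoint e) (edgeRatio σ * (T.elem K).len e) ∩
      halfPlane ((T.elem K).midpoint e) (-(T.elem K).normal e) ⊆ (T.elem K').carrier) ∧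
    Metric.ball ((T.elem K).midpoint e) (edgeRatio σ * (T.elem K).len e) ⊆ Ω := by
  obtain ⟨hne, hs, hseg⟩ := h
  obtain ⟨N, τ, hτ⟩ := hT K
  obtain ⟨N', τ', hτ'⟩ := hT K'
  have h1 := hτ.halfDisc_subset hσ hs (T.disjoint K K' hne)
  have h2 := hτ'.halfDisc_subset hσ hs.symm (T.disjoint K' K hne.symm)
  rw [hs.midpoint_eq, hs.len_eq, hs.normal_eq] at h2
  refine ⟨h1, h2, fun x hx => ?_⟩
  have hu := (T.elem K).tangent_unit e
  rcases lt_trichotomy (coordAlong ((T.elem K).midpoint e) ((T.elem K).normal e) x) 0 with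
    hx0 | hx0 | hx0
  · exact T.subset K (h1 ⟨hx, hx0⟩)
  -- Points of the disc on the line through e have tangential coordinate below h_e/2, since
  -- `edgeRatio σ < 1 / 2`; they lie on the open edge, which is inside Ω.
  · refine hseg ?_
    have hl := (T.elem K).len_pos e
    have e1 := framePt_coordAlong (m := (T.elem K).midpoint e) hu x
    rw [← PolygonalElement.normal_eq_turn, hx0] at e1
    have h3 := (abs_coordAlong_le (m := (T.elem K).midpoint e) hu x).1
    rw [Metric.mem_ball] at hx
    set s := coordAlong ((T.elem K).midpoint e) ((T.elem K).tangent e) x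
    have h4 : |s| < 1 / 2 * (T.elem K).len e := (h3.trans_lt hx).trans
      (mul_lt_mul_of_pos_right (edgeRatio_lt hσ) hl)
    have h5 : |s / (T.elem K).len e| < 1 / 2 := by
      rwa [abs_div, abs_of_pos hl, div_lt_iff₀ hl]
    rw [abs_lt] at h5
    refine ⟨1 / 2 - s / (T.elem K).len e, 1 / 2 + s / (T.elem K).len e, by linarith, by linarith,
      by ring, ?_⟩
    have e2 := (T.elem K).edgePt_eq e (1 / 2 + s / (T.elem K).len e)
    rw [PolygonalElement.edgePt] at e2
    rw [← e1, framePt, zero_smul, add_zero]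
    have e3 : (1 / 2 + s / (T.elem K).len e - 1 / 2) * (T.elem K).len e = s := by field_simp; ring
    rw [e3] at e2
    rw [← e2]
    congr 2
    ring
  · refine T.subset K' (h2 ⟨hx, ?_⟩)
    rw [mem_halfPlane, coordAlong_neg]
    linarith

/-! ### Degrees -/

theorem pd_mem {k : ℕ} {p : MvPolynomial (Fin 2) ℝ} (hp : p ∈ Pk k) (i : Fin 2) : pd i p ∈ Pk k := by
  rw [MvPolynomial.mem_restrictTotalDegree] at hp ⊢
  refine Finset.sup_le fun m hm => ?_
  rw [MvPolynomial.mem_support_iff, MvPolynomial.coeff_pderiv] at hm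
  have h1 : m + Finsupp.single i 1 ∈ p.support :=
    MvPolynomial.mem_support_iff.2 (left_ne_zero_of_mul hm)
  have h2 := (MvPolynomial.le_totalDegree h1).trans hp
  rw [Finsupp.sum_add_index' (fun _ => rfl) (fun _ _ _ => rfl)] at h2
  omega

theorem polyLap_mem {k : ℕ} {p : MvPolynomial (Fin 2) ℝ} (hp : p ∈ Pk k) : polyLap p ∈ Pk k :=
  Submodule.sum_mem _ fun i _ => pd_mem (pd_mem hp i) i

/-- Affine substitution in each monomial does not raise the degree; this moves a residual to the
reference disc. -/
theorem exists_ev_comp_smul {k : ℕ} {q : MvPolynomial (Fin 2) ℝ} (hq : q ∈ Pk k) (c : Plane)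
    (r : ℝ) : ∃ q' ∈ Pk k, ∀ y, ev q' y = ev q (c + r • y) := by
  refine ⟨∑ m ∈ q.support, MvPolynomial.coeff m q •
    ∏ i, (MvPolynomial.C (c i) + MvPolynomial.C r * MvPolynomial.X i) ^ m i, ?_, fun y => ?_⟩
  · refine Submodule.sum_mem _ fun m hm => Submodule.smul_mem _ _ ?_
    rw [MvPolynomial.mem_restrictTotalDegree] at hq ⊢
    have h1 := (MvPolynomial.le_totalDegree hm).trans hq
    refine (MvPolynomial.totalDegree_finsetProd _ _).trans (le_trans ?_ h1)
    rw [Finsupp.sum_fintype _ _ fun _ => rfl]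
    refine Finset.sum_le_sum fun i _ => (MvPolynomial.totalDegree_pow _ _).trans ?_
    have h2 : (MvPolynomial.C (c i) + MvPolynomial.C r * MvPolynomial.X i :
        MvPolynomial (Fin 2) ℝ).totalDegree ≤ 1 := by
      refine (MvPolynomial.totalDegree_add _ _).trans (max_le (by simp) ?_)
      refine (MvPolynomial.totalDegree_mul _ _).trans ?_
      simp
    simpa using Nat.mul_le_mul_left (m i) h2
  · simp only [ev, map_sum, MvPolynomial.smul_eval, map_prod, map_pow, map_add, map_mul,
      MvPolynomial.eval_C, MvPolynomial.eval_X]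
    rw [MvPolynomial.eval_eq']
    simp

theorem exists_eval_line {k : ℕ} {q : MvPolynomial (Fin 2) ℝ} (hq : q ∈ Pk k) (x v : Plane) :
    ∃ a : Polynomial ℝ, a.natDegree ≤ k ∧ ∀ s, a.eval s = ev q (x + s • v) := by
  rw [MvPolynomial.mem_restrictTotalDegree] at hq
  refine ⟨MvPolynomial.aeval (fun i => Polynomial.C (x i) + Polynomial.C (v i) * Polynomial.X) q,
    ?_, fun s => ?_⟩
  · refine (MvPolynomial.aeval_natDegree_le q hq _ (n := 1) fun i => ?_).trans (by simp)
    compute_degree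
  · have h : (Polynomial.aeval s).comp (MvPolynomial.aeval
        (fun i => Polynomial.C (x i) + Polynomial.C (v i) * Polynomial.X)) =
        (MvPolynomial.aeval (fun i => x i + s * v i) : MvPolynomial (Fin 2) ℝ →ₐ[ℝ] ℝ) := by
      ext i; simp; ring
    have h1 := congrArg (fun F : MvPolynomial (Fin 2) ℝ →ₐ[ℝ] ℝ => F q) h
    simpa [ev, MvPolynomial.aeval_eq_eval] using h1

/-- The polynomial `∂²p/∂n²`. -/
def normalHess (p : MvPolynomial (Fin 2) ℝ) (n : Plane) : MvPolynomial (Fin 2) ℝ :=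
  ∑ i, ∑ j, (n i * n j) • pd i (pd j p)

/-- The polynomial `∂(Δp)/∂n + ∂³p/∂n∂t²`. -/
def shearForce (p : MvPolynomial (Fin 2) ℝ) (n t : Plane) : MvPolynomial (Fin 2) ℝ :=
  (∑ i, n i • pd i (polyLap p)) + ∑ i, ∑ j, ∑ l, (n i * t j * t l) • pd i (pd j (pd l p))

theorem ev_sum {ι : Type*} (s : Finset ι) (p : ι → MvPolynomial (Fin 2) ℝ) (x : Plane) :
    ev (∑ i ∈ s, p i) x = ∑ i ∈ s, ev (p i) x := by
  simp [ev]

theorem ev_normalHess (p : MvPolynomial (Fin 2) ℝ) (n x : Plane) :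
    ev (normalHess p n) x = polyD2 p n x := by
  simp only [normalHess, polyD2, ev_sum, ev_smul]

theorem ev_shearForce (p : MvPolynomial (Fin 2) ℝ) (n t x : Plane) :
    ev (shearForce p n t) x = polyD1 (polyLap p) n x + polyD3 p n t x := by
  simp only [shearForce, polyD1, polyD3, ev_add, ev_sum, ev_smul]

theorem normalHess_mem {k : ℕ} {p : MvPolynomial (Fin 2) ℝ} (hp : p ∈ Pk k) (n : Plane) :
    normalHess p n ∈ Pk k :=
  Submodule.sum_mem _ fun _ _ => Submodule.sum_mem _ fun _ _ =>
    Submodule.smul_mem _ _ (pd_mem (pd_mem hp _) _)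

theorem shearForce_mem {k : ℕ} {p : MvPolynomial (Fin 2) ℝ} (hp : p ∈ Pk k) (n t : Plane) :
    shearForce p n t ∈ Pk k :=
  Submodule.add_mem _
    (Submodule.sum_mem _ fun _ _ => Submodule.smul_mem _ _ (pd_mem (polyLap_mem hp) _))
    (Submodule.sum_mem _ fun _ _ => Submodule.sum_mem _ fun _ _ => Submodule.sum_mem _ fun _ _ =>
      Submodule.smul_mem _ _ (pd_mem (pd_mem (pd_mem hp _) _) _))

theorem l2Proj_mem (k : ℕ) (U : Set Plane) (f : Plane → ℝ) : l2Proj k U f ∈ Pk k := by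
  rw [l2Proj]
  split_ifs with h
  · exact h.choose_spec.1
  · exact Submodule.zero_mem _

theorem gradProj_mem (k : ℕ) (K : PolygonalElement) (v : Plane → ℝ) : gradProj k K v ∈ Pk k := by
  rw [gradProj]
  split_ifs with h
  · exact h.choose_spec.1
  · exact Submodule.zero_mem _

/-! ### The residual -/

/-- The area of the unit disc. -/
def discArea : ℝ := volume.real (Metric.ball (0 : Plane) 1)

theorem discArea_nonneg : 0 ≤ discArea := measureReal_nonneg

theorem volume_real_ball (c : Plane) {r : ℝ} (hr : 0 ≤ r) :
    volume.real (Metric.ball c r) = r ^ 2 * discArea := by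
  rw [← Measure.addHaar_real_closedBall_eq_addHaar_real_ball]
  simpa [discArea] using Measure.addHaar_real_closedBall (volume : Measure Plane) c hr

theorem sq_integral_mul_le {μ : Measure Plane} {f g : Plane → ℝ} (hf : MemLp f 2 μ)
    (hg : MemLp g 2 μ) :
    (∫ x, f x * g x ∂μ) ^ 2 ≤ (∫ x, f x ^ 2 ∂μ) * ∫ x, g x ^ 2 ∂μ := by
  have hf2 := hf.integrable_sq
  have hg2 := hg.integrable_sq
  have hfg := integrable_mul_of_memLp hf hg
  -- Cauchy–Schwarz from the discriminant of the nonnegative quadratic s ↦ ∫ (sf + g)².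
  have h : ∀ s : ℝ, 0 ≤ (∫ x, f x ^ 2 ∂μ) * (s * s) + (2 * ∫ x, f x * g x ∂μ) * s +
      ∫ x, g x ^ 2 ∂μ := by
    intro s
    have h1 : 0 ≤ ∫ x, (s * f x + g x) ^ 2 ∂μ := integral_nonneg fun x => sq_nonneg _
    have h2 : ∫ x, (s * f x + g x) ^ 2 ∂μ =
        ∫ x, ((s * s) * f x ^ 2 + (2 * s) * (f x * g x) + g x ^ 2) ∂μ := by
      congr 1; funext x; ring
    have h3 : Integrable (fun x => (s * s) * f x ^ 2 + (2 * s) * (f x * g x)) μ :=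
      (hf2.const_mul _).add (hfg.const_mul _)
    rw [h2, integral_add h3 hg2,
      integral_add (hf2.const_mul _) (hfg.const_mul _), integral_const_mul,
      integral_const_mul] at h1
    linarith
  have := discrim_le_zero h
  rw [discrim] at this
  linarith

/-- Cauchy–Schwarz on S; the factor from φ is at most its sup bound times the area of a disc of
radius r. -/
theorem sq_setIntegral_mul_test_le {U S : Set Plane} {c : Plane} {r A : ℝ} (hr : 0 ≤ r)
    (hS : S ⊆ Metric.ball c r) (hSU : S ⊆ U) {g φ : Plane → ℝ} (hg : MemLp g 2 (volume.restrict U))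
    {W : Set Plane} (hφ : IsTest W φ) (hA : ∀ x, φ x ^ 2 ≤ A) :
    (∫ x in S, g x * φ x) ^ 2 ≤ (∫ x in U, g x ^ 2) * (r ^ 2 * discArea * A) := by
  have hA0 : 0 ≤ A := (sq_nonneg _).trans (hA 0)
  refine (sq_integral_mul_le (hg.mono_measure (Measure.restrict_mono hSU le_rfl))
    (hφ.memLp S)).trans (mul_le_mul ?_ ?_ (integral_nonneg fun _ => sq_nonneg _)
      (integral_nonneg fun _ => sq_nonneg _))
  · exact setIntegral_mono_set hg.integrable_sq (ae_of_all _ fun _ => sq_nonneg _)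
      (Eventually.of_forall hSU)
  · have hfin : volume S < ⊤ := (measure_mono hS).trans_lt measure_ball_lt_top
    have h1 : ∫ x in S, φ x ^ 2 ≤ ∫ _ in S, A :=
      integral_mono (hφ.memLp S).integrable_sq (integrableOn_const hfin.ne) hA
    refine h1.trans ?_
    rw [setIntegral_const, smul_eq_mul, ← volume_real_ball c hr]
    exact mul_le_mul_of_nonneg_right (measureReal_mono hS measure_ball_lt_top.ne) hA0

/-- The residual of the piecewise polynomial `p` on `S`, with data `g`. -/
def residual (Ω S : Set Plane) (f u : Plane → ℝ) (p g : MvPolynomial (Fin 2) ℝ) (v : Plane → ℝ) :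
    ℝ :=
  (∑ i, ∑ j, ∫ x in S, (weakPartial Ω i (weakPartial Ω j u) x - ev (pd i (pd j p)) x) *
    partialD i (partialD j v) x) - ∫ x in S, (f x - ev g x) * v x

theorem memLp_hess {Ω : Set Plane} {u : Plane → ℝ} (hu : MemH2 Ω u) (i j : Fin 2) :
    MemLp (weakPartial Ω i (weakPartial Ω j u)) 2 (volume.restrict Ω) :=
  (hasWeakPartial_weakPartial ((hu.2 j).2 i)).1

theorem residual_eq {Ω S : Set Plane} (hS : S ⊆ Ω) {f u : Plane → ℝ}
    (hf : MemLp f 2 (volume.restrict Ω)) (hu : MemH2 Ω u) (p g : MvPolynomial (Fin 2) ℝ)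
    {W : Set Plane} {v : Plane → ℝ} (hv : IsTest W v) :
    residual Ω S f u p g v =
      (∑ i, ∑ j, ∫ x in S, weakPartial Ω i (weakPartial Ω j u) x * partialD i (partialD j v) x) -
        (∫ x in S, f x * v x) - (∫ x in S, hessDot p v x) + ∫ x in S, ev g x * v x := by
  have hr : ∀ {g : Plane → ℝ}, MemLp g 2 (volume.restrict Ω) → MemLp g 2 (volume.restrict S) :=
    fun hg => hg.mono_measure (Measure.restrict_mono hS le_rfl)
  have h1 : ∫ x in S, (f x - ev g x) * v x = (∫ x in S, f x * v x) - ∫ x in S, ev g x * v x := by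
    simp only [sub_mul]
    exact integral_sub (integrable_mul_of_memLp (hr hf) (hv.memLp S))
      (integrable_mul_test (continuous_ev g) hv).integrableOn
  have h2 : ∀ i j, ∫ x in S, (weakPartial Ω i (weakPartial Ω j u) x - ev (pd i (pd j p)) x) *
      partialD i (partialD j v) x =
      (∫ x in S, weakPartial Ω i (weakPartial Ω j u) x * partialD i (partialD j v) x) -
      ∫ x in S, ev (pd i (pd j p)) x * partialD i (partialD j v) x := fun i j => by
    simp only [sub_mul]
    exact integral_sub (integrable_mul_of_memLp (hr (memLp_hess hu i j))
      (((hv.partialD j).partialD i).memLp S))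
      (integrable_mul_test (continuous_ev _) ((hv.partialD j).partialD i)).integrableOn
  have hi : ∀ i j, IntegrableOn
      (fun x => ev (pd i (pd j p)) x * partialD i (partialD j v) x) S := fun i j =>
    (integrable_mul_test (continuous_ev _) ((hv.partialD j).partialD i)).integrableOn
  have h3 : ∫ x in S, hessDot p v x =
      ∑ i, ∑ j, ∫ x in S, ev (pd i (pd j p)) x * partialD i (partialD j v) x := by
    simp only [hessDot]
    rw [integral_finsetSum _ fun i _ => integrable_finsetSum _ fun j _ => hi i j]
    exact Finset.sum_congr rfl fun i _ => integral_finsetSum _ fun j _ => hi i j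
  rw [residual, h1, h3]
  simp only [h2, Finset.sum_sub_distrib]
  ring

/-- Cauchy–Schwarz for each of the four Hessian entries and for the data term; the 5 is the number
of terms. The hypothesis on second derivatives is the scaling that a similarity of ratio r produces.
-/
theorem sq_residual_le {Ω S : Set Plane} {K : PolygonalElement} (hK : K.carrier ⊆ Ω)
    (hS : S ⊆ K.carrier) {c : Plane} {r A : ℝ} (hr : 0 < r) (hSc : S ⊆ Metric.ball c r)
    {f u : Plane → ℝ} (hf : MemLp f 2 (volume.restrict Ω)) (hu : MemH2 Ω u)
    (p g : MvPolynomial (Fin 2) ℝ) {W : Set Plane} {v : Plane → ℝ} (hv : IsTest W v)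
    (hA : ∀ x, v x ^ 2 ≤ A)
    (hA2 : ∀ i j x, (partialD i (partialD j v) x) ^ 2 ≤ 16 * A / r ^ 4) :
    (residual Ω S f u p g v) ^ 2 ≤ 5 * (r ^ 2 * discArea * A) *
      (16 / r ^ 4 * energyErrorSq K u p + l2NormSq K.carrier (fun x => f x - ev g x)) := by
  have hb := K.isBounded_carrier
  have hres : ∀ {g : Plane → ℝ}, MemLp g 2 (volume.restrict Ω) →
      MemLp g 2 (volume.restrict K.carrier) := fun hg =>
    hg.mono_measure (Measure.restrict_mono hK le_rfl)
  have h1 := sq_setIntegral_mul_test_le hr.le hSc hS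
    ((hres hf).sub (memLp_of_continuous hb (continuous_ev g))) hv hA
  have h2 := fun i j => sq_setIntegral_mul_test_le hr.le hSc hS
    ((hres (memLp_hess hu i j)).sub (memLp_of_continuous hb (continuous_ev (pd i (pd j p)))))
    ((hv.partialD j).partialD i) (hA2 i j)
  simp only [Pi.sub_apply] at h1 h2
  rw [energyErrorSq_eq hK hu, l2NormSq, residual]
  simp only [Fin.sum_univ_two]
  set T := ∫ x in S, (f x - ev g x) * v x
  set T00 := ∫ x in S, (weakPartial Ω 0 (weakPartial Ω 0 u) x - ev (pd 0 (pd 0 p)) x) *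
    partialD 0 (partialD 0 v) x
  set T01 := ∫ x in S, (weakPartial Ω 0 (weakPartial Ω 1 u) x - ev (pd 0 (pd 1 p)) x) *
    partialD 0 (partialD 1 v) x
  set T10 := ∫ x in S, (weakPartial Ω 1 (weakPartial Ω 0 u) x - ev (pd 1 (pd 0 p)) x) *
    partialD 1 (partialD 0 v) x
  set T11 := ∫ x in S, (weakPartial Ω 1 (weakPartial Ω 1 u) x - ev (pd 1 (pd 1 p)) x) *
    partialD 1 (partialD 1 v) x
  have h3 : (T00 + T01 + (T10 + T11) - T) ^ 2 ≤
      5 * (T00 ^ 2 + T01 ^ 2 + T10 ^ 2 + T11 ^ 2 + T ^ 2) := by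
    nlinarith [sq_nonneg (T00 - T01), sq_nonneg (T00 - T10), sq_nonneg (T00 - T11),
      sq_nonneg (T00 + T), sq_nonneg (T01 - T10), sq_nonneg (T01 - T11), sq_nonneg (T01 + T),
      sq_nonneg (T10 - T11), sq_nonneg (T10 + T), sq_nonneg (T11 + T)]
  have e : ∀ X : ℝ, X * (r ^ 2 * discArea * (16 * A / r ^ 4)) =
      (r ^ 2 * discArea * A) * (16 / r ^ 4 * X) := fun X => by ring
  simp only [e] at h2
  linarith [h2 0 0, h2 0 1, h2 1 0, h2 1 1]

/-- Cancels the factor that enters because the size of the test function is measured by the residual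
itself. -/
theorem le_of_sq_le_mul {a b : ℝ} (ha : 0 ≤ a) (hb : 0 ≤ b) (h : a ^ 2 ≤ a * b) : a ≤ b := by
  rcases ha.eq_or_lt with rfl | h0
  · exact hb
  · exact le_of_mul_le_mul_left (by linarith) h0

theorem l2NormSq_nonneg (U : Set Plane) (v : Plane → ℝ) : 0 ≤ l2NormSq U v :=
  integral_nonneg fun _ => sq_nonneg _

theorem energyErrorSq_nonneg (K : PolygonalElement) (u : Plane → ℝ)
    (p : MvPolynomial (Fin 2) ℝ) : 0 ≤ energyErrorSq K u p := by
  rw [energyErrorSq, h2SemiSq]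
  exact Finset.sum_nonneg fun _ _ =>
    Finset.sum_nonneg fun _ _ => l2NormSq_nonneg _ _

theorem oscSq_nonneg (k : ℕ) (K : PolygonalElement) (f : Plane → ℝ) : 0 ≤ oscSq k K f :=
  mul_nonneg (by have := K.diam_pos; positivity) (l2NormSq_nonneg _ _)

/-! ### The element residual -/

/-- Tests the equation with the residual polynomial q times a cutoff supported in a disc inside K,
where no boundary terms arise. -/
theorem exists_elementResidualSq_le (k : ℕ) {σ : ℝ} (hσ : 0 < σ) : ∃ C : ℝ, 0 ≤ C ∧
    ∀ (Ω : Set Plane) (_ : IsOpen Ω) (K : PolygonalElement) (_ : K.carrier ⊆ Ω)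
      (N : ℕ) (τ : Fin N → Fin 3 → Plane) (_ : IsVirtualTriangulation σ K N τ)
      (f : Plane → ℝ) (_ : MemLp f 2 (volume.restrict Ω)) (u : Plane → ℝ)
      (_ : IsWeakSolution Ω f u) (p : MvPolynomial (Fin 2) ℝ) (_ : p ∈ Pk k),
      elementResidualSq k K f p ≤ C * (energyErrorSq K u p + oscSq k K f) := by
  -- Every point of K is within h_K of the centre of a disc of radius σ²h_K, so the rescaled element
  -- lies in the disc of radius 1/σ².
  obtain ⟨M, hM, hbound⟩ := exists_disc_bound k (1 / σ ^ 2)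
  have hV := discArea_nonneg
  refine ⟨discArea * M * (5 * discArea * M) * (16 / σ ^ 12 + 1 / σ ^ 4), by positivity, ?_⟩
  intro Ω hΩ K hK N τ hτ f hf u hu p hp
  obtain ⟨c, hc⟩ := hτ.exists_ball_subset hσ
  have hh := K.diam_pos
  set h := K.diam with hhd
  set r := σ ^ 2 * h with hrd
  have hr : 0 < r := by positivity
  set g := l2Proj k K.carrier f with hg
  set q := g - polyLap (polyLap p) with hq
  have hqm : q ∈ Pk k := Submodule.sub_mem _ (l2Proj_mem _ _ _) (polyLap_mem (polyLap_mem hp))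
  obtain ⟨q', hq'm, hq'⟩ := exists_ev_comp_smul hqm c r
  obtain ⟨b1, b2, b3⟩ := hbound q' hq'm
  set I := ∫ x in Metric.ball 0 (1 / 2), ev q' x ^ 2 with hI
  have hI0 : 0 ≤ I := integral_nonneg fun _ => sq_nonneg _
  let id' := LinearIsometryEquiv.refl ℝ Plane
  have hΦ : ∀ x, toUnitDisc id' c r x = r⁻¹ • (x - c) := fun x => rfl
  have hqΦ : ∀ x, ev q' (toUnitDisc id' c r x) = ev q x := fun x => by
    rw [hq', hΦ, smul_inv_smul₀ hr.ne', add_sub_cancel]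
  have hw := isTest_cutoff_mul (contDiff_ev q')
  set w : Plane → ℝ := fun x => cutoff x * ev q' x with hwd
  have hv := hw.comp_toUnitDisc id' c hr
  set v : Plane → ℝ := fun x => w (toUnitDisc id' c r x) with hvd
  have hvK : IsTest K.carrier v := hv.mono hc
  have hvΩ : IsTest Ω v := hvK.mono hK
  -- the residual equation
  have hres : residual Ω (Metric.ball c r) f u p g v = ∫ x, ev q x * v x := by
    rw [residual_eq (hc.trans hK) hf hu.1.1 p g hv]
    have e1 := hu.test hΩ hvΩ
    have e2 : ∀ i j, ∫ x in Metric.ball c r, weakPartial Ω i (weakPartial Ω j u) x *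
        partialD i (partialD j v) x = ∫ x in Ω, weakPartial Ω i (weakPartial Ω j u) x *
        partialD i (partialD j v) x := fun i j => by
      rw [setIntegral_mul_test ((hv.partialD j).partialD i),
        setIntegral_mul_test ((hvΩ.partialD j).partialD i)]
    have e3 : ∫ x in Metric.ball c r, hessDot p v x = ∫ x, hessDot p v x :=
      setIntegral_eq_integral_of_forall_compl_eq_zero fun x hx =>
        Finset.sum_eq_zero fun i _ => Finset.sum_eq_zero fun j _ => by
          rw [((hv.partialD j).partialD i).eq_zero hx, mul_zero]
    simp only [e2]
    rw [e1, setIntegral_mul_test hvΩ, setIntegral_mul_test hv, e3, integral_hessDot p hv,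
      setIntegral_mul_test hv]
    have e4 : ∫ x, ev q x * v x =
        (∫ x, ev g x * v x) - ∫ x, ev (polyLap (polyLap p)) x * v x := by
      rw [← integral_sub (integrable_mul_test (continuous_ev _) hv)
        (integrable_mul_test (continuous_ev _) hv)]
      simp only [hq, ev_sub, sub_mul]
    rw [e4]
    ring
  -- The change of variables to the unit disc contributes r²; discarding the region outside the
  -- half-size disc is allowed because the integrand is nonnegative.
  have hlow : r ^ 2 * I ≤ ∫ x, ev q x * v x := by
    have e1 : ∫ x, ev q x * v x = ∫ x, (fun y => cutoff y * ev q' y ^ 2) (r⁻¹ • (x - c)) := by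
      congr 1; funext x
      rw [← hqΦ]
      simp only [hvd, hwd, ← hΦ]
      ring
    rw [e1, integral_sub_right_eq_self (fun x => (fun y => cutoff y * ev q' y ^ 2) (r⁻¹ • x)),
      Measure.integral_comp_inv_smul_of_nonneg volume (fun y => cutoff y * ev q' y ^ 2) hr.le]
    have e2 : Module.finrank ℝ Plane = 2 := by simp
    rw [e2, smul_eq_mul]
    refine mul_le_mul_of_nonneg_left ?_ (by positivity)
    have hint : Integrable (fun y => cutoff y * ev q' y ^ 2) := by
      have := (isTest_cutoff_mul ((contDiff_ev q').pow 2))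
      exact this.1.continuous.integrable_of_hasCompactSupport this.2.1
    have e3 : I = ∫ y in Metric.ball 0 (1 / 2), cutoff y * ev q' y ^ 2 := by
      refine setIntegral_congr_fun measurableSet_ball fun y hy => ?_
      rw [cutoff_eq_one (mem_ball_zero_iff.1 hy).le, one_mul]
    rw [e3]
    exact setIntegral_le_integral hint (ae_of_all _ fun y =>
      mul_nonneg (cutoff_nonneg y) (sq_nonneg _))
  have hup := sq_residual_le hK hc hr subset_rfl hf hu.1.1 p g hv
    (fun x => b1 (toUnitDisc id' c r x)) (sq_partialD_comp_toUnitDisc_le id' c hr hw.1 b2)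
  rw [hres] at hup
  have hE := energyErrorSq_nonneg K u p
  have hO := l2NormSq_nonneg K.carrier (fun x => f x - ev g x)
  have hI1 : r ^ 2 * I ≤ 5 * discArea * M * (16 / r ^ 4 * energyErrorSq K u p +
      l2NormSq K.carrier (fun x => f x - ev g x)) := by
    refine le_of_sq_le_mul (by positivity) (by positivity) ?_
    refine (pow_le_pow_left₀ (by positivity) hlow 2).trans (hup.trans (le_of_eq ?_))
    ring
  -- the norm on the element is controlled by the norm on the disc
  have hcK : c ∈ K.carrier := hc (Metric.mem_ball_self hr)
  have hdist : ∀ x ∈ K.carrier, dist x c ≤ h := fun x hx =>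
    Metric.dist_le_diam_of_mem K.isBounded_carrier hx hcK
  have hvol : volume.real K.carrier ≤ h ^ 2 * discArea := by
    have h1 : volume.real (Metric.closedBall c h) = h ^ 2 * discArea := by
      have := Measure.addHaar_real_closedBall (volume : Measure Plane) c hh.le
      simpa [discArea] using this
    rw [← h1]
    exact measureReal_mono (fun x hx => hdist x hx) measure_closedBall_lt_top.ne
  have hnorm : l2NormSq K.carrier (fun x => ev g x - ev (polyLap (polyLap p)) x) ≤
      h ^ 2 * discArea * (M * I) := by
    have h1 : ∀ x ∈ K.carrier, (ev g x - ev (polyLap (polyLap p)) x) ^ 2 ≤ M * I := by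
      intro x hx
      rw [← ev_sub, ← hq, ← hqΦ]
      refine b3 _ ?_
      rw [norm_toUnitDisc _ _ hr, inv_mul_le_iff₀ hr]
      refine (hdist x hx).trans (le_of_eq ?_)
      rw [hrd]; field_simp
    have hfin : volume K.carrier ≠ ⊤ := K.isBounded_carrier.measure_lt_top.ne
    have h2 : l2NormSq K.carrier (fun x => ev g x - ev (polyLap (polyLap p)) x) ≤
        ∫ _ in K.carrier, M * I :=
      setIntegral_mono_on (integrableOn_of_continuous K.isBounded_carrier
        (((continuous_ev _).sub (continuous_ev _)).pow 2)) (integrableOn_const hfin)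
        K.isOpen_carrier.measurableSet h1
    refine h2.trans ?_
    rw [setIntegral_const, smul_eq_mul]
    exact mul_le_mul_of_nonneg_right hvol (by positivity)
  -- Substituting r = σ²h_K turns h_K² into r²/σ⁴ and h_K⁴/r⁴ into 1/σ⁸, which gives the powers 12
  -- and 4 of σ in the constant.
  calc elementResidualSq k K f p ≤ h ^ 4 * (h ^ 2 * discArea * (M * I)) :=
        mul_le_mul_of_nonneg_left hnorm (by positivity)
    _ = h ^ 4 * discArea * M / σ ^ 4 * (r ^ 2 * I) := by rw [hrd]; field_simp
    _ ≤ h ^ 4 * discArea * M / σ ^ 4 * (5 * discArea * M * (16 / r ^ 4 * energyErrorSq K u p +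
      l2NormSq K.carrier (fun x => f x - ev g x))) := by gcongr
    _ = discArea * M * (5 * discArea * M) *
        (16 / σ ^ 12 * energyErrorSq K u p + 1 / σ ^ 4 * oscSq k K f) := by
      rw [oscSq, ← hg, ← hhd, hrd]; field_simp
    _ ≤ discArea * M * (5 * discArea * M) *
        ((16 / σ ^ 12 + 1 / σ ^ 4) * (energyErrorSq K u p + oscSq k K f)) := by
      have hO' := oscSq_nonneg k K f
      have h1 : 0 ≤ 16 / σ ^ 12 * oscSq k K f := by positivity
      have h2 : 0 ≤ 1 / σ ^ 4 * energyErrorSq K u p := by positivity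
      refine mul_le_mul_of_nonneg_left ?_ (by positivity)
      linarith
    _ = _ := by ring

/-! ### The edge residuals -/

theorem volume_line (m t : Plane) (ht : t 0 ^ 2 + t 1 ^ 2 = 1) :
    volume {x | coordAlong m (turn t) x = 0} = 0 := by
  have hc : Continuous fun x => coordAlong m (turn t) x := by unfold coordAlong; fun_prop
  have hm : MeasurableSet {x | coordAlong m (turn t) x = 0} :=
    (isClosed_singleton.preimage hc).measurableSet
  obtain ⟨h1, -⟩ := measurePreserving_framePt m t ht
  rw [← h1.measure_preimage hm.nullMeasurableSet]
  have e : (fun p : ℝ × ℝ => framePt m t p.1 p.2) ⁻¹' {x | coordAlong m (turn t) x = 0} =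
      Set.univ ×ˢ {0} := by
    ext p
    have : coordAlong m (turn t) (framePt m t p.1 p.2) = p.2 := by
      simp [coordAlong, framePt_apply]
      linear_combination p.2 * ht
    simp [this]
  rw [e, Measure.volume_eq_prod, Measure.prod_prod]
  simp

/-- The two open half-planes miss only the dividing line, a null set. -/
theorem setIntegral_split {m t : Plane} (ht : t 0 ^ 2 + t 1 ^ 2 = 1) {D : Set Plane}
    {g : Plane → ℝ} (hg : IntegrableOn g D) :
    ∫ x in D, g x = (∫ x in D ∩ halfPlane m (turn t), g x) +
      ∫ x in D ∩ halfPlane m (-turn t), g x := by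
  rw [← integral_inter_add_sdiff (isOpen_halfPlane m (turn t)).measurableSet hg]
  congr 1
  refine setIntegral_congr_set ?_
  have h0 : ∀ᵐ x ∂(volume : Measure Plane), coordAlong m (turn t) x ≠ 0 := by
    rw [ae_iff]; simpa using volume_line m t ht
  filter_upwards [h0] with x hx
  refine propext ⟨fun h => ⟨h.1, ?_⟩, fun h => ⟨h.1, fun h' => ?_⟩⟩
  · have h2 := lt_of_le_of_ne (not_lt.1 fun h' => h.2 h') hx.symm
    rw [mem_halfPlane, coordAlong_neg]
    linarith
  · have h2 := h.2
    rw [mem_halfPlane, coordAlong_neg] at h2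
    have h3 : coordAlong m (turn t) x < 0 := h'
    linarith

/-- The boundary form in Green's formula on a half-plane. -/
def edgeForm (m t : Plane) (p : MvPolynomial (Fin 2) ℝ) (v : Plane → ℝ) : ℝ :=
  ∫ s : ℝ, (ev (normalHess p (turn t)) (m + s • t) *
    (∑ j, turn t j * partialD j v (m + s • t)) -
      ev (shearForce p (turn t) t) (m + s • t) * v (m + s • t))

theorem IsTest.hessDot_eq_zero {W : Set Plane} {v : Plane → ℝ} (hv : IsTest W v)
    (p : MvPolynomial (Fin 2) ℝ) {x : Plane} (hx : x ∉ W) : hessDot p v x = 0 :=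
  Finset.sum_eq_zero fun i _ => Finset.sum_eq_zero fun j _ => by
    rw [((hv.partialD j).partialD i).eq_zero hx, mul_zero]

theorem setIntegral_inter_of_eq_zero {D H : Set Plane} (hH : MeasurableSet H) {g : Plane → ℝ}
    (hg : ∀ x, x ∉ D → g x = 0) : ∫ x in D ∩ H, g x = ∫ x in H, g x :=
  (setIntegral_eq_of_subset_of_forall_sdiff_eq_zero hH Set.inter_subset_right
    fun x hx => hg x fun h => hx.2 ⟨h, hx.1⟩).symm

theorem setIntegral_hessDot_sub {m t : Plane} (ht : t 0 ^ 2 + t 1 ^ 2 = 1) {D : Set Plane}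
    (p : MvPolynomial (Fin 2) ℝ) {v : Plane → ℝ} (hv : IsTest D v) :
    (∫ x in D ∩ halfPlane m (turn t), hessDot p v x) -
      (∫ x in D ∩ halfPlane m (turn t), ev (polyLap (polyLap p)) x * v x) = edgeForm m t p v := by
  have hH := (isOpen_halfPlane m (turn t)).measurableSet
  rw [setIntegral_inter_of_eq_zero hH fun x hx => hv.hessDot_eq_zero p hx,
    setIntegral_inter_of_eq_zero hH fun x hx => by rw [hv.eq_zero hx, mul_zero],
    setIntegral_halfPlane_hessDot m t ht p hv, add_sub_cancel_left, edgeForm]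
  simp only [ev_normalHess, ev_shearForce]

/-- Over the whole disc there is no boundary term, so the two halves contribute opposite ones. Both
sides of the edge are thus expressed by the same form, with the same normal. -/
theorem setIntegral_hessDot_sub_neg {m t : Plane} (ht : t 0 ^ 2 + t 1 ^ 2 = 1) {D : Set Plane}
    (p : MvPolynomial (Fin 2) ℝ) {v : Plane → ℝ} (hv : IsTest D v) :
    (∫ x in D ∩ halfPlane m (-turn t), hessDot p v x) -
      (∫ x in D ∩ halfPlane m (-turn t), ev (polyLap (polyLap p)) x * v x) =
        -edgeForm m t p v := by
  have h1 := setIntegral_hessDot_sub (m := m) ht p hv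
  have h2 := integral_hessDot p hv
  rw [← setIntegral_mul_test hv] at h2
  have h3 : ∫ x, hessDot p v x = ∫ x in D, hessDot p v x :=
    (setIntegral_eq_integral_of_forall_compl_eq_zero fun x hx => hv.hessDot_eq_zero p hx).symm
  rw [h3, setIntegral_split (m := m) ht (integrable_hessDot p hv).integrableOn,
    setIntegral_split (m := m) ht
      (integrable_mul_test (continuous_ev _) hv).integrableOn] at h2
  linarith

/-- Linearity in p is read off from the area integrals that represent the form. -/
theorem edgeForm_sub {m t : Plane} (ht : t 0 ^ 2 + t 1 ^ 2 = 1)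
    (p p' : MvPolynomial (Fin 2) ℝ) {W : Set Plane} {v : Plane → ℝ} (hv : IsTest W v) :
    edgeForm m t (p - p') v = edgeForm m t p v - edgeForm m t p' v := by
  rw [← setIntegral_hessDot_sub ht p hv, ← setIntegral_hessDot_sub ht p' hv,
    ← setIntegral_hessDot_sub ht (p - p') hv]
  have h1 : ∀ x, hessDot (p - p') v x = hessDot p v x - hessDot p' v x := fun x => by
    simp only [hessDot, map_sub, ev_sub, sub_mul, Finset.sum_sub_distrib]
  have h2 : polyLap (polyLap (p - p')) = polyLap (polyLap p) - polyLap (polyLap p') := by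
    simp only [polyLap, map_sub, Finset.sum_sub_distrib, map_sum]
  simp only [h1, h2, ev_sub, sub_mul]
  rw [integral_sub (integrable_hessDot p hv).integrableOn (integrable_hessDot p' hv).integrableOn,
    integral_sub (integrable_mul_test (continuous_ev _) hv).integrableOn
      (integrable_mul_test (continuous_ev _) hv).integrableOn]
  ring

/-- The residual equation on a disc which is cut by an edge. -/
theorem residual_add_residual {Ω D : Set Plane} (hΩ : IsOpen Ω) (hDΩ : D ⊆ Ω)
    {f u : Plane → ℝ} (hf : MemLp f 2 (volume.restrict Ω)) (hu : IsWeakSolution Ω f u)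
    {m t : Plane} (ht : t 0 ^ 2 + t 1 ^ 2 = 1) (p p' g g' : MvPolynomial (Fin 2) ℝ)
    {v : Plane → ℝ} (hv : IsTest D v) :
    edgeForm m t (p - p') v =
      -(residual Ω (D ∩ halfPlane m (turn t)) f u p g v -
          ∫ x in D ∩ halfPlane m (turn t), (ev g x - ev (polyLap (polyLap p)) x) * v x) -
        (residual Ω (D ∩ halfPlane m (-turn t)) f u p' g' v -
          ∫ x in D ∩ halfPlane m (-turn t), (ev g' x - ev (polyLap (polyLap p')) x) * v x) := by
  have hvΩ := hv.mono hDΩ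
  have hr : ∀ {g : Plane → ℝ}, MemLp g 2 (volume.restrict Ω) → MemLp g 2 (volume.restrict D) :=
    fun hg => hg.mono_measure (Measure.restrict_mono hDΩ le_rfl)
  have e1 := hu.test hΩ hvΩ
  have e2 : ∀ i j, ∫ x in Ω, weakPartial Ω i (weakPartial Ω j u) x *
      partialD i (partialD j v) x =
      (∫ x in D ∩ halfPlane m (turn t), weakPartial Ω i (weakPartial Ω j u) x *
        partialD i (partialD j v) x) +
      ∫ x in D ∩ halfPlane m (-turn t), weakPartial Ω i (weakPartial Ω j u) x *
        partialD i (partialD j v) x := fun i j => by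
    rw [setIntegral_mul_test ((hvΩ.partialD j).partialD i),
      ← setIntegral_mul_test ((hv.partialD j).partialD i)]
    exact setIntegral_split ht (integrable_mul_of_memLp (hr (memLp_hess hu.1.1 i j))
      (((hv.partialD j).partialD i).memLp D))
  rw [setIntegral_mul_test hvΩ, ← setIntegral_mul_test hv,
    setIntegral_split (m := m) ht (integrable_mul_of_memLp (hr hf) (hv.memLp D))] at e1
  simp only [e2, Finset.sum_add_distrib] at e1
  have hsub : ∀ (g p : MvPolynomial (Fin 2) ℝ) (S : Set Plane),
      ∫ x in S, (ev g x - ev (polyLap (polyLap p)) x) * v x =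
      (∫ x in S, ev g x * v x) - ∫ x in S, ev (polyLap (polyLap p)) x * v x := fun g p S => by
    simp only [sub_mul]
    exact integral_sub (integrable_mul_test (continuous_ev _) hv).integrableOn
      (integrable_mul_test (continuous_ev _) hv).integrableOn
  rw [edgeForm_sub ht p p' hv,
    residual_eq (Set.inter_subset_left.trans hDΩ) hf hu.1.1 p g hv,
    residual_eq (Set.inter_subset_left.trans hDΩ) hf hu.1.1 p' g' hv, hsub, hsub]
  have h1 := setIntegral_hessDot_sub (m := m) ht p hv
  have h2 := setIntegral_hessDot_sub_neg (m := m) ht p' hv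
  linarith

theorem rotation_symm_tangent {t : Plane} (ht : t 0 ^ 2 + t 1 ^ 2 = 1) :
    (rotation t ht).symm t = EuclideanSpace.single 0 1 := by
  rw [LinearIsometryEquiv.symm_apply_eq, rotation_apply]
  simp

theorem rotation_symm_turn {t : Plane} (ht : t 0 ^ 2 + t 1 ^ 2 = 1) :
    (rotation t ht).symm (turn t) = EuclideanSpace.single 1 1 := by
  rw [LinearIsometryEquiv.symm_apply_eq, rotation_apply]
  simp

/-- The boundary form of the edge bump associated with the jumps is coercive. -/
theorem le_edgeForm_edgeBump {m t : Plane} (ht : t 0 ^ 2 + t 1 ^ 2 = 1) {r : ℝ} (hr : 0 < r)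
    {p : MvPolynomial (Fin 2) ℝ} {a b : Polynomial ℝ}
    (ha : ∀ s, a.eval s = ev (normalHess p (turn t)) (m + s • (r • t)))
    (hb : ∀ s, b.eval s = r * ev (shearForce p (turn t) t) (m + s • (r • t))) :
    ∫ s in Set.Ioo (-(1 / 2) : ℝ) (1 / 2), (a.eval s ^ 2 + b.eval s ^ 2) ≤
      edgeForm m t p (fun x => edgeBump a b (toUnitDisc (rotation t ht).symm m r x)) := by
  set L := (rotation t ht).symm with hL
  set v : Plane → ℝ := fun x => edgeBump a b (toUnitDisc L m r x) with hv
  set G : ℝ → ℝ := fun s =>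
    cutoff (EuclideanSpace.single 0 s) * (a.eval s ^ 2 + b.eval s ^ 2) with hG
  have hpt : ∀ s : ℝ, toUnitDisc L m r (m + s • t) = EuclideanSpace.single 0 (r⁻¹ * s) := by
    intro s
    rw [toUnitDisc, add_sub_cancel_left, map_smul, hL, rotation_symm_tangent ht]
    ext i; fin_cases i <;> simp
  have hm : ∀ s : ℝ, m + s • t = m + (r⁻¹ * s) • (r • t) := fun s => by
    rw [smul_smul]; congr 2; field_simp
  have hnormal : ∀ x, ∑ j, turn t j * partialD j v x =
      r⁻¹ * partialD 1 (edgeBump a b) (toUnitDisc L m r x) := by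
    intro x
    have h1 : ∀ l, ∑ j, turn t j * L (EuclideanSpace.single j 1) l =
        (EuclideanSpace.single 1 1 : Plane) l := by
      intro l
      rw [← rotation_symm_turn ht, ← hL]
      have h2 : turn t = ∑ j, turn t j • (EuclideanSpace.single j (1 : ℝ) : Plane) := by
        ext j; fin_cases j <;> simp [Fin.sum_univ_two]
      conv_rhs => rw [h2, map_sum]
      simp
    have h0 := h1 0
    have h1' := h1 1
    simp only [hv, partialD_comp_toUnitDisc L m r (isTest_edgeBump a b).1]
    simp only [Fin.sum_univ_two] at h0 h1' ⊢
    simp at h0 h1'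
    simp only [turn_zero, turn_one]
    linear_combination (r⁻¹ * partialD 0 (edgeBump a b) (toUnitDisc L m r x)) * h0 +
      (r⁻¹ * partialD 1 (edgeBump a b) (toUnitDisc L m r x)) * h1'
  -- The normal derivative of v brings r⁻¹, and the shear force is r⁻¹b, so both products carry the
  -- same factor r⁻¹. This is why b contains r; the substitution along the line then removes every
  -- power of r.
  have hint : ∀ s : ℝ, (ev (normalHess p (turn t)) (m + s • t) *
      (∑ j, turn t j * partialD j v (m + s • t)) -
        ev (shearForce p (turn t) t) (m + s • t) * v (m + s • t)) = r⁻¹ * G (r⁻¹ * s) := by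
    intro s
    have e1 : ev (shearForce p (turn t) t) (m + (r⁻¹ * s) • (r • t)) =
        r⁻¹ * b.eval (r⁻¹ * s) := by
      rw [hb, inv_mul_cancel_left₀ hr.ne']
    rw [hnormal]
    simp only [hv, hpt]
    rw [hm, ← ha, e1, partialD_edgeBump_axis a b (by simp), edgeBump_axis a b (by simp)]
    simp [hG]
    ring
  have hcoord : Continuous fun s : ℝ => (EuclideanSpace.single 0 s : Plane) := by
    have : (fun s : ℝ => (EuclideanSpace.single 0 s : Plane)) =
        fun s => s • EuclideanSpace.single 0 1 := by
      funext s; ext i; fin_cases i <;> simp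
    rw [this]; fun_prop
  have hGc : Continuous G := (contDiff_cutoff.continuous.comp hcoord).mul
    ((a.continuous.pow 2).add (b.continuous.pow 2))
  have hGs : HasCompactSupport G := by
    refine HasCompactSupport.of_support_subset_isCompact (isCompact_Icc (a := -1) (b := 1))
      fun s hs => ?_
    have h1 : (EuclideanSpace.single 0 s : Plane) ∈ tsupport cutoff :=
      subset_tsupport _ (left_ne_zero_of_mul hs)
    have h2 := tsupport_cutoff h1
    rw [mem_ball_zero_iff, PiLp.norm_single, Real.norm_eq_abs, abs_lt] at h2
    exact ⟨h2.1.le, h2.2.le⟩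
  have hGi : Integrable G := hGc.integrable_of_hasCompactSupport hGs
  have hval : edgeForm m t p v = ∫ s, G s := by
    rw [edgeForm]
    simp only [hint]
    rw [integral_const_mul, Measure.integral_comp_mul_left G r⁻¹, inv_inv, abs_of_pos hr,
      smul_eq_mul, inv_mul_cancel_left₀ hr.ne']
  rw [hval]
  have e : ∫ s in Set.Ioo (-(1 / 2) : ℝ) (1 / 2), (a.eval s ^ 2 + b.eval s ^ 2) =
      ∫ s in Set.Ioo (-(1 / 2) : ℝ) (1 / 2), G s := by
    refine setIntegral_congr_fun measurableSet_Ioo fun s hs => ?_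
    have h1 : cutoff (EuclideanSpace.single 0 s) = 1 := cutoff_eq_one (by
      rw [PiLp.norm_single, Real.norm_eq_abs]
      exact (abs_lt.2 hs).le)
    simp only [hG, h1, one_mul]
  rw [e]
  exact setIntegral_le_integral hGi (ae_of_all _ fun s =>
    mul_nonneg (cutoff_nonneg _) (by positivity))

theorem edgeIntegral_le (K : PolygonalElement) (e : K.Edge) {g : Plane → ℝ} {B : ℝ}
    (hg : ∀ t ∈ Set.Icc (0 : ℝ) 1, g (K.edgePt e t) ≤ B) (hc : Continuous g) :
    K.edgeIntegral e g ≤ K.len e * B := by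
  refine mul_le_mul_of_nonneg_left ?_ (K.len_pos e).le
  have hcc : Continuous fun t => g (K.edgePt e t) := by
    refine hc.comp ?_
    unfold PolygonalElement.edgePt
    fun_prop
  have := intervalIntegral.integral_mono_on (μ := volume) zero_le_one
    (hcc.intervalIntegrable 0 1) (continuous_const.intervalIntegrable 0 1) hg
  simpa using this

theorem normalHess_sub (p p' : MvPolynomial (Fin 2) ℝ) (n : Plane) :
    normalHess (p - p') n = normalHess p n - normalHess p' n := by
  simp only [normalHess, map_sub, smul_sub, Finset.sum_sub_distrib]

theorem shearForce_sub (p p' : MvPolynomial (Fin 2) ℝ) (n t : Plane) :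
    shearForce (p - p') n t = shearForce p n t - shearForce p' n t := by
  have h : polyLap (p - p') = polyLap p - polyLap p' := by
    simp only [polyLap, map_sub, Finset.sum_sub_distrib]
  simp only [shearForce, h, map_sub, smul_sub, Finset.sum_sub_distrib]
  ring

/-- The arithmetic of the edge estimate. R, R' are the residuals and Z, Z' the element-residual
integrals on the two half-discs; A is the area factor times the sup bound of the squared test
function. The 4 counts these terms, and 80 = 5 · 16. -/
theorem sq_le_of_residual_bounds {r A I R R' Z Z' E E' O O' l l' z z' C : ℝ} (hr : 0 < r)
    (hA : 0 ≤ A) (hI : 0 ≤ I) (hlow : I ≤ -(R - Z) - (R' - Z'))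
    (hR : R ^ 2 ≤ 5 * A * (16 / r ^ 4 * E + l)) (hR' : R' ^ 2 ≤ 5 * A * (16 / r ^ 4 * E' + l'))
    (hZ : Z ^ 2 ≤ z * A) (hZ' : Z' ^ 2 ≤ z' * A) (hl : r ^ 4 * l ≤ O) (hl' : r ^ 4 * l' ≤ O')
    (hz : r ^ 4 * z ≤ C * (E + O)) (hz' : r ^ 4 * z' ≤ C * (E' + O')) (hO : 0 ≤ O) (hO' : 0 ≤ O') :
    (r ^ 2 * I) ^ 2 ≤ 4 * (A * ((80 + C) * ((E + E') + (O + O')))) := by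
  have h1 : I ^ 2 ≤ 4 * (R ^ 2 + Z ^ 2 + R' ^ 2 + Z' ^ 2) := by
    refine (pow_le_pow_left₀ hI hlow 2).trans ?_
    nlinarith [sq_nonneg (R - R'), sq_nonneg (R + Z), sq_nonneg (R + Z'), sq_nonneg (R' + Z),
      sq_nonneg (R' + Z'), sq_nonneg (Z - Z')]
  have hres : ∀ {X e y o : ℝ}, X ^ 2 ≤ 5 * A * (16 / r ^ 4 * e + y) → r ^ 4 * y ≤ o →
      r ^ 4 * X ^ 2 ≤ 5 * A * (16 * e + o) := fun {X e y o} hX ho => by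
    have h2 : r ^ 4 * (5 * A * (16 / r ^ 4 * e + y)) = 5 * A * (16 * e + r ^ 4 * y) := by
      field_simp
    refine (mul_le_mul_of_nonneg_left hX (by positivity)).trans (h2.le.trans ?_)
    gcongr
  have hvol : ∀ {X e o : ℝ}, X ^ 2 ≤ e * A → r ^ 4 * e ≤ o → r ^ 4 * X ^ 2 ≤ o * A :=
    fun {X e o} hX ho => by
      refine (mul_le_mul_of_nonneg_left hX (by positivity)).trans ?_
      rw [← mul_assoc]
      gcongr
  have p1 := hres hR hl
  have p2 := hres hR' hl'
  have p3 := hvol hZ hz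
  have p4 := hvol hZ' hz'
  calc (r ^ 2 * I) ^ 2 = r ^ 4 * I ^ 2 := by ring
    _ ≤ r ^ 4 * (4 * (R ^ 2 + Z ^ 2 + R' ^ 2 + Z' ^ 2)) := by gcongr
    _ ≤ 4 * (5 * A * (16 * E + O) + 5 * A * (16 * E' + O') + C * (E + O) * A +
        C * (E' + O') * A) := by linarith
    _ ≤ 4 * (A * ((80 + C) * ((E + E') + (O + O')))) := by
        have q1 : 0 ≤ A * O := by positivity
        have q2 : 0 ≤ A * O' := by positivity
        linarith

/-- Tests the equation with the edge bump built from both jumps at once; the element residuals on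
the two half-discs are absorbed by the element estimate. -/
theorem exists_jump_le (k : ℕ) {σ : ℝ} (hσ : 0 < σ) : ∃ C : ℝ, 0 ≤ C ∧
    ∀ (Ω : Set Plane) (_ : IsOpen Ω) (T : Mesh Ω) (_ : T.IsRegular σ)
      (f : Plane → ℝ) (_ : MemLp f 2 (volume.restrict Ω)) (u : Plane → ℝ)
      (_ : IsWeakSolution Ω f u) (p : Fin T.card → MvPolynomial (Fin 2) ℝ) (_ : ∀ K, p K ∈ Pk k)
      (K : Fin T.card) (e : (T.elem K).Edge) (K' : Fin T.card) (e' : (T.elem K').Edge)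
      (_ : T.IsInteriorEdge K e K' e'),
      momentJumpSq (T.elem K) e (p K) (p K') ≤
        C * ((energyErrorSq (T.elem K) u (p K) + energyErrorSq (T.elem K') u (p K')) +
          (oscSq k (T.elem K) f + oscSq k (T.elem K') f)) ∧
      shearJumpSq (T.elem K) e (p K) (p K') ≤
        C * ((energyErrorSq (T.elem K) u (p K) + energyErrorSq (T.elem K') u (p K')) +
          (oscSq k (T.elem K) f + oscSq k (T.elem K') f)) := by
  obtain ⟨C₁, hC₁, helem⟩ := exists_elementResidualSq_le k hσ
  set κ := edgeRatio σ with hκ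
  have hκ0 : 0 < κ := edgeRatio_pos hσ
  have hκ1 : κ < 1 / 2 := edgeRatio_lt hσ
  -- In units of the disc radius κh_e, the edge is an interval of half-length 1/(2κ), inside [-1/κ,
  -- 1/κ].
  obtain ⟨M, hM, hbound⟩ := exists_edge_bound k (1 / κ)
  have hV := discArea_nonneg
  set C₂ := 4 * discArea * M * (80 + C₁) with hC₂
  have hC₂0 : 0 ≤ C₂ := by positivity
  refine ⟨M * C₂ / κ ^ 2 + M * C₂ / κ ^ 4, by positivity, ?_⟩
  intro Ω hΩ T hT f hf u hu p hp K e K' e' he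
  obtain ⟨hD1, hD2, hDΩ⟩ := hT.disc_subset hσ he
  have hlen : (T.elem K').len e' = (T.elem K).len e := he.2.1.len_eq
  obtain ⟨N, τ, hτ⟩ := hT K
  obtain ⟨N', τ', hτ'⟩ := hT K'
  have hz := helem Ω hΩ (T.elem K) (T.subset K) N τ hτ f hf u hu (p K) (hp K)
  have hz' := helem Ω hΩ (T.elem K') (T.subset K') N' τ' hτ' f hf u hu (p K') (hp K')
  have hl := (T.elem K).len_pos e
  have hlh := (T.elem K).len_le_diam e
  have hlh' := (T.elem K').len_le_diam e'
  rw [hlen] at hlh'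
  have hu' := (T.elem K).tangent_unit e
  rw [PolygonalElement.normal_eq_turn] at hD1 hD2
  set t := (T.elem K).tangent e with ht
  set m := (T.elem K).midpoint e with hm
  set h := (T.elem K).len e with hh
  set r := κ * h with hr
  have hr0 : 0 < r := by positivity
  set d := p K - p K' with hd
  have hdm : d ∈ Pk k := Submodule.sub_mem _ (hp K) (hp K')
  -- a and b are the two jumps along the edge in the reference parameter, the second multiplied by r
  -- to match the scaling of the boundary form.
  obtain ⟨a, hak, ha⟩ := exists_eval_line (normalHess_mem hdm (turn t)) m (r • t)
  obtain ⟨b, hbk, hb⟩ := exists_eval_line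
    (Submodule.smul_mem _ r (shearForce_mem hdm (turn t) t)) m (r • t)
  simp only [ev_smul] at hb
  obtain ⟨b1, b2, b3, b4⟩ := hbound a b hak hbk
  have hlow := le_edgeForm_edgeBump hu' hr0 ha hb
  set I := ∫ s in Set.Ioo (-(1 / 2) : ℝ) (1 / 2), (a.eval s ^ 2 + b.eval s ^ 2) with hI
  have hI0 : 0 ≤ I := integral_nonneg fun _ => by positivity
  have hv := (isTest_edgeBump a b).comp_toUnitDisc (rotation t hu').symm m hr0
  set v : Plane → ℝ := fun x => edgeBump a b (toUnitDisc (rotation t hu').symm m r x) with hvd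
  have hvA : ∀ x, v x ^ 2 ≤ M * I := fun x => b1 _
  have hvA2 := sq_partialD_comp_toUnitDisc_le (rotation t hu').symm m hr0
    (isTest_edgeBump a b).1 b2
  set g := l2Proj k (T.elem K).carrier f with hg
  set g' := l2Proj k (T.elem K').carrier f with hg'
  have hR := sq_residual_le (T.subset K) hD1 hr0 Set.inter_subset_left hf hu.1.1 (p K) g hv hvA hvA2
  have hR' := sq_residual_le (T.subset K') hD2 hr0 Set.inter_subset_left hf hu.1.1 (p K') g' hv
    hvA hvA2
  have hZ := sq_setIntegral_mul_test_le hr0.le Set.inter_subset_left hD1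
    (memLp_of_continuous (T.elem K).isBounded_carrier
      ((continuous_ev g).sub (continuous_ev (polyLap (polyLap (p K)))))) hv hvA
  have hZ' := sq_setIntegral_mul_test_le hr0.le Set.inter_subset_left hD2
    (memLp_of_continuous (T.elem K').isBounded_carrier
      ((continuous_ev g').sub (continuous_ev (polyLap (polyLap (p K')))))) hv hvA
  have heq := residual_add_residual hΩ hDΩ hf hu (m := m) hu' (p K) (p K') g g'
    hv
  rw [← hd] at heq
  rw [heq] at hlow
  set R := residual Ω (Metric.ball m r ∩ halfPlane m (turn t)) f u (p K) g v
  set R' := residual Ω (Metric.ball m r ∩ halfPlane m (-turn t)) f u (p K') g' v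
  set Z := ∫ x in Metric.ball m r ∩ halfPlane m (turn t),
    (ev g x - ev (polyLap (polyLap (p K))) x) * v x
  set Z' := ∫ x in Metric.ball m r ∩ halfPlane m (-turn t),
    (ev g' x - ev (polyLap (polyLap (p K'))) x) * v x
  have hE := energyErrorSq_nonneg (T.elem K) u (p K)
  have hE' := energyErrorSq_nonneg (T.elem K') u (p K')
  have hO := oscSq_nonneg k (T.elem K) f
  have hO' := oscSq_nonneg k (T.elem K') f
  set E := energyErrorSq (T.elem K) u (p K)
  set E' := energyErrorSq (T.elem K') u (p K')
  -- comparison of the disc radius with the diameters of the elements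
  have hscale : ∀ (Q : PolygonalElement) (X : ℝ), h ≤ Q.diam → 0 ≤ X →
      r ^ 4 * X ≤ Q.diam ^ 4 * X := fun Q X hQ hX => by
    refine mul_le_mul_of_nonneg_right (pow_le_pow_left₀ hr0.le ?_ 4) hX
    refine le_trans ?_ hQ
    rw [hr]
    nlinarith
  have o1 : r ^ 4 * l2NormSq (T.elem K).carrier (fun x => f x - ev g x) ≤ oscSq k (T.elem K) f :=
    hscale _ _ hlh (l2NormSq_nonneg _ _)
  have o2 : r ^ 4 * l2NormSq (T.elem K').carrier (fun x => f x - ev g' x) ≤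
      oscSq k (T.elem K') f := hscale _ _ hlh' (l2NormSq_nonneg _ _)
  have o3 : r ^ 4 * (∫ x in (T.elem K).carrier, (ev g x - ev (polyLap (polyLap (p K))) x) ^ 2) ≤
      C₁ * (E + oscSq k (T.elem K) f) := (hscale _ _ hlh (l2NormSq_nonneg _ _)).trans hz
  have o4 : r ^ 4 * (∫ x in (T.elem K').carrier,
      (ev g' x - ev (polyLap (polyLap (p K'))) x) ^ 2) ≤
      C₁ * (E' + oscSq k (T.elem K') f) := (hscale _ _ hlh' (l2NormSq_nonneg _ _)).trans hz'
  set O := oscSq k (T.elem K) f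
  set O' := oscSq k (T.elem K') f
  set S := (E + E') + (O + O') with hS
  have hS0 : 0 ≤ S := by positivity
  -- Here A = r² · `discArea` · M · I, so the squared bound has the form r²I times C₂S and one
  -- factor r²I cancels.
  have hrI : r ^ 2 * I ≤ C₂ * S := by
    refine le_of_sq_le_mul (by positivity) (by positivity) ?_
    refine (sq_le_of_residual_bounds hr0 (by positivity) hI0 hlow hR hR' hZ hZ' o1 o2 o3 o4
      hO hO').trans (le_of_eq ?_)
    rw [hC₂]
    ring
  -- the jumps on the whole edge
  have hpt : ∀ s : ℝ, (T.elem K).edgePt e s = m + ((s - 1 / 2) / κ) • (r • t) := fun s => by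
    rw [PolygonalElement.edgePt_eq, smul_smul, hr, ← mul_assoc, div_mul_cancel₀ _ hκ0.ne']
  have hs : ∀ s ∈ Set.Icc (0 : ℝ) 1, |(s - 1 / 2) / κ| ≤ 1 / κ := fun s hs => by
    rw [abs_div, abs_of_pos hκ0]
    refine div_le_div_of_nonneg_right ?_ hκ0.le
    rw [abs_le]
    constructor <;> linarith [hs.1, hs.2]
  have hmom : momentJumpSq (T.elem K) e (p K) (p K') ≤ h * (h * (M * I)) := by
    refine mul_le_mul_of_nonneg_left (edgeIntegral_le _ _ (fun s hs' => ?_) ?_) hl.le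
    · rw [PolygonalElement.normal_eq_turn, ← ht, ← ev_normalHess, ← ev_normalHess, ← ev_sub,
        ← normalHess_sub, ← hd, hpt, ← ha]
      exact b3 _ (hs s hs')
    · simp only [← ev_normalHess]
      exact ((continuous_ev _).sub (continuous_ev _)).pow 2
  -- The division by r² undoes the factor r in b. With h = r/κ, the moment term becomes r²I times
  -- κ⁻² and the shear term r²I times κ⁻⁴, up to M.
  have hshear : shearJumpSq (T.elem K) e (p K) (p K') ≤ h ^ 3 * (h * (M * I / r ^ 2)) := by
    refine mul_le_mul_of_nonneg_left (edgeIntegral_le _ _ (fun s hs' => ?_) ?_) (by positivity)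
    · rw [PolygonalElement.normal_eq_turn, ← ht, ← ev_shearForce, ← ev_shearForce, ← ev_sub,
        ← shearForce_sub, ← hd, hpt, le_div_iff₀ (by positivity)]
      have := b4 _ (hs s hs')
      rw [hb, mul_pow] at this
      linarith
    · simp only [← ev_shearForce]
      exact ((continuous_ev _).sub (continuous_ev _)).pow 2
  have hc1 : 0 ≤ M * C₂ / κ ^ 2 * S := by positivity
  have hc2 : 0 ≤ M * C₂ / κ ^ 4 * S := by positivity
  constructor
  · calc momentJumpSq (T.elem K) e (p K) (p K') ≤ h * (h * (M * I)) := hmom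
      _ = M / κ ^ 2 * (r ^ 2 * I) := by rw [hr]; field_simp
      _ ≤ M / κ ^ 2 * (C₂ * S) := by gcongr
      _ = M * C₂ / κ ^ 2 * S := by ring
      _ ≤ _ := by rw [add_mul]; linarith
  · calc shearJumpSq (T.elem K) e (p K) (p K') ≤ h ^ 3 * (h * (M * I / r ^ 2)) := hshear
      _ = M / κ ^ 4 * (r ^ 2 * I) := by rw [hr]; field_simp
      _ ≤ M / κ ^ 4 * (C₂ * S) := by gcongr
      _ = M * C₂ / κ ^ 4 * S := by ring
      _ ≤ _ := by rw [add_mul]; linarith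

end

end IPVEM

open IPVEM

/-! ### The estimates for the projected discrete functions. -/

theorem theorem5p2 (k : ℕ) (hk : 2 ≤ k) (σ : ℝ) (hσ : 0 < σ) :
    ∃ C : ℝ, 0 < C ∧
      ∀ (Ω : Set Plane) (_ : IsPolygonalDomain Ω) (T : Mesh Ω) (_ : T.IsRegular σ)
        (f : Plane → ℝ) (_ : MeasureTheory.MemLp f 2 (MeasureTheory.volume.restrict Ω))
        (u : Plane → ℝ) (_ : IsWeakSolution Ω f u)
        (w : Fin T.card → Plane → ℝ) (_ : InVh k T w),
        (∀ K : Fin T.card,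
          elementResidualSq k (T.elem K) f (gradProj k (T.elem K) (w K)) ≤
            C * (energyErrorSq (T.elem K) u (gradProj k (T.elem K) (w K)) +
              oscSq k (T.elem K) f)) ∧
        (∀ (K : Fin T.card) (e : (T.elem K).Edge) (K' : Fin T.card) (e' : (T.elem K').Edge),
          T.IsInteriorEdge K e K' e' →
          momentJumpSq (T.elem K) e (gradProj k (T.elem K) (w K))
              (gradProj k (T.elem K') (w K')) ≤
            C * ((energyErrorSq (T.elem K) u (gradProj k (T.elem K) (w K)) +
                energyErrorSq (T.elem K') u (gradProj k (T.elem K') (w K'))) +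
              (oscSq k (T.elem K) f + oscSq k (T.elem K') f)) ∧
          shearJumpSq (T.elem K) e (gradProj k (T.elem K) (w K))
              (gradProj k (T.elem K') (w K')) ≤
            C * ((energyErrorSq (T.elem K) u (gradProj k (T.elem K) (w K)) +
                energyErrorSq (T.elem K') u (gradProj k (T.elem K') (w K'))) +
              (oscSq k (T.elem K) f + oscSq k (T.elem K') f))) := by
  obtain ⟨C₁, hC₁, h₁⟩ := exists_elementResidualSq_le k hσ
  obtain ⟨C₂, hC₂, h₂⟩ := exists_jump_le k hσ
  -- The sum serves all three estimates, since their right-hand sides are nonnegative; the 1 makes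
  -- the constant strictly positive.
  refine ⟨C₁ + C₂ + 1, by positivity, ?_⟩
  intro Ω hΩ T hT f hf u hu w _
  constructor
  · intro K
    obtain ⟨N, τ, hτ⟩ := hT K
    refine (h₁ Ω hΩ.1 (T.elem K) (T.subset K) N τ hτ f hf u hu _ (gradProj_mem _ _ _)).trans ?_
    have h0 := add_nonneg (energyErrorSq_nonneg (T.elem K) u (gradProj k (T.elem K) (w K)))
      (oscSq_nonneg k (T.elem K) f)
    exact mul_le_mul_of_nonneg_right (by linarith) h0
  · intro K e K' e' he
    have h0 := add_nonneg (add_nonneg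
      (energyErrorSq_nonneg (T.elem K) u (gradProj k (T.elem K) (w K)))
      (energyErrorSq_nonneg (T.elem K') u (gradProj k (T.elem K') (w K'))))
      (add_nonneg (oscSq_nonneg k (T.elem K) f) (oscSq_nonneg k (T.elem K') f))
    have h := h₂ Ω hΩ.1 T hT f hf u hu (fun K => gradProj k (T.elem K) (w K))
      (fun K => gradProj_mem _ _ _) K e K' e' he
    exact ⟨h.1.trans (mul_le_mul_of_nonneg_right (by linarith) h0),
      h.2.trans (mul_le_mul_of_nonneg_right (by linarith) h0)⟩
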